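/- **Theorem.** There are a single deterministic algorithm and absolute constants $c\in\mathbb N$ and $C\in\mathbb R$ such that the following holds for every real $0<\epsilon<1$ and every $n$. Let $G=(V,E)$ be a graph on $V=\{0,\dots,n-1\}$ which initially has no edges and is changed by a sequence of updates. Each update inserts an edge that is not in $G$ or deletes an edge that is in $G$, and the updates are revealed one at a time. The algorithm, which is given $n$ and $\epsilon$, maintains in memory, after each update, 1. a $(2+\epsilon)$-approximate minimum vertex cover of the current graph, that is, a set $S\subseteq V$ that meets every edge and satisfies $|S|\le(2+\epsilon)\,|T|$ for every vertex cover $T$ of $G$; and 2. a $(2+\epsilon)$-approximate maximum fractional matching of the current graph, that is, edge weights $0\le x(e)\le 1$ with $\sum_{e\ni v}x(e)\le 1$ for every node $v$, such that $\sum_{e\in E}y(e)\le(2+\epsilon)\sum_{e\in E}x(e)$ for every $y$ satisfying the same constraints. Starting from the empty graph, it spends at most $C\,\tau/\epsilon^{2}$ time in total on any sequence of $\tau$ updates, so its amortized update time is $O(1/\epsilon^2)$, independent of $n$. Time is the number of instructions executed by a unit-cost random access machine whose memory is initially zero. The machine stores integers of $w$ bits, for any $w$ with $2^w\ge((n+2)/\epsilon)^c$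 (that is, $w\geq c\log_2((n+2)/\epsilon)$), which it can add, subtract, multiply, compare and use as addresses. It also stores real numbers, on which it performs exact $+,-,\times,/$ and comparisons, without rounding and without conversion of reals to integers. -/

import Mathlib

/-! ## Vertex covers and fractional matchings -/

/-- `S` is an `α`-approximate minimum vertex cover of `G`. -/
def IsApproxMinVertexCover {V : Type*} (α : ℝ) (G : SimpleGraph V) (S : Finset V) : Prop :=
  G.IsVertexCover (S : Set V) ∧
    ∀ T : Finset V, G.IsVertexCover (T : Set V) → (S.card : ℝ) ≤ α * (T.card : ℝ)

open Classical in
/-- The edge weights `x` form a fractional matching of `G`: every edge has a weight in `[0, 1]`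
and every node receives total weight at most `1` from its incident edges. -/
def IsFractionalMatching {V : Type*} [Fintype V] (G : SimpleGraph V) (x : Sym2 V → ℝ) : Prop :=
  (∀ e ∈ G.edgeSet, 0 ≤ x e ∧ x e ≤ 1) ∧
    ∀ v : V, ∑ u ∈ Finset.univ.filter (fun u => G.Adj v u), x s(v, u) ≤ 1

open Classical in
/-- The size of a fractional matching: the total weight of the edges of `G`. -/
noncomputable def fracSize {V : Type*} [Fintype V] (G : SimpleGraph V) (x : Sym2 V → ℝ) : ℝ :=
  ∑ e ∈ Finset.univ.filter (fun e : Sym2 V => e ∈ G.edgeSet), x e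

/-- `x` is an `α`-approximate maximum fractional matching of `G`. -/
def IsApproxMaxFractionalMatching {V : Type*} [Fintype V] (α : ℝ) (G : SimpleGraph V)
    (x : Sym2 V → ℝ) : Prop :=
  IsFractionalMatching G x ∧
    ∀ y : Sym2 V → ℝ, IsFractionalMatching G y → fracSize G y ≤ α * fracSize G x

/-! ## Dynamic graphs -/

/-- An update of a dynamic graph on the node set `V`. -/
inductive EdgeUpdate (V : Type*) where
  | insert (u v : V)
  | delete (u v : V)

namespace EdgeUpdate

/-- Only absent edges are inserted, and only present edges are deleted. -/
def Legal {V : Type*} (G : SimpleGraph V) : EdgeUpdate V → Prop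
  | insert u v => u ≠ v ∧ ¬ G.Adj u v
  | delete u v => G.Adj u v

/-- The graph after an update. -/
def apply {V : Type*} (G : SimpleGraph V) : EdgeUpdate V → SimpleGraph V
  | insert u v => G ⊔ SimpleGraph.edge u v
  | delete u v => G.deleteEdges {s(u, v)}

/-- Every update of the sequence is legal at the time when it is made. -/
def LegalSeq {V : Type*} : SimpleGraph V → List (EdgeUpdate V) → Prop
  | _, [] => True
  | G, a :: as => a.Legal G ∧ LegalSeq (a.apply G) as

/-- The graph after a sequence of updates. -/
def applySeq {V : Type*} : SimpleGraph V → List (EdgeUpdate V) → SimpleGraph V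
  | G, [] => G
  | G, a :: as => applySeq (a.apply G) as

end EdgeUpdate

/-! ## The machine model

A random access machine with unit costs.  It has integer (word) registers and an integer memory,
used for counters, pointers and addresses, and real registers and a real memory.  Its arithmetic
on reals is exact, with comparisons but without rounding, and no real is ever turned into an
integer.  An integer never exceeds the word size: an instruction whose integer result is not
below the word bound is a fault.  So is a division by `0`.  The machine is deterministic. -/

namespace RAM

/-- The instructions.  `d`, `a`, `b`, `s` are register numbers, `k` is a constant and `l` is the
number of an instruction. -/
inductive Instr where
  /-- put the integer `k` into register `d` -/
  | const (d k : ℕ)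
  /-- integer addition -/
  | add (d a b : ℕ)
  /-- integer subtraction, with result `0` where the difference is negative -/
  | sub (d a b : ℕ)
  /-- integer multiplication -/
  | mul (d a b : ℕ)
  /-- read the integer memory at the address in integer register `a` -/
  | load (d a : ℕ)
  /-- write integer register `s` to the integer memory at the address in integer register `a` -/
  | store (a s : ℕ)
  /-- jump to `l` if integer register `a` is at most integer register `b` -/
  | jle (a b l : ℕ)
  /-- copy integer register `a` to real register `d` -/
  | cast (d a : ℕ)
  /-- real addition -/
  | radd (d a b : ℕ)
  /-- real subtraction -/
  | rsub (d a b : ℕ)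
  /-- real multiplication -/
  | rmul (d a b : ℕ)
  /-- real division -/
  | rdiv (d a b : ℕ)
  /-- read the real memory at the address in integer register `a` -/
  | rload (d a : ℕ)
  /-- write real register `s` to the real memory at the address in integer register `a` -/
  | rstore (a s : ℕ)
  /-- jump to `l` if real register `a` is at most real register `b` -/
  | rjle (a b l : ℕ)

/-- A program is a finite list of instructions.  It halts when the program counter leaves the
list. -/
abbrev Program := List Instr

/-- A configuration of the machine. -/
structure Config where
  /-- program counter -/
  pc : ℕ
  /-- integer registers -/
  ireg : ℕ → ℕ
  /-- real registers -/
  rreg : ℕ → ℝ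
  /-- integer memory -/
  imem : ℕ → ℕ
  /-- real memory -/
  rmem : ℕ → ℝ

/-- Write the integer `x` into register `d` and go on, unless `x` does not fit into a word. -/
def Config.setInt (B : ℕ) (c : Config) (d x : ℕ) : Option Config :=
  if x < B then some { c with pc := c.pc + 1, ireg := Function.update c.ireg d x } else none

/-- Write the real `x` into register `d` and go on. -/
def Config.setReal (c : Config) (d : ℕ) (x : ℝ) : Config :=
  { c with pc := c.pc + 1, rreg := Function.update c.rreg d x }

/-- Execute one instruction, with words holding the integers below `B`; `none` is a fault. -/
noncomputable def exec (B : ℕ) (c : Config) : Instr → Option Config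
  | .const d k => c.setInt B d k
  | .add d a b => c.setInt B d (c.ireg a + c.ireg b)
  | .sub d a b => c.setInt B d (c.ireg a - c.ireg b)
  | .mul d a b => c.setInt B d (c.ireg a * c.ireg b)
  | .load d a => c.setInt B d (c.imem (c.ireg a))
  | .store a s =>
      some { c with pc := c.pc + 1, imem := Function.update c.imem (c.ireg a) (c.ireg s) }
  | .jle a b l => some { c with pc := if c.ireg a ≤ c.ireg b then l else c.pc + 1 }
  | .cast d a => some (c.setReal d (c.ireg a : ℝ))
  | .radd d a b => some (c.setReal d (c.rreg a + c.rreg b))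
  | .rsub d a b => some (c.setReal d (c.rreg a - c.rreg b))
  | .rmul d a b => some (c.setReal d (c.rreg a * c.rreg b))
  | .rdiv d a b => if c.rreg b = 0 then none else some (c.setReal d (c.rreg a / c.rreg b))
  | .rload d a => some (c.setReal d (c.rmem (c.ireg a)))
  | .rstore a s =>
      some { c with pc := c.pc + 1, rmem := Function.update c.rmem (c.ireg a) (c.rreg s) }
  | .rjle a b l => some { c with pc := if c.rreg a ≤ c.rreg b then l else c.pc + 1 }

/-- `Runs B P c t c'`: started in `c`, the program `P` halts after exactly `t` instructions, without
a fault, in the configuration `c'`. -/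
inductive Runs (B : ℕ) (P : Program) : Config → ℕ → Config → Prop where
  | halt (c : Config) : P[c.pc]? = none → Runs B P c 0 c
  | step (c d e : Config) (i : Instr) (t : ℕ) :
      P[c.pc]? = some i → exec B c i = some d → Runs B P d t e → Runs B P c (t + 1) e

/-- The initial configuration, for the empty graph on `n` nodes: `n` is in integer register `3`, `ε`
is in real register `0`, and everything else is `0`. -/
noncomputable def init (n : ℕ) (ε : ℝ) : Config where
  pc := 0
  ireg := Function.update (fun _ => 0) 3 n
  rreg := Function.update (fun _ => 0) 0 ε
  imem := fun _ => 0
  rmem := fun _ => 0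

/-- Hand an update to the machine: integer register `0` gets the kind of the update (`1` for an
insertion, `0` for a deletion), integer registers `1` and `2` get the endpoints of the edge, and the
program restarts.  All other registers and the memory keep their contents. -/
def feed {n : ℕ} (c : Config) : EdgeUpdate (Fin n) → Config
  | .insert u v => { c with
      pc := 0
      ireg := Function.update (Function.update (Function.update c.ireg 0 1) 1 u) 2 v }
  | .delete u v => { c with
      pc := 0
      ireg := Function.update (Function.update (Function.update c.ireg 0 0) 1 u) 2 v }

/-- `Handles B P c us t c'`: from the configuration `c`, the program `P` handles the updates `us` one
after the other, each one before the next is known, with `t` instructions in total, and ends in the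
configuration `c'`. -/
def Handles (B : ℕ) (P : Program) {n : ℕ} :
    Config → List (EdgeUpdate (Fin n)) → ℕ → Config → Prop
  | c, [], t, c' => t = 0 ∧ c' = c
  | c, a :: as, t, c' => ∃ (t₁ t₂ : ℕ) (d : Config),
      Runs B P (feed c a) t₁ d ∧ Handles B P d as t₂ c' ∧ t = t₁ + t₂

/-- The node set that the machine maintains on the node set `Fin n`: the integer memory cell `v`
holds `1` if and only if the node `v` belongs to it. -/
def Config.nodes (c : Config) (n : ℕ) : Finset (Fin n) :=
  Finset.univ.filter fun v => c.imem v = 1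

/-- The real memory holds the weight `x e` of each edge `e = {u, v}` of the graph, in the cells
`u * n + v` and `v * n + u`. -/
def Config.HoldsWeights (c : Config) {n : ℕ} (G : SimpleGraph (Fin n)) (x : Sym2 (Fin n) → ℝ) :
    Prop :=
  ∀ u v : Fin n, G.Adj u v → c.rmem ((u : ℕ) * n + (v : ℕ)) = x s(u, v)

end RAM

/-! ## The potential function -/

namespace DynCover

open Finset

/-! Put δ = ε/64, give every node v a level ℓ(v), and give the edge uv the weight (1+δ)^(-max(ℓ(u),
ℓ(v))). Let W(v) be the total weight at v. Suppose that W(v) ≤ 1 always and W(v) ≥ 1 - 12δ above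
level 0 (`Stable`). Then the weights are a fractional matching, and the nodes with W(v) ≥ 1 - 12δ
form a vertex cover, because an edge between two other nodes would lie on level 0 and have weight 1.
The cover has at most ΣW/(1 - 12δ) nodes, ΣW is twice the size of the matching, and no fractional
matching exceeds a vertex cover. So both are optimal up to the factor 2/(1 - 12δ) ≤ 2 + ε
(`Stable.approx_cover`, `Stable.approx_matching`).

An update is repaired by raising nodes with W > 1, and lowering nodes above level 0 with W < 1 -
12δ, one level at a time. A move alters only edges to neighbours that are not above the node. These
edges lie in one bucket, so the move takes time proportional to their number plus a constant; the
neighbours whose weight has changed go onto a stack of nodes to be examined.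

The time is amortized with a potential. Measure the load of v as x = (1+δ)^ℓ(v) W(v) and compare it
with the threshold T = (1-δ)(1+δ)^ℓ(v). The node holds K times the excess of x over T, the slightly
smaller multiple K - 6Kδ of the deficit if ℓ(v) > 0, and 3Kδ(d - x), where d is the degree. A move
shifts T towards x by about a fraction δ, while each low neighbour sees its load change by at most
δ. The unequal coefficients and the term in d - x leave a surplus of order Kδ²(1+δ)^ℓ(v), which pays
for the move once K is a large multiple of 1/δ² (`nodePot_raise`, `nodePot_drop`, summed up in
`pot_raise`, `pot_drop`). An update itself increases the potential by O(K) = O(1/ε²).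

An inserted edge may overload an endpoint by more than the factor 1 + δ that `pot_raise` tolerates.
The raises that follow are therefore accounted for in the old graph, where an offset of 1 at the two
endpoints stands for the new edge (`Covers`, `tri_drain`); afterwards the potential is converted to
the new graph.

The algorithm is written in a structured language whose compilation costs a factor of 8
(`Big.steps`). Each stack entry carries potential 100, so the bound on the potential also bounds the
stacks, and thereby the word length (`exists_env`). -/

/-- The contribution of a node on level `i` with offset `o`, degree `d` and scaled load `x`. -/
noncomputable def nodePot (K δ : ℝ) (i : ℕ) (o d x : ℝ) : ℝ :=
  K * max (x + o - (1 - δ) * (1 + δ) ^ i) 0 +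
    (if i = 0 then 0 else (K - 6 * K * δ) * max ((1 - δ) * (1 + δ) ^ i - x - o) 0) +
    3 * K * δ * (d - x)

theorem nodePot_nonneg {K δ : ℝ} (hK : 0 ≤ K) (h0 : 0 < δ) (h1 : δ ≤ 1 / 64) (i : ℕ)
    {o d x : ℝ} (hx : x ≤ d) : 0 ≤ nodePot K δ i o d x := by
  have hB : 0 ≤ K - 6 * K * δ := by nlinarith
  unfold nodePot
  have h2 : 0 ≤ 3 * K * δ * (d - x) := by
    have : 0 ≤ d - x := by linarith
    positivity
  have h3 : 0 ≤ if i = 0 then 0 else (K - 6 * K * δ) * max ((1 - δ) * (1 + δ) ^ i - x - o) 0 := by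
    split_ifs
    · exact le_rfl
    · exact mul_nonneg hB (le_max_right _ _)
  have h4 : 0 ≤ K * max (x + o - (1 - δ) * (1 + δ) ^ i) 0 := mul_nonneg hK (le_max_right _ _)
  linarith

/-- The scaled load may be changed at a bounded price. -/
theorem nodePot_le_of_load {K δ : ℝ} (hK : 0 ≤ K) (h0 : 0 < δ) (h1 : δ ≤ 1 / 64) (i : ℕ)
    {o o' d d' x x' a b e : ℝ} (ha : 0 ≤ a) (hb : 0 ≤ b)
    (hup : x' + o' ≤ x + o + a) (hdown : x + o ≤ x' + o' + b) (he : d' - x' ≤ d - x + e) :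
    nodePot K δ i o' d' x' ≤
      nodePot K δ i o d x + K * a + (K - 6 * K * δ) * b + 3 * K * δ * e := by
  have hB : 0 ≤ K - 6 * K * δ := by nlinarith
  unfold nodePot
  set T := (1 - δ) * (1 + δ) ^ i
  have m1 : max (x' + o' - T) 0 ≤ max (x + o - T) 0 + a := by
    apply max_le
    · linarith [le_max_left (x + o - T) 0]
    · linarith [le_max_right (x + o - T) 0]
  have m2 : max (T - x' - o') 0 ≤ max (T - x - o) 0 + b := by
    apply max_le
    · linarith [le_max_left (T - x - o) 0]
    · linarith [le_max_right (T - x - o) 0]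
  have m1' := mul_le_mul_of_nonneg_left m1 hK
  have m2' := mul_le_mul_of_nonneg_left m2 hB
  have m3 : 3 * K * δ * (d' - x') ≤ 3 * K * δ * (d - x + e) :=
    mul_le_mul_of_nonneg_left he (by positivity)
  have hb' : 0 ≤ (K - 6 * K * δ) * b := mul_nonneg hB hb
  split_ifs
  · nlinarith
  · nlinarith

/-- Only the part H of the load, from higher neighbours, is multiplied by 1 + δ, while the threshold
grows by (1 - δ)δS. The node releases Kδ((1 - δ)S - (1 - 3δ)H). Paying (K - 3Kδ)δ for each of the D
other neighbours leaves at least Kδ²S(1 + 3δ), since D + H ≤ (1 + δ)S and (1 - δ) - (1 - 3δ)(1 + δ)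
= δ + 3δ². Without the term 3Kδ(d - x) nothing would be left for large H. -/
theorem nodePot_raise {K δ c S : ℝ} (hc : 0 ≤ c) (h0 : 0 < δ) (h1 : δ ≤ 1 / 64)
    (hK : 4 * c ≤ K * δ ^ 2) (hK0 : 0 ≤ K) {i : ℕ} (hS : S = (1 + δ) ^ i)
    {o d D H : ℝ} (hD : 0 ≤ D) (hH : 0 ≤ H) (hlow : S < D + H + o)
    (hhigh : D + H ≤ (1 + δ) * S) :
    nodePot K δ (i + 1) o d (D + (1 + δ) * H) + (K - 3 * K * δ) * δ * D + c * (D + 2) ≤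
      nodePot K δ i o d (D + H) := by
  have hS1 : 1 ≤ S := by rw [hS]; exact one_le_pow₀ (by linarith)
  unfold nodePot
  rw [pow_succ, ← hS]
  -- Because (1 - δ)(1 + δ) < 1, a node whose load with offset exceeds S is still above its
  -- threshold after the raise, so only the upper part of the potential is involved.
  have e1 : max (D + (1 + δ) * H + o - (1 - δ) * (S * (1 + δ))) 0 =
      D + (1 + δ) * H + o - (1 - δ) * (S * (1 + δ)) := by
    apply max_eq_left
    nlinarith [mul_nonneg h0.le hH, mul_pos h0 h0, mul_pos (mul_pos h0 h0) (by linarith : 0 < S)]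
  have e2 : max ((1 - δ) * (S * (1 + δ)) - (D + (1 + δ) * H) - o) 0 = 0 := by
    apply max_eq_right
    nlinarith [mul_nonneg h0.le hH, mul_pos h0 h0, mul_pos (mul_pos h0 h0) (by linarith : 0 < S)]
  have e3 : max (D + H + o - (1 - δ) * S) 0 = D + H + o - (1 - δ) * S := by
    apply max_eq_left; nlinarith
  have e4 : max ((1 - δ) * S - (D + H) - o) 0 = 0 := by
    apply max_eq_right; nlinarith
  rw [e1, e2, e3, e4]
  have hDS : D + 2 ≤ 4 * S := by nlinarith
  have f1 : c * (D + 2) ≤ K * δ ^ 2 * S := by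
    calc c * (D + 2) ≤ c * (4 * S) := mul_le_mul_of_nonneg_left hDS hc
      _ = 4 * c * S := by ring
      _ ≤ K * δ ^ 2 * S := mul_le_mul_of_nonneg_right hK (by linarith)
  have f2 : K * δ * (1 - 3 * δ) * (D + H) ≤ K * δ * (1 - 3 * δ) * ((1 + δ) * S) :=
    mul_le_mul_of_nonneg_left hhigh (by
      have : 0 ≤ 1 - 3 * δ := by linarith
      positivity)
  have f3 : 0 ≤ K * δ ^ 3 * S := by positivity
  simp only [mul_zero, ite_self]
  nlinarith

/-- The threshold and the part H of the load shrink by the factor q, while D stays. What is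
released, less K(1 - q)D for the lower neighbours and the growth of 3Kδ(d - x), is at least (1 -
q)K·5δS. As 1 - q = qδ, this is of order Kδ²S. -/
theorem nodePot_drop {K δ c S q : ℝ} (hc : 0 ≤ c) (h0 : 0 < δ) (h1 : δ ≤ 1 / 64)
    (hK : 4 * c ≤ K * δ ^ 2) (hK0 : 0 ≤ K) {i : ℕ} (hS : S = (1 + δ) ^ (i + 1))
    (hq : q = (1 + δ)⁻¹) {d D H : ℝ} (hD : 0 ≤ D) (hH : 0 ≤ H)
    (hlow : D + H < (1 - 12 * δ) * S) :
    nodePot K δ i 0 d (D + q * H) + K * (1 - q) * D + c * (3 * S) ≤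
      nodePot K δ (i + 1) 0 d (D + H) := by
  have hS1 : 1 ≤ S := by rw [hS]; exact one_le_pow₀ (by linarith)
  have hB : 0 ≤ K - 6 * K * δ := by nlinarith
  have hq0 : 0 < q := by rw [hq]; positivity
  have hq1 : q * (1 + δ) = 1 := by rw [hq]; field_simp
  have hqS : (1 + δ) ^ i = q * S := by
    rw [hS, pow_succ]; linear_combination (-(1 + δ) ^ i) * hq1
  have hqd : 1 - q = q * δ := by linarith
  have hq2 : 15 / 16 ≤ q := by nlinarith
  have hql : q ≤ 1 := by nlinarith
  unfold nodePot
  rw [← hS, hqS]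
  -- The distance between 1 - 12δ and 1 - δ absorbs the factor q: the node stays below its new
  -- threshold and the upper part remains 0.
  have hx : D + q * H ≤ (1 - δ) * (q * S) := by
    have a1 : D + H ≤ (1 - 12 * δ) * S := hlow.le
    have a2 : q * H ≤ H := by nlinarith
    have a3 : (1 - 12 * δ) * S ≤ (1 - δ) * (q * S) := by
      have : (1 - 12 * δ) ≤ (1 - δ) * q := by nlinarith
      nlinarith
    linarith
  have e1 : max (D + q * H + 0 - (1 - δ) * (q * S)) 0 = 0 := by
    apply max_eq_right; linarith
  have e2 : max ((1 - δ) * (q * S) - (D + q * H) - 0) 0 = (1 - δ) * (q * S) - (D + q * H) := by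
    rw [max_eq_left]
    · ring
    · linarith
  have e3 : max (D + H + 0 - (1 - δ) * S) 0 = 0 := by
    apply max_eq_right; nlinarith
  have e4 : max ((1 - δ) * S - (D + H) - 0) 0 = (1 - δ) * S - (D + H) := by
    rw [max_eq_left]
    · ring
    · nlinarith
  rw [e1, e2, e3, e4, if_neg (Nat.succ_ne_zero i)]
  -- The loss in (1 - 6δ)(1 - δ) is at most 7δ, so a load below (1 - 12δ)S leaves 5δS.
  have key : (1 - q) * K * (5 * δ * S) ≤
      (1 - q) * ((K - 6 * K * δ) * ((1 - δ) * S - H) - 3 * K * δ * H - K * D) := by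
    rw [mul_assoc]
    apply mul_le_mul_of_nonneg_left _ (by linarith)
    have a1 : K * (D + H) ≤ K * ((1 - 12 * δ) * S) := mul_le_mul_of_nonneg_left hlow.le hK0
    have a2 : 0 ≤ K * δ * H := by positivity
    have a3 : 0 ≤ K * δ * δ * S := by positivity
    nlinarith
  have f1 : c * (3 * S) ≤ (1 - q) * K * (5 * δ * S) := by
    have a1 : 4 * c * S ≤ K * δ ^ 2 * S := mul_le_mul_of_nonneg_right hK (by linarith)
    have a2 : K * δ ^ 2 * S ≤ (1 - q) * K * (5 * δ * S) := by
      rw [hqd]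
      have : 0 ≤ K * δ ^ 2 * S := by positivity
      nlinarith
    nlinarith
  -- A node arriving on level 0 gives up its lower part altogether, which only helps.
  have h2 : (if i = 0 then 0 else (K - 6 * K * δ) * ((1 - δ) * (q * S) - (D + q * H))) ≤
      (K - 6 * K * δ) * ((1 - δ) * (q * S) - (D + q * H)) := by
    split_ifs
    · apply mul_nonneg hB; linarith
    · exact le_rfl
  nlinarith

/-! ### Levelled graphs: scaled loads and the total potential -/

variable {V : Type*}

/-- `G'` arises from `G` by the insertion of the edge `{u, v}`. -/
structure EdgeAdded (G G' : SimpleGraph V) (u v : V) : Prop where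
  ne : u ≠ v
  not_adj : ¬ G.Adj u v
  adj : G'.Adj u v
  iff : ∀ w x, s(w, x) ≠ s(u, v) → (G'.Adj w x ↔ G.Adj w x)

theorem EdgeAdded.symm {G G' : SimpleGraph V} {u v : V} (h : EdgeAdded G G' u v) :
    EdgeAdded G G' v u :=
  ⟨h.ne.symm, fun a => h.not_adj a.symm, h.adj.symm,
    fun w x hw => h.iff w x (by rwa [Sym2.eq_swap (a := u)])⟩

variable [Fintype V]

open Classical in
/-- The load of `v` in units of the weight of an edge on the level of `v`. -/
noncomputable def load (δ : ℝ) (G : SimpleGraph V) (ℓ : V → ℕ) (v : V) : ℝ :=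
  ∑ u, if G.Adj v u then ((1 + δ)⁻¹) ^ (ℓ u - ℓ v) else 0

open Classical in
noncomputable def deg (G : SimpleGraph V) (v : V) : ℝ := ∑ u, if G.Adj v u then (1 : ℝ) else 0

/-- The potential of a levelled graph. -/
noncomputable def pot (K δ : ℝ) (G : SimpleGraph V) (ℓ : V → ℕ) (o : V → ℝ) : ℝ :=
  ∑ v, nodePot K δ (ℓ v) (o v) (deg G v) (load δ G ℓ v)

open Classical in
/-- The number of neighbours of `v` that are not above `v`. -/
noncomputable def lowCount (G : SimpleGraph V) (ℓ : V → ℕ) (v : V) : ℕ :=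
  (univ.filter fun u => G.Adj v u ∧ ℓ u ≤ ℓ v).card

theorem inv_pow_le_one {δ : ℝ} (h0 : 0 < δ) (k : ℕ) : ((1 + δ)⁻¹) ^ k ≤ 1 :=
  pow_le_one₀ (by positivity) (inv_le_one_of_one_le₀ (by linarith))

theorem load_le_deg {δ : ℝ} (h0 : 0 < δ) (G : SimpleGraph V) (ℓ : V → ℕ) (v : V) :
    load δ G ℓ v ≤ deg G v := by
  classical
  unfold load deg
  refine sum_le_sum fun u _ => ?_
  split_ifs
  · exact inv_pow_le_one h0 _
  · exact le_rfl

theorem load_nonneg {δ : ℝ} (h0 : 0 < δ) (G : SimpleGraph V) (ℓ : V → ℕ) (v : V) :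
    0 ≤ load δ G ℓ v := by
  classical
  unfold load
  refine sum_nonneg fun u _ => ?_
  split_ifs <;> positivity

theorem deg_le_card (G : SimpleGraph V) (v : V) : deg G v ≤ Fintype.card V := by
  classical
  unfold deg
  calc _ ≤ ∑ u : V, (1 : ℝ) := sum_le_sum fun u _ => by split_ifs <;> norm_num
    _ = _ := by simp

theorem pot_nonneg {K δ : ℝ} (hK : 0 ≤ K) (h0 : 0 < δ) (h1 : δ ≤ 1 / 64) (G : SimpleGraph V)
    (ℓ : V → ℕ) (o : V → ℝ) : 0 ≤ pot K δ G ℓ o :=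
  sum_nonneg fun v _ => nodePot_nonneg hK h0 h1 _ (load_le_deg h0 G ℓ v)

theorem pot_bot {K δ : ℝ} (h1 : δ ≤ 1 / 64) :
    pot K δ (⊥ : SimpleGraph V) (fun _ => 0) (fun _ => 0) = 0 := by
  unfold pot
  refine sum_eq_zero fun v _ => ?_
  simp [nodePot, load, deg]
  right; linarith

/-- A crude bound that plays no role for the time: it limits the stacks, and with them the memory
and the word length. -/
theorem pot_le {K δ : ℝ} (hK : 0 ≤ K) (h0 : 0 < δ) (h1 : δ ≤ 1 / 64) (G : SimpleGraph V)
    (ℓ : V → ℕ) (o : V → ℝ) {N : ℝ} (hN : (Fintype.card V : ℝ) ≤ N) (hN1 : 1 ≤ N)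
    (ho : ∀ v, 0 ≤ o v ∧ o v ≤ 1) (hℓ : ∀ v, (1 + δ) ^ ℓ v ≤ 2 * N) :
    pot K δ G ℓ o ≤ 6 * K * N ^ 2 := by
  have hB : 0 ≤ K - 6 * K * δ := by nlinarith
  have key : ∀ v, nodePot K δ (ℓ v) (o v) (deg G v) (load δ G ℓ v) ≤ 6 * K * N := by
    intro v
    have l1 := load_le_deg h0 G ℓ v
    have l2 := load_nonneg h0 G ℓ v
    have l3 := (deg_le_card G v).trans hN
    obtain ⟨o1, o2⟩ := ho v
    have l4 := hℓ v
    have l5 : 0 < (1 + δ) ^ ℓ v := by positivity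
    unfold nodePot
    have m1 : max (load δ G ℓ v + o v - (1 - δ) * (1 + δ) ^ ℓ v) 0 ≤ 2 * N := by
      apply max_le <;> nlinarith
    have m2 : max ((1 - δ) * (1 + δ) ^ ℓ v - load δ G ℓ v - o v) 0 ≤ 2 * N := by
      apply max_le <;> nlinarith
    have m1' := mul_le_mul_of_nonneg_left m1 hK
    have m2' := mul_le_mul_of_nonneg_left m2 hB
    have m3 : 3 * K * δ * (deg G v - load δ G ℓ v) ≤ 3 * K * δ * N :=
      mul_le_mul_of_nonneg_left (by linarith) (by positivity)
    have m4 : K * δ * N ≤ K * (1 / 64) * N := by gcongr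
    have m5 : 0 ≤ K * N := by positivity
    have m6 : 0 ≤ K * δ * N := by positivity
    have m7 : (if ℓ v = 0 then 0 else (K - 6 * K * δ) *
        max ((1 - δ) * (1 + δ) ^ ℓ v - load δ G ℓ v - o v) 0) ≤ 2 * K * N := by
      split_ifs
      · linarith
      · nlinarith
    nlinarith
  unfold pot
  calc _ ≤ ∑ _v : V, 6 * K * N := sum_le_sum fun v _ => key v
    _ = Fintype.card V * (6 * K * N) := by simp
    _ ≤ N * (6 * K * N) := mul_le_mul_of_nonneg_right hN (by positivity)
    _ = _ := by ring

/-- Changing the level of `v` changes the load of another node only through the edge to `v`. -/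
theorem load_update_of_ne [DecidableEq V] {δ : ℝ} (G : SimpleGraph V) (ℓ : V → ℕ) {v w : V}
    (h : w ≠ v) (k : ℕ) [Decidable (G.Adj w v)] :
    load δ G (Function.update ℓ v k) w = load δ G ℓ w +
      if G.Adj w v then ((1 + δ)⁻¹) ^ (k - ℓ w) - ((1 + δ)⁻¹) ^ (ℓ v - ℓ w) else 0 := by
  classical
  unfold load
  rw [← sub_eq_iff_eq_add', ← sum_sub_distrib, Finset.sum_eq_single v]
  · simp only [Function.update_self, Function.update_of_ne h]
    split_ifs <;> simp
  · intro u _ hu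
    simp [Function.update_of_ne h, Function.update_of_ne hu]
  · simp

open Classical in
theorem lowCount_eq (G : SimpleGraph V) (ℓ : V → ℕ) (v : V) :
    (lowCount G ℓ v : ℝ) = ∑ u, if G.Adj v u ∧ ℓ u ≤ ℓ v then (1 : ℝ) else 0 := by
  unfold lowCount
  rw [Finset.sum_boole]

/-- The surplus of `nodePot_raise` at v is distributed to the neighbours. Those above v do not
notice the raise, since their edges to v keep their level; each of the others loses at most δ of its
load. -/
theorem pot_raise [DecidableEq V] {K δ c : ℝ} (hc : 0 ≤ c) (h0 : 0 < δ) (h1 : δ ≤ 1 / 64)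
    (hK : 4 * c ≤ K * δ ^ 2) (hK0 : 0 ≤ K) (G : SimpleGraph V) (ℓ : V → ℕ) (o : V → ℝ) (v : V)
    (hlow : (1 + δ) ^ ℓ v < load δ G ℓ v + o v)
    (hhigh : load δ G ℓ v ≤ (1 + δ) * (1 + δ) ^ ℓ v) :
    pot K δ G (Function.update ℓ v (ℓ v + 1)) o + c * (lowCount G ℓ v + 2) ≤ pot K δ G ℓ o := by
  classical
  set ℓ' := Function.update ℓ v (ℓ v + 1) with hℓ'
  set q := (1 + δ)⁻¹ with hq
  have hq0 : 0 < q := by positivity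
  have hq1 : q * (1 + δ) = 1 := by rw [hq]; field_simp
  have hql : q ≤ 1 := by nlinarith
  have hB : 0 ≤ K - 3 * K * δ := by nlinarith
  set H : ℝ := ∑ u, if G.Adj v u ∧ ¬ ℓ u ≤ ℓ v then q ^ (ℓ u - ℓ v) else 0 with hH
  have hH0 : 0 ≤ H := sum_nonneg fun u _ => by split_ifs <;> positivity
  have hX : load δ G ℓ v = lowCount G ℓ v + H := by
    rw [lowCount_eq, hH, ← sum_add_distrib, load]
    refine sum_congr rfl fun u _ => ?_
    by_cases a : G.Adj v u <;> by_cases b : ℓ u ≤ ℓ v <;> simp [a, b, hq]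
  have hX' : load δ G ℓ' v = lowCount G ℓ v + (1 + δ) * H := by
    rw [lowCount_eq, hH, mul_sum, ← sum_add_distrib, load]
    refine sum_congr rfl fun u _ => ?_
    by_cases a : G.Adj v u
    · have hne : u ≠ v := a.ne'
      by_cases b : ℓ u ≤ ℓ v
      · have : ℓ u - (ℓ v + 1) = 0 := by omega
        simp [a, b, hℓ', Function.update_of_ne hne, this]
      · obtain ⟨m, hm⟩ : ∃ m, ℓ u = ℓ v + 1 + m := ⟨ℓ u - (ℓ v + 1), by omega⟩
        have e1 : ℓ u - (ℓ v + 1) = m := by omega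
        have e2 : ℓ u - ℓ v = m + 1 := by omega
        simp only [a, b, hℓ', Function.update_of_ne hne, Function.update_self, e1, e2, true_and,
          not_false_eq_true, if_true, if_false, pow_succ]
        rw [← hq]
        linear_combination (-q ^ m) * hq1
    · simp [a]
  have hself := nodePot_raise (d := deg G v) hc h0 h1 hK hK0 rfl (Nat.cast_nonneg (lowCount G ℓ v))
    hH0 (hX ▸ hlow) (hX ▸ hhigh)
  rw [← hX, ← hX'] at hself
  have hother : ∀ w, w ≠ v → nodePot K δ (ℓ' w) (o w) (deg G w) (load δ G ℓ' w) ≤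
      nodePot K δ (ℓ w) (o w) (deg G w) (load δ G ℓ w) +
        if G.Adj v w ∧ ℓ w ≤ ℓ v then (K - 3 * K * δ) * δ else 0 := by
    intro w hw
    have e := load_update_of_ne (δ := δ) G ℓ hw (ℓ v + 1)
    rw [← hℓ'] at e
    have el : ℓ' w = ℓ w := by simp [hℓ', hw]
    rw [el]
    by_cases a : G.Adj v w ∧ ℓ w ≤ ℓ v
    · rw [if_pos a.1.symm, ← hq] at e
      rw [if_pos a]
      have e1 : ℓ v + 1 - ℓ w = (ℓ v - ℓ w) + 1 := by omega
      rw [e1, pow_succ] at e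
      have hp : q ^ (ℓ v - ℓ w) ≤ 1 := inv_pow_le_one h0 _
      have hp0 : 0 < q ^ (ℓ v - ℓ w) := by positivity
      have hd : 1 - q ≤ δ := by nlinarith
      -- A loss of load δ costs (K - 6Kδ)δ in the deficit and 3Kδ·δ in d - x, hence (K - 3Kδ)δ in
      -- all.
      have := nodePot_le_of_load hK0 h0 h1 (ℓ w) (o := o w) (o' := o w) (d := deg G w)
        (d' := deg G w) (x := load δ G ℓ w) (x' := load δ G ℓ' w) (a := 0) (b := δ) (e := δ)
        le_rfl h0.le (by nlinarith) (by nlinarith) (by nlinarith)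
      nlinarith
    · rw [if_neg a]
      by_cases b : G.Adj w v
      · have hlt : ¬ ℓ w ≤ ℓ v := fun h => a ⟨b.symm, h⟩
        have e1 : ℓ v + 1 - ℓ w = 0 := by omega
        have e2 : ℓ v - ℓ w = 0 := by omega
        rw [e1, e2] at e
        simp at e
        rw [e]; simp
      · rw [if_neg b] at e
        rw [e]; simp
  have hsum : ∑ w, nodePot K δ (ℓ' w) (o w) (deg G w) (load δ G ℓ' w) ≤
      ∑ w, (nodePot K δ (ℓ w) (o w) (deg G w) (load δ G ℓ w) +
        ((if G.Adj v w ∧ ℓ w ≤ ℓ v then (K - 3 * K * δ) * δ else 0) -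
          if w = v then (K - 3 * K * δ) * δ * lowCount G ℓ v + c * (lowCount G ℓ v + 2) else 0)) := by
    refine sum_le_sum fun w _ => ?_
    by_cases hw : w = v
    · subst hw
      have el : ℓ' w = ℓ w + 1 := by simp [hℓ']
      simp only [el, SimpleGraph.irrefl, false_and, if_false, if_true]
      linarith
    · simpa [hw] using hother w hw
  have e1 : (∑ w, if G.Adj v w ∧ ℓ w ≤ ℓ v then (K - 3 * K * δ) * δ else 0) =
      (K - 3 * K * δ) * δ * lowCount G ℓ v := by
    rw [lowCount_eq, mul_sum]
    exact sum_congr rfl fun w _ => by split_ifs <;> simp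
  rw [sum_add_distrib, sum_sub_distrib, e1, Finset.sum_ite_eq' univ v] at hsum
  simp only [mem_univ, if_true] at hsum
  unfold pot
  linarith

/-- Each neighbour strictly below v gains at most 1 - q in load, at a price of K(1 - q); the
accompanying decrease of its d - x is given away. Neighbours on the level of v or above notice
nothing. -/
theorem pot_drop [DecidableEq V] {K δ c : ℝ} (hc : 0 ≤ c) (h0 : 0 < δ) (h1 : δ ≤ 1 / 64)
    (hK : 4 * c ≤ K * δ ^ 2) (hK0 : 0 ≤ K) (G : SimpleGraph V) (ℓ : V → ℕ) (v : V) {i : ℕ}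
    (hi : ℓ v = i + 1) (hlow : load δ G ℓ v < (1 - 12 * δ) * (1 + δ) ^ ℓ v) :
    pot K δ G (Function.update ℓ v i) (fun _ => 0) + c * (lowCount G ℓ v + 2) ≤
      pot K δ G ℓ (fun _ => 0) := by
  classical
  set ℓ' := Function.update ℓ v i with hℓ'
  set q := (1 + δ)⁻¹ with hq
  have hq0 : 0 < q := by positivity
  have hq1 : q * (1 + δ) = 1 := by rw [hq]; field_simp
  have hql : q ≤ 1 := by nlinarith
  set D : ℝ := ∑ u, if G.Adj v u ∧ ℓ u ≤ i then (1 : ℝ) else 0 with hD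
  have hD0 : 0 ≤ D := sum_nonneg fun u _ => by split_ifs <;> norm_num
  set H : ℝ := ∑ u, if G.Adj v u ∧ ¬ ℓ u ≤ i then q ^ (ℓ u - ℓ v) else 0 with hH
  have hH0 : 0 ≤ H := sum_nonneg fun u _ => by split_ifs <;> positivity
  have hX : load δ G ℓ v = D + H := by
    rw [hD, hH, ← sum_add_distrib, load]
    refine sum_congr rfl fun u _ => ?_
    by_cases a : G.Adj v u <;> by_cases b : ℓ u ≤ i
    · have : ℓ u - ℓ v = 0 := by omega
      simp [a, b, this]
    · simp [a, b, hq]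
    · simp [a]
    · simp [a]
  have hX' : load δ G ℓ' v = D + q * H := by
    rw [hD, hH, mul_sum, ← sum_add_distrib, load]
    refine sum_congr rfl fun u _ => ?_
    by_cases a : G.Adj v u
    · have hne : u ≠ v := a.ne'
      by_cases b : ℓ u ≤ i
      · have : ℓ u - i = 0 := by omega
        simp [a, b, hℓ', Function.update_of_ne hne, this]
      · have e2 : ℓ u - i = (ℓ u - ℓ v) + 1 := by omega
        simp only [a, b, hℓ', Function.update_of_ne hne, Function.update_self, e2, true_and,
          not_false_eq_true, if_true, if_false, pow_succ]
        rw [← hq]; ring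
    · simp [a]
  -- The scan also visits neighbours on the level of v itself, which D does not count. The time is
  -- therefore bounded by the load of v, which is below (1 + δ)^ℓ(v).
  have hlowle : (lowCount G ℓ v : ℝ) ≤ load δ G ℓ v := by
    rw [lowCount_eq, load]
    refine sum_le_sum fun u _ => ?_
    by_cases a : G.Adj v u
    · by_cases b : ℓ u ≤ ℓ v
      · have : ℓ u - ℓ v = 0 := by omega
        simp [a, b, this]
      · simp only [a, b, and_false, if_false, if_true]; positivity
    · simp [a]
  have hself := nodePot_drop (d := deg G v) hc h0 h1 hK hK0 (i := i) rfl hq hD0 hH0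
    (by rw [← hX, ← hi]; exact hlow)
  rw [← hX, ← hX'] at hself
  have hS1 : (1 : ℝ) ≤ (1 + δ) ^ (i + 1) := one_le_pow₀ (by linarith)
  have hcost : c * (lowCount G ℓ v + 2) ≤ c * (3 * (1 + δ) ^ (i + 1)) := by
    apply mul_le_mul_of_nonneg_left _ hc
    rw [hi] at hlow
    nlinarith
  have hother : ∀ w, w ≠ v → nodePot K δ (ℓ' w) 0 (deg G w) (load δ G ℓ' w) ≤
      nodePot K δ (ℓ w) 0 (deg G w) (load δ G ℓ w) +
        if G.Adj v w ∧ ℓ w ≤ i then K * (1 - q) else 0 := by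
    intro w hw
    have e := load_update_of_ne (δ := δ) G ℓ hw i
    rw [← hℓ'] at e
    have el : ℓ' w = ℓ w := by simp [hℓ', hw]
    rw [el]
    by_cases a : G.Adj v w ∧ ℓ w ≤ i
    · rw [if_pos a.1.symm, ← hq] at e
      rw [if_pos a]
      have e1 : ℓ v - ℓ w = (i - ℓ w) + 1 := by omega
      rw [e1, pow_succ] at e
      have hp : q ^ (i - ℓ w) ≤ 1 := inv_pow_le_one h0 _
      have hp0 : 0 < q ^ (i - ℓ w) := by positivity
      have := nodePot_le_of_load hK0 h0 h1 (ℓ w) (o := 0) (o' := 0) (d := deg G w)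
        (d' := deg G w) (x := load δ G ℓ w) (x' := load δ G ℓ' w) (a := 1 - q) (b := 0) (e := 0)
        (by linarith) le_rfl (by nlinarith) (by nlinarith) (by nlinarith)
      linarith
    · rw [if_neg a]
      by_cases b : G.Adj w v
      · have hlt : ¬ ℓ w ≤ i := fun h => a ⟨b.symm, h⟩
        have e1 : i - ℓ w = 0 := by omega
        have e2 : ℓ v - ℓ w = 0 := by omega
        rw [e1, e2] at e
        simp at e
        rw [e]; simp
      · rw [if_neg b] at e
        rw [e]; simp
  have hsum : ∑ w, nodePot K δ (ℓ' w) 0 (deg G w) (load δ G ℓ' w) ≤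
      ∑ w, (nodePot K δ (ℓ w) 0 (deg G w) (load δ G ℓ w) +
        ((if G.Adj v w ∧ ℓ w ≤ i then K * (1 - q) else 0) -
          if w = v then K * (1 - q) * D + c * (lowCount G ℓ v + 2) else 0)) := by
    refine sum_le_sum fun w _ => ?_
    by_cases hw : w = v
    · subst hw
      have el : ℓ' w = i := by simp [hℓ']
      simp only [el, SimpleGraph.irrefl, false_and, if_false, if_true]
      rw [hi]
      linarith
    · simpa [hw] using hother w hw
  have e1 : (∑ w, if G.Adj v w ∧ ℓ w ≤ i then K * (1 - q) else 0) = K * (1 - q) * D := by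
    rw [hD, mul_sum]
    exact sum_congr rfl fun w _ => by split_ifs <;> simp
  rw [sum_add_distrib, sum_sub_distrib, e1, Finset.sum_ite_eq' univ v] at hsum
  simp only [mem_univ, if_true] at hsum
  unfold pot
  linarith

/-! ### The effect of one edge on the potential -/

theorem EdgeAdded.load_left {G G' : SimpleGraph V} {u v : V} (h : EdgeAdded G G' u v) (δ : ℝ)
    (ℓ : V → ℕ) : load δ G' ℓ u = load δ G ℓ u + ((1 + δ)⁻¹) ^ (ℓ v - ℓ u) := by
  classical
  unfold load
  rw [← sub_eq_iff_eq_add', ← sum_sub_distrib, Finset.sum_eq_single v]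
  · simp [h.adj, h.not_adj]
  · intro x _ hx
    have := h.iff u x (by simp [hx, h.ne])
    simp [this]
  · simp

theorem EdgeAdded.deg_left {G G' : SimpleGraph V} {u v : V} (h : EdgeAdded G G' u v) :
    deg G' u = deg G u + 1 := by
  classical
  unfold deg
  rw [← sub_eq_iff_eq_add', ← sum_sub_distrib, Finset.sum_eq_single v]
  · simp [h.adj, h.not_adj]
  · intro x _ hx
    have := h.iff u x (by simp [hx, h.ne])
    simp [this]
  · simp

theorem EdgeAdded.other {G G' : SimpleGraph V} {u v w : V} (h : EdgeAdded G G' u v) (δ : ℝ)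
    (ℓ : V → ℕ) (hu : w ≠ u) (hv : w ≠ v) :
    load δ G' ℓ w = load δ G ℓ w ∧ deg G' w = deg G w := by
  classical
  have : ∀ x, G'.Adj w x ↔ G.Adj w x := fun x => h.iff w x (by simp [hu, hv])
  simp [load, deg, this]

open Classical in
theorem pot_le_of_two {K δ e : ℝ} {G G' : SimpleGraph V} {ℓ : V → ℕ} {o o' : V → ℝ} {u v : V}
    (huv : u ≠ v)
    (h : ∀ w, w = u ∨ w = v → nodePot K δ (ℓ w) (o' w) (deg G' w) (load δ G' ℓ w) ≤
      nodePot K δ (ℓ w) (o w) (deg G w) (load δ G ℓ w) + e)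
    (h' : ∀ w, w ≠ u → w ≠ v → load δ G' ℓ w = load δ G ℓ w ∧ deg G' w = deg G w ∧ o' w = o w) :
    pot K δ G' ℓ o' ≤ pot K δ G ℓ o + 2 * e := by
  unfold pot
  calc _ ≤ ∑ w, (nodePot K δ (ℓ w) (o w) (deg G w) (load δ G ℓ w) +
        ((if w = u then e else 0) + if w = v then e else 0)) := by
        refine sum_le_sum fun w _ => ?_
        by_cases a : w = u
        · have : w ≠ v := a ▸ huv
          simpa [a, huv] using h w (Or.inl a)
        · by_cases b : w = v
          · simpa [b, huv.symm] using h w (Or.inr b)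
          · obtain ⟨h1, h2, h3⟩ := h' w a b
            simp [a, b, h1, h2, h3]
    _ = _ := by
        rw [sum_add_distrib, sum_add_distrib]
        simp; ring

open Classical in
/-- The offset of the endpoints of an edge. -/
noncomputable def endOffset (u v w : V) : ℝ := if w = u ∨ w = v then 1 else 0

/-- The offset prepays the load of an edge that is about to be inserted; each endpoint is charged K.
-/
theorem pot_offset_le {K δ : ℝ} (hK : 0 ≤ K) (h0 : 0 < δ) (h1 : δ ≤ 1 / 64) (G : SimpleGraph V)
    (ℓ : V → ℕ) {u v : V} (huv : u ≠ v) :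
    pot K δ G ℓ (endOffset u v) ≤ pot K δ G ℓ (fun _ => 0) + 2 * K := by
  refine pot_le_of_two huv (fun w hw => ?_) (fun w h2 h3 => ?_)
  · have : endOffset u v w = 1 := if_pos hw
    rw [this]
    have := nodePot_le_of_load hK h0 h1 (ℓ w) (o := 0) (o' := 1) (d := deg G w) (d' := deg G w)
      (x := load δ G ℓ w) (x' := load δ G ℓ w) (a := 1) (b := 0) (e := 0) (by norm_num) le_rfl
      (by linarith) (by linarith) (by linarith)
    linarith
  · exact ⟨rfl, rfl, if_neg (by tauto)⟩

/-- The edge adds at most 1 to the load of an endpoint, and the removed offset makes room for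
exactly 1. The excess does not grow; only the deficit and d - x may, by at most 1 each. -/
theorem pot_insert_le {K δ : ℝ} (hK : 0 ≤ K) (h0 : 0 < δ) (h1 : δ ≤ 1 / 64)
    {G G' : SimpleGraph V} {u v : V} (h : EdgeAdded G G' u v) (ℓ : V → ℕ) :
    pot K δ G' ℓ (fun _ => 0) ≤ pot K δ G ℓ (endOffset u v) + 4 * K := by
  have key : ∀ {u v : V}, EdgeAdded G G' u v →
      nodePot K δ (ℓ u) 0 (deg G' u) (load δ G' ℓ u) ≤
        nodePot K δ (ℓ u) 1 (deg G u) (load δ G ℓ u) + 2 * K := by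
    intro u v h
    have hp := inv_pow_le_one h0 (ℓ v - ℓ u)
    have hp0 : 0 < ((1 + δ)⁻¹) ^ (ℓ v - ℓ u) := by positivity
    have e1 := h.load_left δ ℓ
    have e2 := h.deg_left
    have := nodePot_le_of_load hK h0 h1 (ℓ u) (o := 1) (o' := 0) (d := deg G u) (d' := deg G' u)
      (x := load δ G ℓ u) (x' := load δ G' ℓ u) (a := 0) (b := 1) (e := 1) le_rfl (by norm_num)
      (by linarith) (by linarith) (by linarith)
    nlinarith
  have := pot_le_of_two (K := K) (δ := δ) (ℓ := ℓ) (o := endOffset u v) (o' := fun _ => 0)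
    (e := 2 * K) h.ne
    (fun w hw => by
      have e : endOffset u v w = 1 := if_pos hw
      rw [e]
      rcases hw with rfl | rfl
      · exact key h
      · exact key h.symm)
    (fun w h2 h3 => ⟨(h.other δ ℓ h2 h3).1, (h.other δ ℓ h2 h3).2, (if_neg (by tauto)).symm⟩)
  linarith

/-- An endpoint loses at most 1 of its load, which can increase its deficit. Its d - x does not
grow, as the degree drops by 1 and the load by no more. -/
theorem pot_delete_le {K δ : ℝ} (hK : 0 ≤ K) (h0 : 0 < δ) (h1 : δ ≤ 1 / 64)
    {G G' : SimpleGraph V} {u v : V} (h : EdgeAdded G G' u v) (ℓ : V → ℕ) :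
    pot K δ G ℓ (fun _ => 0) ≤ pot K δ G' ℓ (fun _ => 0) + 2 * K := by
  have key : ∀ {u v : V}, EdgeAdded G G' u v →
      nodePot K δ (ℓ u) 0 (deg G u) (load δ G ℓ u) ≤
        nodePot K δ (ℓ u) 0 (deg G' u) (load δ G' ℓ u) + K := by
    intro u v h
    have hp := inv_pow_le_one h0 (ℓ v - ℓ u)
    have hp0 : 0 < ((1 + δ)⁻¹) ^ (ℓ v - ℓ u) := by positivity
    have e1 := h.load_left δ ℓ
    have e2 := h.deg_left
    have := nodePot_le_of_load hK h0 h1 (ℓ u) (o := 0) (o' := 0) (d := deg G' u) (d' := deg G u)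
      (x := load δ G' ℓ u) (x' := load δ G ℓ u) (a := 0) (b := 1) (e := 0) le_rfl (by norm_num)
      (by linarith) (by linarith) (by linarith)
    nlinarith
  refine pot_le_of_two h.ne
    (fun w hw => by
      rcases hw with rfl | rfl
      · exact key h
      · exact key h.symm)
    (fun w h2 h3 => ⟨((h.other δ ℓ h2 h3).1).symm, ((h.other δ ℓ h2 h3).2).symm, rfl⟩)

end DynCover

/-! ## A structured language and its compilation -/

namespace RAM

/-- A machine state seen through arrays: `ia (a, x, y)` and `ra (a, x, y)` are the entries in row `x`
and column `y` of the integer array and of the real array with the number `a`. -/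
structure St where
  ireg : ℕ → ℕ
  rreg : ℕ → ℝ
  ia : ℕ × ℕ × ℕ → ℕ
  ra : ℕ × ℕ × ℕ → ℝ
  cov : ℕ → ℕ

/-- Instructions of the structured language: machine instructions and array accesses. -/
inductive Op where
  | const (d k : ℕ)
  | add (d a b : ℕ)
  | sub (d a b : ℕ)
  | mul (d a b : ℕ)
  | ld (d a x y : ℕ)
  | st (a x y s : ℕ)
  | stc (y s : ℕ)
  | cast (d a : ℕ)
  | radd (d a b : ℕ)
  | rsub (d a b : ℕ)
  | rmul (d a b : ℕ)
  | rdiv (d a b : ℕ)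
  | rld (d a x y : ℕ)
  | rst (a x y s : ℕ)

namespace Op

/-- The conditions under which an instruction makes no fault. -/
def Safe (n M : ℕ) (s : St) : Op → Prop
  | const d k => d < 24 ∧ k < M
  | add d a b => d < 24 ∧ a < 24 ∧ b < 24 ∧ s.ireg a + s.ireg b < M
  | sub d a b => d < 24 ∧ a < 24 ∧ b < 24 ∧ s.ireg a - s.ireg b < M
  | mul d a b => d < 24 ∧ a < 24 ∧ b < 24 ∧ s.ireg a * s.ireg b < M
  | ld d a x y => d < 24 ∧ x < 24 ∧ y < 24 ∧ a < 8 ∧ s.ireg 3 = n ∧ s.ireg x < M ∧ s.ireg y < n ∧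
      s.ia (a, s.ireg x, s.ireg y) < M
  | st a x y r => r < 24 ∧ x < 24 ∧ y < 24 ∧ a < 8 ∧ s.ireg 3 = n ∧ s.ireg x < M ∧ s.ireg y < n
  | stc y r => y < 24 ∧ r < 24 ∧ s.ireg y < n
  | cast _ a => a < 24
  | radd _ _ _ => True
  | rsub _ _ _ => True
  | rmul _ _ _ => True
  | rdiv _ _ b => s.rreg b ≠ 0
  | rld _ a x y => x < 24 ∧ y < 24 ∧ a < 3 ∧ s.ireg 3 = n ∧ s.ireg x < n ∧ s.ireg y < n
  | rst a x y _ => x < 24 ∧ y < 24 ∧ a < 3 ∧ s.ireg 3 = n ∧ s.ireg x < n ∧ s.ireg y < n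

/-- The effect of an instruction. -/
noncomputable def eff (s : St) : Op → St
  | const d k => { s with ireg := Function.update s.ireg d k }
  | add d a b => { s with ireg := Function.update s.ireg d (s.ireg a + s.ireg b) }
  | sub d a b => { s with ireg := Function.update s.ireg d (s.ireg a - s.ireg b) }
  | mul d a b => { s with ireg := Function.update s.ireg d (s.ireg a * s.ireg b) }
  | ld d a x y => { s with ireg := Function.update s.ireg d (s.ia (a, s.ireg x, s.ireg y)) }
  | st a x y r => { s with ia := Function.update s.ia (a, s.ireg x, s.ireg y) (s.ireg r) }
  | stc y r => { s with cov := Function.update s.cov (s.ireg y) (s.ireg r) }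
  | cast d a => { s with rreg := Function.update s.rreg d (s.ireg a : ℝ) }
  | radd d a b => { s with rreg := Function.update s.rreg d (s.rreg a + s.rreg b) }
  | rsub d a b => { s with rreg := Function.update s.rreg d (s.rreg a - s.rreg b) }
  | rmul d a b => { s with rreg := Function.update s.rreg d (s.rreg a * s.rreg b) }
  | rdiv d a b => { s with rreg := Function.update s.rreg d (s.rreg a / s.rreg b) }
  | rld d a x y => { s with rreg := Function.update s.rreg d (s.ra (a, s.ireg x, s.ireg y)) }
  | rst a x y r => { s with ra := Function.update s.ra (a, s.ireg x, s.ireg y) (s.rreg r) }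

/-- Put the address of an entry of an integer array into register `24`. -/
def addrCode (a x y : ℕ) : List Instr :=
  [.mul 24 x 3, .add 24 24 y, .const 25 8, .mul 24 24 25, .add 24 24 3, .const 25 a, .add 24 24 25]

/-- Put the address of an entry of a real array into register `24`. -/
def raddrCode (a x y : ℕ) : List Instr :=
  [.mul 24 x 3, .add 24 24 y, .mul 25 3 3, .const 26 a, .mul 25 25 26, .add 24 24 25]

/-- The machine code of an instruction. -/
def code : Op → List Instr
  | const d k => [.const d k]
  | add d a b => [.add d a b]
  | sub d a b => [.sub d a b]
  | mul d a b => [.mul d a b]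
  | ld d a x y => addrCode a x y ++ [.load d 24]
  | st a x y r => addrCode a x y ++ [.store 24 r]
  | stc y r => [.store y r]
  | cast d a => [.cast d a]
  | radd d a b => [.radd d a b]
  | rsub d a b => [.rsub d a b]
  | rmul d a b => [.rmul d a b]
  | rdiv d a b => [.rdiv d a b]
  | rld d a x y => raddrCode a x y ++ [.rload d 24]
  | rst a x y r => raddrCode a x y ++ [.rstore 24 r]

theorem length_code_le (o : Op) : o.code.length ≤ 8 := by
  cases o <;> simp [code, addrCode, raddrCode]

end Op

/-- The configuration `c` represents the state `s`. -/
structure Sim (n M : ℕ) (s : St) (c : Config) : Prop where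
  ireg : ∀ r < 24, c.ireg r = s.ireg r
  rreg : c.rreg = s.rreg
  imem : ∀ a < 8, ∀ x < M, ∀ y < n, c.imem (n + 8 * (x * n + y) + a) = s.ia (a, x, y)
  rmem : ∀ a < 3, ∀ x < n, ∀ y < n, c.rmem (a * (n * n) + x * n + y) = s.ra (a, x, y)
  cov : ∀ y < n, c.imem y = s.cov y

/-- The words are long enough for the addresses. -/
structure Fits (n M B : ℕ) : Prop where
  int : 8 * (M * n) + n ≤ B
  real : 3 * (n * n) ≤ B
  word : M ≤ B
  const : 9 < B

theorem mul_add_inj {n x y x' y' : ℕ} (hy : y < n) (hy' : y' < n)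
    (h : x * n + y = x' * n + y') : x = x' ∧ y = y' := by
  have hn : 0 < n := by omega
  have h1 : (x * n + y) / n = x := by
    rw [mul_comm, Nat.mul_add_div hn, Nat.div_eq_of_lt hy, add_zero]
  have h2 : (x' * n + y') / n = x' := by
    rw [mul_comm, Nat.mul_add_div hn, Nat.div_eq_of_lt hy', add_zero]
  have : x = x' := by rw [← h1, ← h2, h]
  subst this
  exact ⟨rfl, by omega⟩

theorem mul_add_lt {n M x y : ℕ} (hx : x < M) (hy : y < n) : x * n + y < M * n := by
  calc x * n + y < x * n + n := by omega
    _ = (x + 1) * n := by ring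
    _ ≤ M * n := Nat.mul_le_mul_right n hx

/-- Execute a list of instructions without jumps. -/
noncomputable def runList (B : ℕ) : List Instr → Config → Option Config
  | [], c => some c
  | i :: l, c => (exec B c i).bind (runList B l)

theorem runList_append (B : ℕ) (l l' : List Instr) (c : Config) :
    runList B (l ++ l') c = (runList B l c).bind (runList B l') := by
  induction l generalizing c with
  | nil => simp [runList]
  | cons i l ih =>
    simp only [List.cons_append, runList]
    cases exec B c i <;> simp [ih]

/-- The integer arrays are interleaved in blocks of eight behind the n cells of the cover, so that
rows up to M need no separate base addresses. The real arrays have n rows and are stored one after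
the other, which gives array 0 precisely the cells required by `Config.HoldsWeights`. -/
theorem runList_addrCode {n M B : ℕ} (hB : Fits n M B) {c : Config} {a x y : ℕ} (_ : x < 24)
    (hy : y < 24) (ha : a < 8) (h3 : c.ireg 3 = n) (hxM : c.ireg x < M) (hyn : c.ireg y < n) :
    ∃ d, runList B (Op.addrCode a x y) c = some d ∧
      d.ireg 24 = n + 8 * (c.ireg x * n + c.ireg y) + a ∧ (∀ r < 24, d.ireg r = c.ireg r) ∧
      d.rreg = c.rreg ∧ d.imem = c.imem ∧ d.rmem = c.rmem := by
  have h1 := mul_add_lt hxM hyn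
  have h2 := hB.int
  have h4 := hB.const
  have b1 : c.ireg x * n < B := by omega
  have b2 : c.ireg x * n + c.ireg y < B := by omega
  have b3 : 8 < B := by omega
  have b4 : (c.ireg x * n + c.ireg y) * 8 < B := by omega
  have b5 : (c.ireg x * n + c.ireg y) * 8 + n < B := by omega
  have b6 : a < B := by omega
  have b7 : (c.ireg x * n + c.ireg y) * 8 + n + a < B := by omega
  have ny : y ≠ 24 := by omega
  have key : runList B (Op.addrCode a x y) c = some
      { c with
        pc := c.pc + 1 + 1 + 1 + 1 + 1 + 1 + 1
        ireg := Function.update (Function.update (Function.update (Function.update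
          (Function.update c.ireg 24 (c.ireg x * n + c.ireg y)) 25 8) 24
            ((c.ireg x * n + c.ireg y) * 8 + n)) 25 a) 24
              ((c.ireg x * n + c.ireg y) * 8 + n + a) } := by
    simp [Op.addrCode, runList, exec, Config.setInt, h3, b1, b2, b3, b4, b5, b6, b7, ny]
  refine ⟨_, key, ?_, ?_, rfl, rfl, rfl⟩
  · simp; omega
  · intro r hr
    have n1 : r ≠ 24 := by omega
    have n2 : r ≠ 25 := by omega
    simp [n1, n2]

theorem runList_raddrCode {n M B : ℕ} (hB : Fits n M B) {c : Config} {a x y : ℕ} (_ : x < 24)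
    (hy : y < 24) (ha : a < 3) (h3 : c.ireg 3 = n) (hxM : c.ireg x < n) (hyn : c.ireg y < n) :
    ∃ d, runList B (Op.raddrCode a x y) c = some d ∧
      d.ireg 24 = a * (n * n) + c.ireg x * n + c.ireg y ∧ (∀ r < 24, d.ireg r = c.ireg r) ∧
      d.rreg = c.rreg ∧ d.imem = c.imem ∧ d.rmem = c.rmem := by
  have h1 := mul_add_lt hxM hyn
  have h2 := hB.real
  have h4 := hB.const
  have h5 : a * (n * n) ≤ 2 * (n * n) := Nat.mul_le_mul_right _ (by omega)
  have h6 : n * n * a = a * (n * n) := by ring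
  have b1 : c.ireg x * n < B := by omega
  have b2 : c.ireg x * n + c.ireg y < B := by omega
  have b3 : n * n < B := by nlinarith
  have b4 : n * n * a < B := by omega
  have b5 : c.ireg x * n + c.ireg y + n * n * a < B := by omega
  have b6 : a < B := by omega
  have ny : y ≠ 24 := by omega
  have key : runList B (Op.raddrCode a x y) c = some
      { c with
        pc := c.pc + 1 + 1 + 1 + 1 + 1 + 1
        ireg := Function.update (Function.update (Function.update (Function.update
          (Function.update c.ireg 24 (c.ireg x * n + c.ireg y)) 25 (n * n)) 26 a) 25
            (n * n * a)) 24 (c.ireg x * n + c.ireg y + n * n * a) } := by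
    simp [Op.raddrCode, runList, exec, Config.setInt, h3, b1, b2, b3, b4, b5, b6, ny]
  refine ⟨_, key, ?_, ?_, rfl, rfl, rfl⟩
  · simp; omega
  · intro r hr
    have n1 : r ≠ 24 := by omega
    have n2 : r ≠ 25 := by omega
    have n3 : r ≠ 26 := by omega
    simp [n1, n2, n3]

theorem Sim.setInt {n M B : ℕ} (hB : Fits n M B) {s : St} {c : Config} (h : Sim n M s c)
    {d x : ℕ} (hx : x < M) :
    ∃ e, c.setInt B d x = some e ∧
      Sim n M { s with ireg := Function.update s.ireg d x } e := by
  refine ⟨_, if_pos (hx.trans_le hB.word), ⟨fun r hr => ?_, h.rreg, h.imem, h.rmem, h.cov⟩⟩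
  by_cases hd : r = d
  · simp [hd]
  · simp [hd, h.ireg r hr]

theorem Sim.setReal {n M : ℕ} {s : St} {c : Config} (h : Sim n M s c) (d : ℕ) (x : ℝ) :
    Sim n M { s with rreg := Function.update s.rreg d x } (c.setReal d x) := by
  refine ⟨h.ireg, ?_, h.imem, h.rmem, h.cov⟩
  simp [Config.setReal, h.rreg]

/-- The code of an instruction does what the instruction does. -/
theorem Op.runList_code {n M B : ℕ} (hB : Fits n M B) {s : St} {c : Config} (h : Sim n M s c)
    (o : Op) (ho : o.Safe n M s) :
    ∃ d, runList B o.code c = some d ∧ Sim n M (o.eff s) d := by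
  have single : ∀ {i : Instr} {e : Config}, exec B c i = some e → runList B [i] c = some e := by
    intro i e hi
    simp [runList, hi]
  cases o with
  | const d k =>
    obtain ⟨e, he, hs⟩ := h.setInt hB (d := d) ho.2
    exact ⟨e, single he, hs⟩
  | add d a b =>
    obtain ⟨-, ha, hb, hM⟩ := ho
    obtain ⟨e, he, hs⟩ := h.setInt hB (d := d) hM
    exact ⟨e, single (by rw [exec, h.ireg a ha, h.ireg b hb, he]), hs⟩
  | sub d a b =>
    obtain ⟨-, ha, hb, hM⟩ := ho
    obtain ⟨e, he, hs⟩ := h.setInt hB (d := d) hM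
    exact ⟨e, single (by rw [exec, h.ireg a ha, h.ireg b hb, he]), hs⟩
  | mul d a b =>
    obtain ⟨-, ha, hb, hM⟩ := ho
    obtain ⟨e, he, hs⟩ := h.setInt hB (d := d) hM
    exact ⟨e, single (by rw [exec, h.ireg a ha, h.ireg b hb, he]), hs⟩
  | ld d a x y =>
    obtain ⟨-, hx, hy, ha, h3, hxM, hyn, hv⟩ := ho
    obtain ⟨e, he, e24, er, err, eim, erm⟩ := runList_addrCode (c := c) hB hx hy ha
      (by rw [h.ireg 3 (by norm_num), h3]) (by rwa [h.ireg x hx]) (by rwa [h.ireg y hy])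
    have hs : Sim n M s e := ⟨fun r hr => by rw [er r hr, h.ireg r hr], err.trans h.rreg,
      by rw [eim]; exact h.imem, by rw [erm]; exact h.rmem, by rw [eim]; exact h.cov⟩
    obtain ⟨f, hf, hs'⟩ := hs.setInt hB (d := d) hv
    refine ⟨f, ?_, hs'⟩
    rw [Op.code, runList_append, he]
    simp only [Option.bind_some, runList, exec, e24]
    rw [eim, h.ireg x hx, h.ireg y hy, h.imem a ha _ hxM _ hyn, hf]
    rfl
  | st a x y r =>
    obtain ⟨hr, hx, hy, ha, h3, hxM, hyn⟩ := ho
    obtain ⟨e, he, e24, er, err, eim, erm⟩ := runList_addrCode (c := c) hB hx hy ha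
      (by rw [h.ireg 3 (by norm_num), h3]) (by rwa [h.ireg x hx]) (by rwa [h.ireg y hy])
    refine ⟨_, by
      rw [Op.code, runList_append, he]
      simp only [Option.bind_some, runList, exec, e24]
      rfl, ⟨?_, ?_, ?_, ?_, ?_⟩⟩
    · intro r hr
      simp [Op.eff, er r hr, h.ireg r hr]
    · exact err.trans h.rreg
    · intro a' ha' x' hx' y' hy'
      rw [h.ireg x hx, h.ireg y hy]
      simp only [Op.eff, Function.update_apply, Prod.mk.injEq, er r hr, h.ireg r hr, eim]
      by_cases hh : a' = a ∧ x' = s.ireg x ∧ y' = s.ireg y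
      · obtain ⟨rfl, rfl, rfl⟩ := hh
        simp
      · rw [if_neg hh, if_neg, h.imem a' ha' x' hx' y' hy']
        intro heq
        apply hh
        -- The array number is the remainder modulo 8 of the address minus n.
        have q1 : a' = a := by omega
        have q2 : x' * n + y' = s.ireg x * n + s.ireg y := by omega
        obtain ⟨q3, q4⟩ := mul_add_inj hy' hyn q2
        exact ⟨q1, q3, q4⟩
    · intro a' ha' x' hx' y' hy'
      simp [Op.eff, erm, h.rmem a' ha' x' hx' y' hy']
    · intro y' hy'
      simp only [Op.eff, Function.update_apply]
      rw [if_neg (by omega), eim, h.cov y' hy']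
  | stc y r =>
    obtain ⟨hy, hr, hyn⟩ := ho
    refine ⟨_, single rfl, ⟨h.ireg, h.rreg, ?_, h.rmem, ?_⟩⟩
    · intro a' ha' x' hx' y' hy'
      simp only [Function.update_apply]
      rw [if_neg, h.imem a' ha' x' hx' y' hy', Op.eff]
      rw [h.ireg y hy]; omega
    · intro y' hy'
      simp only [Op.eff, Function.update_apply, h.ireg y hy, h.ireg r hr, h.cov y' hy']
  | cast d a =>
    refine ⟨_, single rfl, ?_⟩
    rw [h.ireg a ho]
    exact h.setReal d _
  | radd d a b => exact ⟨_, single rfl, by rw [h.rreg]; exact h.setReal d _⟩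
  | rsub d a b => exact ⟨_, single rfl, by rw [h.rreg]; exact h.setReal d _⟩
  | rmul d a b => exact ⟨_, single rfl, by rw [h.rreg]; exact h.setReal d _⟩
  | rdiv d a b =>
    refine ⟨_, single (if_neg ?_), by rw [h.rreg]; exact h.setReal d _⟩
    rw [h.rreg]; exact ho
  | rld d a x y =>
    obtain ⟨hx, hy, ha, h3, hxn, hyn⟩ := ho
    obtain ⟨e, he, e24, er, err, eim, erm⟩ := runList_raddrCode (c := c) hB hx hy ha
      (by rw [h.ireg 3 (by norm_num), h3]) (by rwa [h.ireg x hx]) (by rwa [h.ireg y hy])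
    have hs : Sim n M s e := ⟨fun r hr => by rw [er r hr, h.ireg r hr], err.trans h.rreg,
      by rw [eim]; exact h.imem, by rw [erm]; exact h.rmem, by rw [eim]; exact h.cov⟩
    refine ⟨_, ?_, hs.setReal d _⟩
    rw [Op.code, runList_append, he]
    simp only [Option.bind_some, runList, exec, e24]
    rw [erm, h.ireg x hx, h.ireg y hy, h.rmem a ha _ hxn _ hyn]
  | rst a x y r =>
    obtain ⟨hx, hy, ha, h3, hxn, hyn⟩ := ho
    obtain ⟨e, he, e24, er, err, eim, erm⟩ := runList_raddrCode (c := c) hB hx hy ha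
      (by rw [h.ireg 3 (by norm_num), h3]) (by rwa [h.ireg x hx]) (by rwa [h.ireg y hy])
    refine ⟨_, by
      rw [Op.code, runList_append, he]
      simp only [Option.bind_some, runList, exec, e24]
      rfl, ⟨?_, ?_, ?_, ?_, ?_⟩⟩
    · intro r hr
      simp [Op.eff, er r hr, h.ireg r hr]
    · exact err.trans h.rreg
    · intro a' ha' x' hx' y' hy'
      simp [Op.eff, eim, h.imem a' ha' x' hx' y' hy']
    · intro a' ha' x' hx' y' hy'
      rw [h.ireg x hx, h.ireg y hy]
      simp only [Op.eff, Function.update_apply, Prod.mk.injEq, err, h.rreg, erm]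
      by_cases hh : a' = a ∧ x' = s.ireg x ∧ y' = s.ireg y
      · obtain ⟨rfl, rfl, rfl⟩ := hh
        simp
      · rw [if_neg hh, if_neg, h.rmem a' ha' x' hx' y' hy']
        intro heq
        apply hh
        rw [add_assoc, add_assoc] at heq
        obtain ⟨q1, q2⟩ := mul_add_inj (mul_add_lt hx' hy') (mul_add_lt hxn hyn) heq
        obtain ⟨q3, q4⟩ := mul_add_inj hy' hyn q2
        exact ⟨q1, q3, q4⟩
    · intro y' hy'
      simp [Op.eff, eim, h.cov y' hy']

/-! ### Structured programs -/

inductive Cond where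
  | ile (a b : ℕ)
  | rle (a b : ℕ)

namespace Cond

def Holds (s : St) : Cond → Prop
  | ile a b => s.ireg a ≤ s.ireg b
  | rle a b => s.rreg a ≤ s.rreg b

def Safe : Cond → Prop
  | ile a b => a < 24 ∧ b < 24
  | rle _ _ => True

def jump (l : ℕ) : Cond → Instr
  | ile a b => .jle a b l
  | rle a b => .rjle a b l

end Cond

/-- In spite of its name, `repeatUntil` tests the condition before each execution of the body. -/
inductive Com where
  | skip
  | op (o : Op)
  | seq (a b : Com)
  | ite (c : Cond) (a b : Com)
  | repeatUntil (c : Cond) (a : Com)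

/-- `Big n M a s t s'`: the structured program `a` turns `s` into `s'` in `t` steps. -/
inductive Big (n M : ℕ) : Com → St → ℕ → St → Prop
  | skip (s : St) : Big n M .skip s 0 s
  | op (o : Op) (s : St) : o.Safe n M s → Big n M (.op o) s 1 (o.eff s)
  | seq {a b : Com} {s s' s'' : St} {t t' : ℕ} :
      Big n M a s t s' → Big n M b s' t' s'' → Big n M (.seq a b) s (t + t') s''
  | ite_pos {c : Cond} {a b : Com} {s s' : St} {t : ℕ} : c.Safe → c.Holds s → Big n M a s t s' →
      Big n M (.ite c a b) s (t + 2) s'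
  | ite_neg {c : Cond} {a b : Com} {s s' : St} {t : ℕ} : c.Safe → ¬ c.Holds s → Big n M b s t s' →
      Big n M (.ite c a b) s (t + 2) s'
  | done {c : Cond} {a : Com} {s : St} : c.Safe → c.Holds s → Big n M (.repeatUntil c a) s 1 s
  | loop {c : Cond} {a : Com} {s s' s'' : St} {t t' : ℕ} : c.Safe → ¬ c.Holds s →
      Big n M a s t s' → Big n M (.repeatUntil c a) s' t' s'' →
      Big n M (.repeatUntil c a) s (t + t' + 2) s''

namespace Com

def size : Com → ℕ
  | skip => 0
  | op o => o.code.length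
  | seq a b => a.size + b.size
  | ite _ a b => 2 + b.size + a.size
  | repeatUntil _ a => 2 + a.size

/-- The machine code of a structured program, placed at the address `k`. -/
def compile : ℕ → Com → List Instr
  | _, skip => []
  | _, op o => o.code
  | k, seq a b => compile k a ++ compile (k + a.size) b
  -- The alternative `b` stands first, since the conditional jump leads to `a`. The instruction `jle
  -- 0 0` compares a register with itself and so always jumps.
  | k, ite c a b => c.jump (k + 2 + b.size) ::
      (compile (k + 1) b ++ (.jle 0 0 (k + 2 + b.size + a.size) :: compile (k + 2 + b.size) a))
  | k, repeatUntil c a => c.jump (k + 2 + a.size) :: (compile (k + 1) a ++ [.jle 0 0 k])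

theorem length_compile (a : Com) (k : ℕ) : (a.compile k).length = a.size := by
  induction a generalizing k with
  | skip => rfl
  | op o => rfl
  | seq a b iha ihb => simp [compile, size, iha, ihb]
  | ite c a b iha ihb => simp [compile, size, iha, ihb]; ring
  | repeatUntil c a ih => simp [compile, size, ih]; ring

end Com

/-- The instructions `l` stand in the program `P` from the address `k` on. -/
def CodeAt (P : Program) (k : ℕ) (l : List Instr) : Prop :=
  ∀ j, ∀ i, l[j]? = some i → P[k + j]? = some i

theorem CodeAt.head {P : Program} {k : ℕ} {i : Instr} {l : List Instr} (h : CodeAt P k (i :: l)) :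
    P[k]? = some i := h 0 i rfl

theorem CodeAt.tail {P : Program} {k : ℕ} {i : Instr} {l : List Instr} (h : CodeAt P k (i :: l)) :
    CodeAt P (k + 1) l := by
  intro j i' hj
  have := h (j + 1) i' (by simpa using hj)
  rwa [show k + 1 + j = k + (j + 1) by ring]

theorem CodeAt.left {P : Program} {k : ℕ} {l l' : List Instr} (h : CodeAt P k (l ++ l')) :
    CodeAt P k l := by
  intro j i hj
  refine h j i ?_
  obtain ⟨hlt, -⟩ := List.getElem?_eq_some_iff.mp hj
  rw [List.getElem?_append_left hlt, hj]

theorem CodeAt.right {P : Program} {k : ℕ} {l l' : List Instr} (h : CodeAt P k (l ++ l')) :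
    CodeAt P (k + l.length) l' := by
  intro j i hj
  have := h (l.length + j) i (by rw [List.getElem?_append_right (by omega)]; simpa using hj)
  rwa [add_assoc]

/-- `Steps B P c t d`: the program `P` gets from `c` to `d` in `t` instructions. -/
inductive Steps (B : ℕ) (P : Program) : Config → ℕ → Config → Prop
  | refl (c : Config) : Steps B P c 0 c
  | step {c d e : Config} {i : Instr} {t : ℕ} :
      P[c.pc]? = some i → exec B c i = some d → Steps B P d t e → Steps B P c (t + 1) e

theorem Steps.trans {B : ℕ} {P : Program} {c d e : Config} {t t' : ℕ} (h : Steps B P c t d)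
    (h' : Steps B P d t' e) : Steps B P c (t + t') e := by
  induction h with
  | refl c => simpa using h'
  | step h1 h2 _ ih =>
    rw [show ∀ a b : ℕ, a + 1 + b = a + b + 1 by intros; ring]
    exact .step h1 h2 (ih h')

theorem Steps.runs {B : ℕ} {P : Program} {c d : Config} {t : ℕ} (h : Steps B P c t d)
    (hd : P[d.pc]? = none) : Runs B P c t d := by
  induction h with
  | refl c => exact .halt c hd
  | step h1 h2 _ ih => exact .step _ _ _ _ _ h1 h2 (ih hd)

/-! ### Compiled code simulates structured programs -/

def Instr.IsJump : Instr → Prop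
  | .jle _ _ _ => True
  | .rjle _ _ _ => True
  | _ => False

theorem exec_pc {B : ℕ} {c d : Config} {i : Instr} (hi : ¬ i.IsJump) (h : exec B c i = some d) :
    d.pc = c.pc + 1 := by
  cases i <;> simp only [exec, Config.setInt, Config.setReal, Instr.IsJump, not_true_eq_false]
    at h hi <;> first
    | (split_ifs at h; cases h; rfl)
    | (cases h; rfl)

theorem Steps.of_runList {B : ℕ} {P : Program} {l : List Instr} (hl : ∀ i ∈ l, ¬ i.IsJump)
    {c d : Config} (hc : CodeAt P c.pc l) (h : runList B l c = some d) :
    Steps B P c l.length d ∧ d.pc = c.pc + l.length := by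
  induction l generalizing c with
  | nil =>
    cases h
    exact ⟨.refl _, rfl⟩
  | cons i l ih =>
    rw [runList] at h
    obtain ⟨e, he, hd⟩ := Option.bind_eq_some_iff.mp h
    have hpc := exec_pc (hl i (by simp)) he
    obtain ⟨h1, h2⟩ := ih (fun j hj => hl j (by simp [hj])) (by rw [hpc]; exact hc.tail) hd
    refine ⟨.step hc.head he h1, ?_⟩
    rw [h2, hpc, List.length_cons]; ring

theorem Op.code_not_jump (o : Op) : ∀ i ∈ o.code, ¬ i.IsJump := by
  cases o <;> simp [Op.code, Op.addrCode, Op.raddrCode, Instr.IsJump]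

theorem Sim.setPc {n M : ℕ} {s : St} {c : Config} (h : Sim n M s c) (k : ℕ) :
    Sim n M s { c with pc := k } := ⟨h.ireg, h.rreg, h.imem, h.rmem, h.cov⟩

theorem Sim.jump {n M B : ℕ} {s : St} {c : Config} (h : Sim n M s c) {k : Cond} (hk : k.Safe)
    (l : ℕ) [Decidable (k.Holds s)] :
    exec B c (k.jump l) = some { c with pc := if k.Holds s then l else c.pc + 1 } := by
  cases k with
  | ile a b => simp [Cond.jump, exec, Cond.Holds, h.ireg a hk.1, h.ireg b hk.2]; congr
  | rle a b =>
    simp only [Cond.jump, exec, Cond.Holds, h.rreg]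
    congr

/-- Compiled programs do what structured programs do, in proportional time. -/
theorem Big.steps {n M B : ℕ} (hB : Fits n M B) {P : Program} {a : Com} {s s' : St} {t : ℕ}
    (h : Big n M a s t s') {c : Config} (hP : CodeAt P c.pc (a.compile c.pc)) (hc : Sim n M s c) :
    ∃ t' d, Steps B P c t' d ∧ t' ≤ 8 * t ∧ Sim n M s' d ∧ d.pc = c.pc + a.size := by
  classical
  induction h generalizing c with
  | skip s => exact ⟨0, c, .refl c, le_rfl, hc, rfl⟩
  | op o s ho =>
    obtain ⟨d, hd, hs⟩ := o.runList_code hB hc ho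
    obtain ⟨h1, h2⟩ := Steps.of_runList o.code_not_jump hP hd
    exact ⟨_, d, h1, o.length_code_le, hs, h2⟩
  | @seq a b s s' s'' t t' _ _ iha ihb =>
    obtain ⟨t₁, d, h1, h2, h3, h4⟩ := iha hP.left hc
    have hP' := hP.right
    rw [Com.length_compile, ← h4] at hP'
    obtain ⟨t₂, e, k1, k2, k3, k4⟩ := ihb hP' h3
    exact ⟨_, e, h1.trans k1, by omega, k3, by rw [k4, h4, Com.size]; ring⟩
  | @ite_pos k a b s s' t hk hh _ ih =>
    have hj := hc.jump (B := B) hk (c.pc + 2 + b.size)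
    rw [if_pos hh] at hj
    have hP' := hP.tail.right.tail
    rw [Com.length_compile, show c.pc + 1 + b.size + 1 = c.pc + 2 + b.size by ring] at hP'
    obtain ⟨t₁, d, h1, h2, h3, h4⟩ := ih (c := { c with pc := c.pc + 2 + b.size }) hP' (hc.setPc _)
    exact ⟨_, d, .step hP.head hj h1, by omega, h3, by rw [h4, Com.size]; dsimp; ring⟩
  | @ite_neg k a b s s' t hk hh _ ih =>
    have hj := hc.jump (B := B) hk (c.pc + 2 + b.size)
    rw [if_neg hh] at hj
    obtain ⟨t₁, d, h1, h2, h3, h4⟩ := ih (c := { c with pc := c.pc + 1 }) hP.tail.left (hc.setPc _)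
    have hP' := hP.tail.right.head
    rw [Com.length_compile] at hP'
    dsimp at h4
    rw [← h4] at hP'
    have last : Steps B P d 1 { d with pc := c.pc + 2 + b.size + a.size } :=
      .step hP' (by simp [exec]) (.refl _)
    exact ⟨_, _, .step hP.head hj (h1.trans last), by omega, h3.setPc _,
      by rw [Com.size]; dsimp; ring⟩
  | @done k a s hk hh =>
    have hj := hc.jump (B := B) hk (c.pc + 2 + a.size)
    rw [if_pos hh] at hj
    exact ⟨_, _, .step hP.head hj (.refl _), by omega, hc.setPc _, by rw [Com.size]; dsimp; ring⟩
  | @loop k a s s' s'' t t' hk hh _ _ iha ihb =>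
    have hj := hc.jump (B := B) hk (c.pc + 2 + a.size)
    rw [if_neg hh] at hj
    obtain ⟨t₁, d, h1, h2, h3, h4⟩ := iha (c := { c with pc := c.pc + 1 }) hP.tail.left (hc.setPc _)
    have hP' := hP.tail.right.head
    rw [Com.length_compile] at hP'
    dsimp at h4
    rw [← h4] at hP'
    have back : Steps B P d 1 { d with pc := c.pc } := .step hP' (by simp [exec]) (.refl _)
    obtain ⟨t₂, e, k1, k2, k3, k4⟩ := ihb (c := { d with pc := c.pc }) hP (h3.setPc _)
    exact ⟨_, e, .step hP.head hj (h1.trans (back.trans k1)), by omega, k3, k4⟩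

/-! ### Total correctness -/

/-- Started in `s`, the program `a` terminates, in a state and after a time that satisfy `Q`. -/
def Tri (n M : ℕ) (a : Com) (s : St) (Q : ℕ → St → Prop) : Prop :=
  ∃ t s', Big n M a s t s' ∧ Q t s'

theorem Tri.mono {n M : ℕ} {a : Com} {s : St} {Q Q' : ℕ → St → Prop} (h : Tri n M a s Q)
    (hQ : ∀ t s', Q t s' → Q' t s') : Tri n M a s Q' := by
  obtain ⟨t, s', h1, h2⟩ := h
  exact ⟨t, s', h1, hQ _ _ h2⟩

/-- Nesting the second triple in the postcondition of the first allows programs to be verified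
forwards, with the elapsed time carried along exactly. -/
theorem Tri.seq {n M : ℕ} {a b : Com} {s : St} {Q : ℕ → St → Prop}
    (h : Tri n M a s fun t s' => Tri n M b s' fun t' s'' => Q (t + t') s'') :
    Tri n M (.seq a b) s Q := by
  obtain ⟨t, s', h1, t', s'', h2, h3⟩ := h
  exact ⟨_, _, .seq h1 h2, h3⟩

theorem Tri.ite {n M : ℕ} {c : Cond} {a b : Com} {s : St} {Q : ℕ → St → Prop} (hc : c.Safe)
    (h1 : c.Holds s → Tri n M a s fun t s' => Q (t + 2) s')
    (h2 : ¬ c.Holds s → Tri n M b s fun t s' => Q (t + 2) s') : Tri n M (.ite c a b) s Q := by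
  by_cases h : c.Holds s
  · obtain ⟨t, s', k1, k2⟩ := h1 h
    exact ⟨_, _, .ite_pos hc h k1, k2⟩
  · obtain ⟨t, s', k1, k2⟩ := h2 h
    exact ⟨_, _, .ite_neg hc h k1, k2⟩

theorem Tri.done {n M : ℕ} {c : Cond} {a : Com} {s : St} {Q : ℕ → St → Prop} (hc : c.Safe)
    (h : c.Holds s) (hQ : Q 1 s) : Tri n M (.repeatUntil c a) s Q :=
  ⟨_, _, .done hc h, hQ⟩

theorem Tri.loop {n M : ℕ} {c : Cond} {a : Com} {s : St} {Q : ℕ → St → Prop} (hc : c.Safe)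
    (h : ¬ c.Holds s) (hQ : Tri n M a s fun t s' =>
      Tri n M (.repeatUntil c a) s' fun t' s'' => Q (t + t' + 2) s'') :
    Tri n M (.repeatUntil c a) s Q := by
  obtain ⟨t, s', h1, t', s'', h2, h3⟩ := hQ
  exact ⟨_, _, .loop hc h h1 h2, h3⟩

def Com.ops : List Op → Com
  | [] => .skip
  | o :: l => .seq (.op o) (ops l)

/-- The weakest precondition of a list of instructions. -/
def wp (n M : ℕ) : List Op → St → (St → Prop) → Prop
  | [], s, Q => Q s
  | o :: l, s, Q => o.Safe n M s ∧ wp n M l (o.eff s) Q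

theorem Tri.ops {n M : ℕ} {l : List Op} {s : St} {Q : ℕ → St → Prop}
    (h : wp n M l s (Q l.length)) : Tri n M (.ops l) s Q := by
  suffices ∃ s', Big n M (.ops l) s l.length s' ∧ Q l.length s' by
    obtain ⟨s', h1, h2⟩ := this
    exact ⟨_, s', h1, h2⟩
  revert h
  generalize Q l.length = R
  intro h
  induction l generalizing s with
  | nil => exact ⟨s, .skip s, h⟩
  | cons o l ih =>
    obtain ⟨s', h1, h2⟩ := ih h.2
    refine ⟨s', ?_, h2⟩
    have := Big.seq (.op o s h.1) h1
    rwa [add_comm] at this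

end RAM

/-! ## Buckets of edges -/

namespace RAM

/-- `f` with the value at `(a, b)` replaced by `o`. -/
def setAt {n : ℕ} (f : Fin n → Fin n → Option ℕ) (a b : Fin n) (o : Option ℕ) :
    Fin n → Fin n → Option ℕ :=
  fun v u => if v = a ∧ u = b then o else f v u

/-- The arrays `2` (number of entries), `3` (entries) and `4` (positions) hold, for each node `v` and
each level `j`, the bucket of the `u` with `f v u = some j`. -/
structure Buckets (n : ℕ) (ia : ℕ × ℕ × ℕ → ℕ) (f : Fin n → Fin n → Option ℕ) : Prop where
  pos : ∀ (v u : Fin n) (j : ℕ), f v u = some j →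
    ia (4, v, u) < ia (2, j, v) ∧ ia (3, j * n + v, ia (4, v, u)) = u
  entry : ∀ (v : Fin n) (j p : ℕ), p < ia (2, j, v) →
    ∃ u : Fin n, f v u = some j ∧ ia (3, j * n + v, p) = u ∧ ia (4, v, u) = p

/-- The arrays after the removal of `b` from the bucket of `a` on the level `j`. -/
def removeArr (n : ℕ) (ia : ℕ × ℕ × ℕ → ℕ) (a b j : ℕ) : ℕ × ℕ × ℕ → ℕ :=
  let q := ia (4, a, b)
  let c := ia (2, j, a) - 1
  let l := ia (3, j * n + a, c)
  Function.update (Function.update (Function.update ia (3, j * n + a, q) l) (4, a, l) q) (2, j, a) c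

/-- The arrays after `b` has been appended to the bucket of `a` on the level `j`. -/
def appendArr (n : ℕ) (ia : ℕ × ℕ × ℕ → ℕ) (a b j : ℕ) : ℕ × ℕ × ℕ → ℕ :=
  let c := ia (2, j, a)
  Function.update (Function.update (Function.update ia (3, j * n + a, c) b) (4, a, b) c)
    (2, j, a) (c + 1)

theorem row_inj {n : ℕ} {v v' : Fin n} {j j' : ℕ} :
    j * n + (v : ℕ) = j' * n + (v' : ℕ) ↔ j = j' ∧ v = v' := by
  constructor
  · intro h
    obtain ⟨h1, h2⟩ := mul_add_inj v.2 v'.2 h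
    exact ⟨h1, Fin.ext h2⟩
  · rintro ⟨rfl, rfl⟩; rfl

/-- The last entry l fills the hole left by b. Within a bucket the position determines the entry, so
no other position or slot is affected. If b is itself the last entry, then l = b and the same writes
are harmless. -/
theorem Buckets.remove {n : ℕ} {ia : ℕ × ℕ × ℕ → ℕ} {f : Fin n → Fin n → Option ℕ}
    (h : Buckets n ia f) {a b : Fin n} {j : ℕ} (hab : f a b = some j) :
    Buckets n (removeArr n ia a b j) (setAt f a b none) := by
  obtain ⟨hq, hqb⟩ := h.pos a b j hab
  obtain ⟨l, hl, hlc, hlp⟩ := h.entry a j (ia (2, j, a) - 1) (by omega)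
  have hcnt : ∀ (v : Fin n) (j' : ℕ), removeArr n ia a b j (2, j', v) =
      if j' = j ∧ v = a then ia (2, j, a) - 1 else ia (2, j', v) := by
    intro v j'
    simp [removeArr, Function.update_apply, Fin.val_inj]
  have hpos : ∀ (v u : Fin n), removeArr n ia a b j (4, v, u) =
      if v = a ∧ u = l then ia (4, a, b) else ia (4, v, u) := by
    intro v u
    simp [removeArr, Function.update_apply, Fin.val_inj, hlc]
  have hslot : ∀ (v : Fin n) (j' p : ℕ), removeArr n ia a b j (3, j' * n + v, p) =
      if (j' = j ∧ v = a) ∧ p = ia (4, a, b) then (l : ℕ) else ia (3, j' * n + v, p) := by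
    intro v j' p
    simp [removeArr, Function.update_apply, hlc, row_inj]
  have inj : ∀ u j', f a u = some j' → j' = j → ia (4, a, u) = ia (4, a, b) → u = b := by
    intro u j' h1 h2 h3
    obtain ⟨h4, h5⟩ := h.pos a u j' h1
    rw [h2, h3, hqb] at h5
    exact (Fin.ext h5).symm
  have inj' : ∀ u j', f a u = some j' → j' = j → ia (4, a, u) = ia (2, j, a) - 1 → u = l := by
    intro u j' h1 h2 h3
    obtain ⟨h4, h5⟩ := h.pos a u j' h1
    rw [h2, h3, hlc] at h5
    exact (Fin.ext h5).symm
  constructor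
  · intro v u j' hf
    have hne : ¬ (v = a ∧ u = b) := by
      intro hc; simp [setAt, hc] at hf
    have hf' : f v u = some j' := by simpa [setAt, hne] using hf
    obtain ⟨k1, k2⟩ := h.pos v u j' hf'
    rw [hpos, hcnt, hslot]
    by_cases hv : v = a
    · subst hv
      have hub : u ≠ b := fun hc => hne ⟨rfl, hc⟩
      by_cases hjj : j' = j
      · subst hjj
        by_cases hul : u = l
        · subst hul
          simp only [and_self, if_true]
          have : ia (4, v, b) ≠ ia (2, j', v) - 1 := fun hc => hub (inj' b j' hab rfl hc).symm
          exact ⟨by omega, trivial⟩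
        · have n1 : ia (4, v, u) ≠ ia (4, v, b) := fun hc => hub (inj u j' hf' rfl hc)
          have n2 : ia (4, v, u) ≠ ia (2, j', v) - 1 := fun hc => hul (inj' u j' hf' rfl hc)
          simp only [hul, n1, and_self, and_false, if_true, if_false]
          exact ⟨by omega, k2⟩
      · have hul : u ≠ l := by
          rintro rfl
          rw [hl] at hf'
          exact hjj (by simpa using hf'.symm)
        simp [hul, hjj, k1, k2]
    · simp [hv, k1, k2]
  · intro v j' p hp
    rw [hcnt] at hp
    by_cases hh : j' = j ∧ v = a
    · obtain ⟨rfl, rfl⟩ := hh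
      simp only [and_self, if_true] at hp
      by_cases hpq : p = ia (4, v, b)
      · refine ⟨l, ?_, ?_, ?_⟩
        · have : l ≠ b := by rintro rfl; omega
          simp [setAt, this, hl]
        · simp [hslot, hpq]
        · simp [hpos, hpq]
      · obtain ⟨u, h1, h2, h3⟩ := h.entry v j' p (by omega)
        have n1 : u ≠ b := by rintro rfl; exact hpq h3.symm
        have n2 : u ≠ l := by rintro rfl; omega
        refine ⟨u, by simp [setAt, n1, h1], by simp [hslot, hpq, h2], by simp [hpos, n2, h3]⟩
    · rw [if_neg hh] at hp
      obtain ⟨u, h1, h2, h3⟩ := h.entry v j' p hp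
      have n1 : ¬ (v = a ∧ u = b) := by
        rintro ⟨rfl, rfl⟩
        rw [hab] at h1
        exact hh ⟨by simpa using h1.symm, rfl⟩
      have n2 : ¬ (v = a ∧ u = l) := by
        rintro ⟨rfl, rfl⟩
        rw [hl] at h1
        exact hh ⟨by simpa using h1.symm, rfl⟩
      refine ⟨u, by simp [setAt, n1, h1], by simp [hslot, hh, h2], by simp [hpos, n2, h3]⟩

theorem Buckets.append {n : ℕ} {ia : ℕ × ℕ × ℕ → ℕ} {f : Fin n → Fin n → Option ℕ}
    (h : Buckets n ia f) {a b : Fin n} (j : ℕ) (hab : f a b = none) :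
    Buckets n (appendArr n ia a b j) (setAt f a b (some j)) := by
  have hcnt : ∀ (v : Fin n) (j' : ℕ), appendArr n ia a b j (2, j', v) =
      if j' = j ∧ v = a then ia (2, j, a) + 1 else ia (2, j', v) := by
    intro v j'
    simp [appendArr, Function.update_apply, Fin.val_inj]
  have hpos : ∀ (v u : Fin n), appendArr n ia a b j (4, v, u) =
      if v = a ∧ u = b then ia (2, j, a) else ia (4, v, u) := by
    intro v u
    simp [appendArr, Function.update_apply, Fin.val_inj]
  have hslot : ∀ (v : Fin n) (j' p : ℕ), appendArr n ia a b j (3, j' * n + v, p) =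
      if (j' = j ∧ v = a) ∧ p = ia (2, j, a) then (b : ℕ) else ia (3, j' * n + v, p) := by
    intro v j' p
    simp [appendArr, Function.update_apply, row_inj]
  constructor
  · intro v u j' hf
    rw [hpos, hcnt, hslot]
    by_cases hh : v = a ∧ u = b
    · obtain ⟨rfl, rfl⟩ := hh
      have : j' = j := by simpa [setAt] using hf.symm
      subst this
      simp
    · have hf' : f v u = some j' := by simpa [setAt, hh] using hf
      obtain ⟨k1, k2⟩ := h.pos v u j' hf'
      rw [if_neg hh]
      by_cases h2 : j' = j ∧ v = a
      · obtain ⟨rfl, rfl⟩ := h2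
        have : ia (4, v, u) ≠ ia (2, j', v) := by omega
        simp only [and_self, this, and_false, if_true, if_false]
        exact ⟨by omega, k2⟩
      · simp [h2, k1, k2]
  · intro v j' p hp
    rw [hcnt] at hp
    by_cases hh : (j' = j ∧ v = a) ∧ p = ia (2, j, a)
    · obtain ⟨⟨rfl, rfl⟩, rfl⟩ := hh
      exact ⟨b, by simp [setAt], by simp [hslot], by simp [hpos]⟩
    · have hp' : p < ia (2, j', v) := by
        split_ifs at hp with h2
        · have : p ≠ ia (2, j, a) := fun hc => hh ⟨h2, hc⟩
          rw [h2.1, h2.2]; omega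
        · exact hp
      obtain ⟨u, h1, h2, h3⟩ := h.entry v j' p hp'
      have n1 : ¬ (v = a ∧ u = b) := by
        rintro ⟨rfl, rfl⟩
        rw [hab] at h1; cases h1
      exact ⟨u, by simp [setAt, n1, h1], by simp [hslot, hh, h2], by simp [hpos, n1, h3]⟩

/-- Positions map the members of the bucket bijectively onto an initial segment. This identifies the
stored counter, hence the scanning time, with a number of neighbours. -/
theorem Buckets.card {n : ℕ} {ia : ℕ × ℕ × ℕ → ℕ} {f : Fin n → Fin n → Option ℕ}
    (h : Buckets n ia f) (v : Fin n) (j : ℕ) :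
    ia (2, j, v) = (Finset.univ.filter fun u => f v u = some j).card := by
  rw [← Finset.card_range (ia (2, j, v))]
  symm
  apply Finset.card_bij (fun (u : Fin n) _ => ia (4, (v : ℕ), (u : ℕ)))
  · intro u hu
    simpa using (h.pos v u j (by simpa using hu)).1
  · intro u hu u' hu' he
    have h1 := (h.pos v u j (by simpa using hu)).2
    have h2 := (h.pos v u' j (by simpa using hu')).2
    rw [he, h2] at h1
    exact (Fin.ext h1).symm
  · intro p hp
    obtain ⟨u, h1, h2, h3⟩ := h.entry v j p (by simpa using hp)
    exact ⟨u, by simpa using h1, h3⟩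

theorem Buckets.card_le {n : ℕ} {ia : ℕ × ℕ × ℕ → ℕ} {f : Fin n → Fin n → Option ℕ}
    (h : Buckets n ia f) (v : Fin n) (j : ℕ) : ia (2, j, v) ≤ n := by
  rw [h.card v j]
  exact (Finset.card_le_univ _).trans (by simp)

/-- Strictness guarantees that the slot used by an append lies in a column below n. -/
theorem Buckets.card_lt {n : ℕ} {ia : ℕ × ℕ × ℕ → ℕ} {f : Fin n → Fin n → Option ℕ}
    (h : Buckets n ia f) {v u : Fin n} {j : ℕ} (hu : f v u ≠ some j) : ia (2, j, v) < n := by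
  rw [h.card v j]
  have := Finset.card_lt_univ_of_notMem (s := Finset.univ.filter fun u => f v u = some j) (x := u)
    (by simpa using hu)
  simpa using this

/-- Buckets depend on the arrays `2`, `3` and `4` only. -/
theorem Buckets.congr {n : ℕ} {ia ia' : ℕ × ℕ × ℕ → ℕ} {f : Fin n → Fin n → Option ℕ}
    (h : Buckets n ia f) (h' : ∀ a x y, 2 ≤ a → a ≤ 4 → ia' (a, x, y) = ia (a, x, y)) :
    Buckets n ia' f := by
  constructor
  · intro v u j hf
    rw [h' 4 _ _ (by norm_num) (by norm_num), h' 2 _ _ (by norm_num) (by norm_num),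
      h' 3 _ _ (by norm_num) (by norm_num)]
    exact h.pos v u j hf
  · intro v j p hp
    rw [h' 2 _ _ (by norm_num) (by norm_num)] at hp
    obtain ⟨u, h1, h2, h3⟩ := h.entry v j p hp
    exact ⟨u, h1, by rw [h' 3 _ _ (by norm_num) (by norm_num), h2],
      by rw [h' 4 _ _ (by norm_num) (by norm_num), h3]⟩

theorem removeArr_of_ne {n : ℕ} {ia : ℕ × ℕ × ℕ → ℕ} {a b j k x y : ℕ}
    (h : k < 2 ∨ 4 < k) : removeArr n ia a b j (k, x, y) = ia (k, x, y) := by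
  have h2 : k ≠ 2 := by omega
  have h3 : k ≠ 3 := by omega
  have h4 : k ≠ 4 := by omega
  simp [removeArr, h2, h3, h4]

theorem appendArr_of_ne {n : ℕ} {ia : ℕ × ℕ × ℕ → ℕ} {a b j k x y : ℕ}
    (h : k < 2 ∨ 4 < k) : appendArr n ia a b j (k, x, y) = ia (k, x, y) := by
  have h2 : k ≠ 2 := by omega
  have h3 : k ≠ 3 := by omega
  have h4 : k ≠ 4 := by omega
  simp [appendArr, h2, h3, h4]

/-! ### Code -/

/-- Remove register `b` from the bucket of register `a` on the level in register `j`. -/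
def removeCode (a b j : ℕ) : Com := .ops
  [.ld 20 4 a b, .mul 21 j 3, .add 21 21 a, .ld 22 2 j a, .sub 22 22 5, .ld 23 3 21 22,
    .st 3 21 20 23, .st 4 a 23 20, .st 2 j a 22]

/-- Append register `b` to the bucket of register `a` on the level in register `j`. -/
def appendCode (a b j : ℕ) : Com := .ops
  [.mul 21 j 3, .add 21 21 a, .ld 22 2 j a, .st 3 21 22 b, .st 4 a b 22, .add 22 22 5,
    .st 2 j a 22]

theorem tri_remove {n M : ℕ} (hM : n < M) {s : St} {f : Fin n → Fin n → Option ℕ}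
    (H : Buckets n s.ia f) (a b j : ℕ) (ha : a < 20) (hb : b < 20) (hj : j < 20)
    {x y : Fin n} (hx : s.ireg a = x) (hy : s.ireg b = y) {i : ℕ} (hi : s.ireg j = i)
    (hiM : (i + 1) * n ≤ M) (h3 : s.ireg 3 = n) (h5 : s.ireg 5 = 1) (hf : f x y = some i) :
    Tri n M (removeCode a b j) s fun t s' => t = 9 ∧ s'.ia = removeArr n s.ia x y i ∧
      (∀ r < 20, s'.ireg r = s.ireg r) ∧ s'.rreg = s.rreg ∧ s'.ra = s.ra ∧ s'.cov = s.cov := by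
  apply Tri.ops
  have n1 : ∀ r, 20 ≤ r → a ≠ r := fun r hr => by omega
  have n3 : ∀ r, 20 ≤ r → j ≠ r := fun r hr => by omega
  obtain ⟨hq, -⟩ := H.pos x y i hf
  obtain ⟨l, -, hl, -⟩ := H.entry x i (s.ia (2, i, x) - 1) (by omega)
  have hc := H.card_le x i
  have hxn := x.2
  have hyn := y.2
  have hln := l.2
  have hin : i * n + n ≤ M := by linarith
  have hiM' : i < M := by nlinarith
  simp only [wp, Op.Safe, Op.eff]
  simp [n1, n3, hx, hy, hi, h3, h5, hl]
  and_intros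
  any_goals omega
  · simp [removeArr, hl]
  · intro r hr
    have : ∀ k, 20 ≤ k → r ≠ k := fun r hr => by omega
    simp [this]

theorem tri_append {n M : ℕ} (hM : n < M) {s : St} {f : Fin n → Fin n → Option ℕ}
    (H : Buckets n s.ia f) (a b j : ℕ) (ha : a < 20) (hb : b < 20) (hj : j < 20)
    {x y : Fin n} (hx : s.ireg a = x) (hy : s.ireg b = y) {i : ℕ} (hi : s.ireg j = i)
    (hiM : (i + 1) * n ≤ M) (h3 : s.ireg 3 = n) (h5 : s.ireg 5 = 1) (hf : f x y = none) :
    Tri n M (appendCode a b j) s fun t s' => t = 7 ∧ s'.ia = appendArr n s.ia x y i ∧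
      (∀ r < 20, s'.ireg r = s.ireg r) ∧ s'.rreg = s.rreg ∧ s'.ra = s.ra ∧ s'.cov = s.cov := by
  apply Tri.ops
  have n1 : ∀ r, 20 ≤ r → a ≠ r := fun r hr => by omega
  have n2 : ∀ r, 20 ≤ r → b ≠ r := fun r hr => by omega
  have n3 : ∀ r, 20 ≤ r → j ≠ r := fun r hr => by omega
  have hc : s.ia (2, i, x) < n := H.card_lt (u := y) (by simp [hf])
  have hxn := x.2
  have hyn := y.2
  have hin : i * n + n ≤ M := by linarith
  have hiM' : i < M := by nlinarith
  simp only [wp, Op.Safe, Op.eff]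
  simp [n1, n2, n3, hx, hy, hi, h3, h5]
  and_intros
  any_goals omega
  · simp [appendArr]
  · intro r hr
    have : ∀ k, 20 ≤ k → r ≠ k := fun r hr => by omega
    simp [this]

end RAM

/-! ## The representation of a levelled graph -/

namespace RAM

open Finset

/-- The weight of an edge on a given level. -/
noncomputable def val (δ : ℝ) : Option ℕ → ℝ
  | none => 0
  | some j => ((1 + δ)⁻¹) ^ j

/-- The total weight at `v`. -/
noncomputable def wt {n : ℕ} (δ : ℝ) (f : Fin n → Fin n → Option ℕ) (v : Fin n) : ℝ :=
  ∑ u, val δ (f v u)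

/-- `f` with the value at `{a, b}` replaced by `o`. -/
def setEdge {n : ℕ} (f : Fin n → Fin n → Option ℕ) (a b : Fin n) (o : Option ℕ) :
    Fin n → Fin n → Option ℕ :=
  fun v u => if (v = a ∧ u = b) ∨ (v = b ∧ u = a) then o else f v u

structure Consts (n : ℕ) (δ : ℝ) (s : St) : Prop where
  i3 : s.ireg 3 = n
  i4 : s.ireg 4 = 0
  i5 : s.ireg 5 = 1
  r0 : s.rreg 0 = 64 * δ
  r1 : s.rreg 1 = 1
  r2 : s.rreg 2 = 1 + δ
  r3 : s.rreg 3 = (1 + δ)⁻¹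
  r4 : s.rreg 4 = 1 - 12 * δ

/-- The state holds the edge levels `f`, the node levels `lev` and the node weights `W`. -/
structure Rep (n : ℕ) (δ : ℝ) (s : St) (f : Fin n → Fin n → Option ℕ) (lev : Fin n → ℕ)
    (W : Fin n → ℝ) : Prop where
  buckets : Buckets n s.ia f
  level : ∀ v : Fin n, s.ia (1, 0, v) = lev v
  weight : ∀ (v u : Fin n) (j : ℕ), f v u = some j → s.ra (0, v, u) = ((1 + δ)⁻¹) ^ j
  sum : ∀ v : Fin n, s.ra (1, 0, v) = W v
  scale : ∀ v : Fin n, s.ra (2, 0, v) = 1 - ((1 + δ)⁻¹) ^ lev v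
  cov_pos : ∀ v : Fin n, 1 - 12 * δ ≤ W v → s.cov v = 1
  cov_neg : ∀ v : Fin n, ¬ 1 - 12 * δ ≤ W v → s.cov v = 0

/-- Only temporary registers and the edge data have changed. -/
structure Frame (s s' : St) : Prop where
  ireg : ∀ r < 20, s'.ireg r = s.ireg r
  rreg : ∀ r, r ≠ 5 → r ≠ 6 → r ≠ 8 → r ≠ 9 → s'.rreg r = s.rreg r
  ia : ∀ k x y, k < 2 ∨ 4 < k → s'.ia (k, x, y) = s.ia (k, x, y)

theorem Frame.trans {s s' s'' : St} (h : Frame s s') (h' : Frame s' s'') : Frame s s'' :=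
  ⟨fun r hr => (h'.ireg r hr).trans (h.ireg r hr),
    fun r h1 h2 h3 h4 => (h'.rreg r h1 h2 h3 h4).trans (h.rreg r h1 h2 h3 h4),
    fun k x y hk => (h'.ia k x y hk).trans (h.ia k x y hk)⟩

theorem Frame.consts {n : ℕ} {δ : ℝ} {s s' : St} (h : Frame s s') (hc : Consts n δ s) :
    Consts n δ s' := by
  constructor
  · rw [h.ireg 3 (by norm_num), hc.i3]
  · rw [h.ireg 4 (by norm_num), hc.i4]
  · rw [h.ireg 5 (by norm_num), hc.i5]
  · rw [h.rreg 0 (by norm_num) (by norm_num) (by norm_num) (by norm_num), hc.r0]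
  · rw [h.rreg 1 (by norm_num) (by norm_num) (by norm_num) (by norm_num), hc.r1]
  · rw [h.rreg 2 (by norm_num) (by norm_num) (by norm_num) (by norm_num), hc.r2]
  · rw [h.rreg 3 (by norm_num) (by norm_num) (by norm_num) (by norm_num), hc.r3]
  · rw [h.rreg 4 (by norm_num) (by norm_num) (by norm_num) (by norm_num), hc.r4]

/-! ### Unlinking, linking and reweighting a single edge -/

section
variable {n M : ℕ} {δ : ℝ} {s : St} {f : Fin n → Fin n → Option ℕ} {lev : Fin n → ℕ}
  {W : Fin n → ℝ}

theorem tri_remove_rep (hM : n < M) (hc : Consts n δ s) (H : Rep n δ s f lev W)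
    (a b j : ℕ) (ha : a < 20) (hb : b < 20) (hj : j < 20)
    {x y : Fin n} (hx : s.ireg a = x) (hy : s.ireg b = y) {i : ℕ} (hi : s.ireg j = i)
    (hiM : (i + 1) * n ≤ M) (hf : f x y = some i) :
    Tri n M (removeCode a b j) s fun t s' => t = 9 ∧ Rep n δ s' (setAt f x y none) lev W ∧
      Frame s s' ∧ s'.ia = removeArr n s.ia x y i ∧ s'.rreg = s.rreg ∧ s'.ra = s.ra := by
  refine (tri_remove hM H.buckets a b j ha hb hj hx hy hi hiM hc.i3 hc.i5 hf).mono ?_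
  rintro t s' ⟨ht, h1, h2, h3, h4, h5⟩
  have hf' : ∀ v u j', setAt f x y none v u = some j' → f v u = some j' := by
    intro v u j' h
    unfold setAt at h
    split_ifs at h
    exact h
  refine ⟨ht, ⟨h1 ▸ H.buckets.remove hf, fun v => ?_, fun v u j' h => ?_, ?_, ?_, ?_, ?_⟩,
    ⟨h2, fun r _ _ _ _ => by rw [h3], fun k p q hk => by rw [h1, removeArr_of_ne hk]⟩, h1, h3, h4⟩
  · rw [h1, removeArr_of_ne (by norm_num), H.level]
  · rw [h4, H.weight v u j' (hf' v u j' h)]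
  · rw [h4]; exact H.sum
  · rw [h4]; exact H.scale
  · rw [h5]; exact H.cov_pos
  · rw [h5]; exact H.cov_neg

theorem tri_append_rep (hM : n < M) (hc : Consts n δ s) (H : Rep n δ s f lev W)
    (a b j : ℕ) (ha : a < 20) (hb : b < 20) (hj : j < 20)
    {x y : Fin n} (hx : s.ireg a = x) (hy : s.ireg b = y) {i : ℕ} (hi : s.ireg j = i)
    (hiM : (i + 1) * n ≤ M) (hf : f x y = none) (hw : s.ra (0, x, y) = ((1 + δ)⁻¹) ^ i) :
    Tri n M (appendCode a b j) s fun t s' => t = 7 ∧ Rep n δ s' (setAt f x y (some i)) lev W ∧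
      Frame s s' ∧ s'.ia = appendArr n s.ia x y i ∧ s'.rreg = s.rreg ∧ s'.ra = s.ra := by
  refine (tri_append hM H.buckets a b j ha hb hj hx hy hi hiM hc.i3 hc.i5 hf).mono ?_
  rintro t s' ⟨ht, h1, h2, h3, h4, h5⟩
  refine ⟨ht, ⟨h1 ▸ H.buckets.append i hf, fun v => ?_, fun v u j' h => ?_, ?_, ?_, ?_, ?_⟩,
    ⟨h2, fun r _ _ _ _ => by rw [h3], fun k p q hk => by rw [h1, appendArr_of_ne hk]⟩, h1, h3, h4⟩
  · rw [h1, appendArr_of_ne (by norm_num), H.level]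
  · rw [h4]
    by_cases hh : v = x ∧ u = y
    · obtain ⟨rfl, rfl⟩ := hh
      have : j' = i := by simpa [setAt] using h.symm
      rw [this, hw]
    · exact H.weight v u j' (by simpa [setAt, hh] using h)
  · rw [h4]; exact H.sum
  · rw [h4]; exact H.scale
  · rw [h5]; exact H.cov_pos
  · rw [h5]; exact H.cov_neg

/-- Add real register `5` to the weight of the node in register `a`. -/
def addWeightCode (a : ℕ) : Com :=
  .seq (.ops [.rld 6 1 4 a, .radd 6 6 5, .rst 1 4 a 6])
    (.ite (.rle 4 6) (.ops [.stc a 5]) (.ops [.stc a 4]))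

/-- The cover cell is rewritten together with the weight, so membership always agrees with the test
1 - 12δ ≤ W, also in the middle of a repair. -/
theorem tri_addWeight (hc : Consts n δ s) (H : Rep n δ s f lev W) (a : ℕ) (ha : a < 20)
    {x : Fin n} (hx : s.ireg a = x) :
    Tri n M (addWeightCode a) s fun t s' => t = 6 ∧
      Rep n δ s' f lev (Function.update W x (W x + s.rreg 5)) ∧
      Frame s s' ∧ s'.ia = s.ia ∧ s'.rreg 5 = s.rreg 5 := by
  have hx0 : 0 < n := x.pos
  have ha' : a < 24 := by omega
  have e6 : W x = s.ra (1, 0, x) := (H.sum x).symm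
  have hsum : ∀ v : Fin n, Function.update s.ra (1, 0, ↑x) (s.ra (1, 0, ↑x) + s.rreg 5) (1, 0, ↑v) =
      Function.update W x (W x + s.rreg 5) v := by
    intro v
    by_cases hv : v = x
    · subst hv; simp [e6]
    · have : (v : ℕ) ≠ x := fun h => hv (Fin.ext h)
      simp [hv, this, H.sum]
  have hframe : ∀ cov, Frame s
      { s with
        rreg := Function.update (Function.update s.rreg 6 (s.ra (1, 0, x))) 6
          (s.ra (1, 0, x) + s.rreg 5)
        ra := Function.update s.ra (1, 0, x) (s.ra (1, 0, x) + s.rreg 5)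
        cov := cov } := by
    intro cov
    refine ⟨fun _ _ => rfl, fun r h1 h2 h3 h4 => ?_, fun _ _ _ _ => rfl⟩
    simp [h2]
  apply Tri.seq
  apply Tri.ops
  simp only [wp, Op.Safe, Op.eff, hc.i4, hx]
  refine ⟨⟨by norm_num, ha', by norm_num, hc.i3, hx0, x.2⟩, trivial,
    ⟨by norm_num, ha', by norm_num, hc.i3, hx0, x.2⟩, ?_⟩
  apply Tri.ite (show Cond.Safe (.rle 4 6) from trivial)
  · intro hh
    simp [Cond.Holds, hc.r4] at hh
    apply Tri.ops
    simp only [wp, Op.Safe, Op.eff, hc.i5, hx]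
    refine ⟨⟨ha', by norm_num, x.2⟩, rfl, ⟨H.buckets, H.level, ?_, ?_, ?_, ?_, ?_⟩, ?_, trivial, ?_⟩
    · intro v u j h
      simpa using H.weight v u j h
    · simpa using hsum
    · intro v
      simpa using H.scale v
    · intro v hv
      by_cases hvx : v = x
      · simp [hvx]
      · have : (v : ℕ) ≠ x := fun h => hvx (Fin.ext h)
        rw [Function.update_of_ne hvx] at hv
        simp [this, H.cov_pos v hv]
    · intro v hv
      by_cases hvx : v = x
      · subst hvx
        rw [Function.update_self, e6] at hv
        exact absurd (by linarith) hv
      · have : (v : ℕ) ≠ x := fun h => hvx (Fin.ext h)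
        rw [Function.update_of_ne hvx] at hv
        simp [this, H.cov_neg v hv]
    · simpa using hframe _
    · simp
  · intro hh
    simp [Cond.Holds, hc.r4] at hh
    apply Tri.ops
    simp only [wp, Op.Safe, Op.eff, hc.i4, hx]
    refine ⟨⟨ha', by norm_num, x.2⟩, rfl, ⟨H.buckets, H.level, ?_, ?_, ?_, ?_, ?_⟩, ?_, trivial, ?_⟩
    · intro v u j h
      simpa using H.weight v u j h
    · simpa using hsum
    · intro v
      simpa using H.scale v
    · intro v hv
      by_cases hvx : v = x
      · subst hvx
        rw [Function.update_self, e6] at hv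
        linarith
      · have : (v : ℕ) ≠ x := fun h => hvx (Fin.ext h)
        rw [Function.update_of_ne hvx] at hv
        simp [this, H.cov_pos v hv]
    · intro v hv
      by_cases hvx : v = x
      · simp [hvx]
      · have : (v : ℕ) ≠ x := fun h => hvx (Fin.ext h)
        rw [Function.update_of_ne hvx] at hv
        simp [this, H.cov_neg v hv]
    · simpa using hframe _
    · simp

theorem wt_setEdge (hsym : ∀ v u, f v u = f u v) {x u : Fin n} (hxu : x ≠ u) (o : Option ℕ) :
    wt δ (setEdge f x u o) =
      Function.update (Function.update (wt δ f) x (wt δ f x + (val δ o - val δ (f x u)))) u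
        (wt δ f u + (val δ o - val δ (f x u))) := by
  have key : ∀ x u : Fin n, x ≠ u →
      wt δ (setEdge f x u o) x = wt δ f x + (val δ o - val δ (f x u)) := by
    intro x u hxu
    unfold wt
    rw [← sub_eq_iff_eq_add', ← sum_sub_distrib, Finset.sum_eq_single u]
    · simp [setEdge]
    · intro w _ hw
      simp [setEdge, hw, hxu]
    · simp
  have hswap : setEdge f x u o = setEdge f u x o := by
    funext v w
    simp only [setEdge, or_comm]
  funext v
  by_cases hu : v = u
  · subst hu
    rw [Function.update_self, hswap, key v x hxu.symm, hsym v x]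
  · rw [Function.update_of_ne hu]
    by_cases hx : v = x
    · subst hx
      rw [Function.update_self, key v u hxu]
    · rw [Function.update_of_ne hx]
      simp [wt, setEdge, hu, hx]

theorem Rep.of_weights {s' : St} (H : Rep n δ s f lev W) (hia : s'.ia = s.ia)
    (hcov : s'.cov = s.cov) (hra : ∀ k (v u : ℕ), k ≠ 0 → s'.ra (k, v, u) = s.ra (k, v, u))
    (hw : ∀ (v u : Fin n) (j : ℕ), f v u = some j → s'.ra (0, v, u) = s.ra (0, v, u)) :
    Rep n δ s' f lev W := by
  refine ⟨hia ▸ H.buckets, ?_, ?_, ?_, ?_, ?_, ?_⟩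
  · rw [hia]; exact H.level
  · intro v u j h
    rw [hw v u j h, H.weight v u j h]
  · intro v; rw [hra 1 _ _ (by norm_num), H.sum]
  · intro v; rw [hra 2 _ _ (by norm_num), H.scale]
  · rw [hcov]; exact H.cov_pos
  · rw [hcov]; exact H.cov_neg

/-- Write real register `9` as the weight of the edge between the registers `8` and `11`. -/
def storeWeight : List Op := [.rst 0 8 11 9, .rst 0 11 8 9]

/-- Unlink the edge between the registers `8` and `11` on the level in register `9`. -/
def unlinkCode : Com := .seq (removeCode 8 11 9) (removeCode 11 8 9)

/-- Link the edge between the registers `8` and `11` on the level in register `10`. -/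
def linkCode : Com := .seq (appendCode 8 11 10) (appendCode 11 8 10)

def addWeightsCode : Com := .seq (addWeightCode 8) (addWeightCode 11)

/-- The last clause records that, besides the removed entry, only the last entry of the bucket can
change its position. This is what makes a backward scan with removals correct. -/
theorem tri_unlink (hM : n < M) (hc : Consts n δ s) (H : Rep n δ s f lev W)
    {x u : Fin n} (hxu : x ≠ u) (hx : s.ireg 8 = x) (hu : s.ireg 11 = u) {i : ℕ}
    (hi : s.ireg 9 = i) (hiM : (i + 1) * n ≤ M) (hf : f x u = some i) (hf' : f u x = some i) :
    Tri n M unlinkCode s fun t s' => t = 18 ∧ Rep n δ s' (setEdge f x u none) lev W ∧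
      Frame s s' ∧ s'.rreg = s.rreg ∧ s'.ra = s.ra ∧
      ∀ w : Fin n, s.ia (4, x, w) + 1 < s.ia (2, i, x) → s'.ia (4, x, w) = s.ia (4, x, w) := by
  apply Tri.seq
  refine (tri_remove_rep hM hc H 8 11 9 (by norm_num) (by norm_num) (by norm_num) hx hu hi hiM
    hf).mono ?_
  rintro t s' ⟨rfl, R, F, a1, a2, a3⟩
  refine (tri_remove_rep hM (F.consts hc) R 11 8 9 (by norm_num) (by norm_num) (by norm_num)
    (by rw [F.ireg 11 (by norm_num), hu]) (by rw [F.ireg 8 (by norm_num), hx])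
    (by rw [F.ireg 9 (by norm_num), hi]) hiM (by simp [setAt, hf', hxu.symm])).mono ?_
  rintro t s'' ⟨rfl, R', F', b1, b2, b3⟩
  have e : setAt (setAt f x u none) u x none = setEdge f x u none := by
    funext v w
    simp only [setAt, setEdge]
    split_ifs <;> tauto
  refine ⟨rfl, e ▸ R', F.trans F', by rw [b2, a2], by rw [b3, a3], fun w hw => ?_⟩
  have hxu' : (x : ℕ) ≠ u := fun h => hxu (Fin.ext h)
  rw [b1]
  have : removeArr n s'.ia u x i (4, x, w) = s'.ia (4, x, w) := by
    simp [removeArr, hxu']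
  rw [this, a1]
  obtain ⟨l, -, hl, hp⟩ := H.buckets.entry x i (s.ia (2, i, x) - 1) (by omega)
  have hwl : (w : ℕ) ≠ l := by
    intro h
    rw [h] at hw
    omega
  simp [removeArr, hl, hwl]

theorem tri_link (hM : n < M) (hc : Consts n δ s) (H : Rep n δ s f lev W)
    {x u : Fin n} (hxu : x ≠ u) (hx : s.ireg 8 = x) (hu : s.ireg 11 = u) {i : ℕ}
    (hi : s.ireg 10 = i) (hiM : (i + 1) * n ≤ M) (hf : f x u = none) (hf' : f u x = none)
    (hw : s.ra (0, x, u) = ((1 + δ)⁻¹) ^ i) (hw' : s.ra (0, u, x) = ((1 + δ)⁻¹) ^ i) :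
    Tri n M linkCode s fun t s' => t = 14 ∧ Rep n δ s' (setEdge f x u (some i)) lev W ∧
      Frame s s' ∧ s'.rreg = s.rreg ∧
      ∀ w : Fin n, w ≠ u → s'.ia (4, x, w) = s.ia (4, x, w) := by
  apply Tri.seq
  refine (tri_append_rep hM hc H 8 11 10 (by norm_num) (by norm_num) (by norm_num) hx hu hi hiM
    hf hw).mono ?_
  rintro t s' ⟨rfl, R, F, a1, a2, a3⟩
  refine (tri_append_rep hM (F.consts hc) R 11 8 10 (by norm_num) (by norm_num) (by norm_num)
    (by rw [F.ireg 11 (by norm_num), hu]) (by rw [F.ireg 8 (by norm_num), hx])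
    (by rw [F.ireg 10 (by norm_num), hi]) hiM (by simp [setAt, hf', hxu.symm])
    (by rw [a3, hw'])).mono ?_
  rintro t s'' ⟨rfl, R', F', b1, b2, b3⟩
  have e : setAt (setAt f x u (some i)) u x (some i) = setEdge f x u (some i) := by
    funext v w
    simp only [setAt, setEdge]
    split_ifs <;> tauto
  refine ⟨rfl, e ▸ R', F.trans F', by rw [b2, a2], fun w hw => ?_⟩
  have hxu' : (x : ℕ) ≠ u := fun h => hxu (Fin.ext h)
  have hwu : (w : ℕ) ≠ u := fun h => hw (Fin.ext h)
  rw [b1, show appendArr n s'.ia u x i (4, x, w) = s'.ia (4, x, w) by simp [appendArr, hxu'], a1]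
  simp [appendArr, hwu]

theorem tri_addWeights (hc : Consts n δ s) (H : Rep n δ s f lev W)
    {x u : Fin n} (hxu : x ≠ u) (hx : s.ireg 8 = x) (hu : s.ireg 11 = u) :
    Tri n M addWeightsCode s fun t s' => t = 12 ∧
      Rep n δ s' f lev (Function.update (Function.update W x (W x + s.rreg 5)) u
        (W u + s.rreg 5)) ∧ Frame s s' ∧ s'.ia = s.ia := by
  apply Tri.seq
  refine (tri_addWeight hc H 8 (by norm_num) hx).mono ?_
  rintro t s' ⟨rfl, R, F, a1, a2⟩
  refine (tri_addWeight (F.consts hc) R 11 (by norm_num)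
    (by rw [F.ireg 11 (by norm_num), hu])).mono ?_
  rintro t s'' ⟨rfl, R', F', b1, b2⟩
  rw [Function.update_of_ne hxu.symm, a2] at R'
  exact ⟨rfl, R', F.trans F', by rw [b1, a1]⟩

/-- Move the edge between the registers `8` and `11` from the level in register `9` to the level in
register `10`, where its weight changes by the factor in real register `7`. -/
def moveCode : Com :=
  .seq unlinkCode (.seq (.ops (.rld 8 0 8 11 :: .rmul 9 8 7 :: .rsub 5 9 8 :: storeWeight))
    (.seq linkCode addWeightsCode))

/-- Between unlinking and the final weight correction, the stored node weights still belong to the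
old edge levels. That is why `Rep` keeps the node weights as a parameter independent of f. -/
theorem tri_move (hM : n < M) (hc : Consts n δ s) (H : Rep n δ s f lev (wt δ f))
    (hsym : ∀ v u, f v u = f u v) {x u : Fin n} (hxu : x ≠ u) (hx : s.ireg 8 = x)
    (hu : s.ireg 11 = u) {i i' : ℕ} (hi : s.ireg 9 = i) (hi' : s.ireg 10 = i')
    (hiM : (i + 1) * n ≤ M) (hiM' : (i' + 1) * n ≤ M) (hf : f x u = some i)
    (hr : ((1 + δ)⁻¹) ^ i' = ((1 + δ)⁻¹) ^ i * s.rreg 7) :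
    Tri n M moveCode s fun t s' => t = 49 ∧
      Rep n δ s' (setEdge f x u (some i')) lev (wt δ (setEdge f x u (some i'))) ∧ Frame s s' ∧
      ∀ w : Fin n, w ≠ u → s.ia (4, x, w) + 1 < s.ia (2, i, x) →
        s'.ia (4, x, w) = s.ia (4, x, w) := by
  have hxu' : (x : ℕ) ≠ u := fun h => hxu (Fin.ext h)
  apply Tri.seq
  refine (tri_unlink hM hc H hxu hx hu hi hiM hf (by rw [hsym, hf])).mono ?_
  rintro t s₁ ⟨rfl, R₁, F₁, a1, a2, a3⟩
  apply Tri.seq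
  apply Tri.ops
  have hx₁ : s₁.ireg 8 = x := by rw [F₁.ireg 8 (by norm_num), hx]
  have hu₁ : s₁.ireg 11 = u := by rw [F₁.ireg 11 (by norm_num), hu]
  have hi₁ : s₁.ireg 10 = i' := by rw [F₁.ireg 10 (by norm_num), hi']
  have c₁ := F₁.consts hc
  have w₁ : s₁.ra (0, x, u) = ((1 + δ)⁻¹) ^ i := by rw [a2, H.weight x u i hf]
  have r₁ : s₁.rreg 7 = s.rreg 7 := by rw [a1]
  simp only [storeWeight, wp, Op.Safe, Op.eff, hx₁, hu₁, c₁.i3]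
  refine ⟨⟨by norm_num, by norm_num, by norm_num, trivial, x.2, u.2⟩, trivial, trivial,
    ⟨by norm_num, by norm_num, by norm_num, trivial, x.2, u.2⟩,
    ⟨by norm_num, by norm_num, by norm_num, trivial, u.2, x.2⟩, ?_⟩
  simp only [Function.update_apply _ _ _ (_ : ℕ), w₁, r₁, Nat.reduceEqDiff, if_true, if_false,
    ← hr]
  generalize hs₂ : St.mk _ _ _ _ _ = s₂
  have F₂ : Frame s₁ s₂ := by
    subst hs₂
    refine ⟨fun _ _ => rfl, fun r h1 h2 h3 h4 => ?_, fun _ _ _ _ => rfl⟩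
    simp [h1, h3, h4]
  have R₂ : Rep n δ s₂ (setEdge f x u none) lev (wt δ f) := by
    subst hs₂
    refine R₁.of_weights rfl rfl (fun k v w hk => by simp [hk]) (fun v w j h => ?_)
    have n1 : ¬ (v = u ∧ w = x) := fun hh => by simp [setEdge, hh] at h
    have n2 : ¬ (v = x ∧ w = u) := fun hh => by simp [setEdge, hh] at h
    simp only [Function.update_apply, Prod.mk.injEq, true_and, Fin.val_inj, n1, n2, if_false]
  have e5 : s₂.rreg 5 = ((1 + δ)⁻¹) ^ i' - ((1 + δ)⁻¹) ^ i := by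
    subst hs₂; simp
  have ew : s₂.ra (0, x, u) = ((1 + δ)⁻¹) ^ i' ∧ s₂.ra (0, u, x) = ((1 + δ)⁻¹) ^ i' := by
    subst hs₂; simp [hxu']
  have hia₂ : s₂.ia = s₁.ia := by subst hs₂; rfl
  apply Tri.seq
  refine (tri_link hM (F₂.consts c₁) R₂ hxu (by rw [F₂.ireg 8 (by norm_num), hx₁])
    (by rw [F₂.ireg 11 (by norm_num), hu₁]) (by rw [F₂.ireg 10 (by norm_num), hi₁]) hiM'
    (by simp [setEdge]) (by simp [setEdge]) ew.1 ew.2).mono ?_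
  rintro t s₃ ⟨rfl, R₃, F₃, b1, b2⟩
  have F₁₃ := (F₁.trans F₂).trans F₃
  refine (tri_addWeights (F₁₃.consts hc) R₃ hxu (by rw [F₁₃.ireg 8 (by norm_num), hx])
    (by rw [F₁₃.ireg 11 (by norm_num), hu])).mono ?_
  rintro t s₄ ⟨rfl, R₄, F₄, c1⟩
  have e : setEdge (setEdge f x u none) x u (some i') = setEdge f x u (some i') := by
    funext v w
    simp only [setEdge]
    split_ifs <;> rfl
  refine ⟨rfl, ?_, F₁₃.trans F₄, fun w hw h => ?_⟩
  · rw [wt_setEdge hsym hxu]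
    rw [e, b1, e5] at R₄
    simpa [val, hf] using R₄
  · rw [c1, b2 w hw, hia₂, a3 w h]

end

end RAM

/-! ## Changing the level of a node -/

namespace RAM

open Finset

/-- The array `arr` holds the stack `l`, whose size is in register `reg`. -/
structure Stack {n : ℕ} (s : St) (arr reg : ℕ) (l : List (Fin n)) : Prop where
  size : s.ireg reg = l.length
  entry : ∀ p u, l[p]? = some u → s.ia (arr, p, 0) = (u : Fin n)

theorem Stack.frame {n : ℕ} {s s' : St} {arr reg : ℕ} {l : List (Fin n)} (h : Stack s arr reg l)
    (F : Frame s s') (ha : 4 < arr) (hr : reg < 20) : Stack s' arr reg l :=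
  ⟨by rw [F.ireg reg hr, h.size], fun p u hp => by rw [F.ia _ _ _ (Or.inr ha), h.entry p u hp]⟩

theorem Stack.congr {n : ℕ} {s s' : St} {arr reg : ℕ} {l : List (Fin n)} (h : Stack s arr reg l)
    (hr : s'.ireg reg = s.ireg reg) (ha : ∀ p, s'.ia (arr, p, 0) = s.ia (arr, p, 0)) :
    Stack s' arr reg l :=
  ⟨by rw [hr, h.size], fun p u hp => by rw [ha, h.entry p u hp]⟩

theorem Stack.push {n : ℕ} {s s' : St} {arr reg : ℕ} {l : List (Fin n)} (h : Stack s arr reg l)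
    {u : Fin n} (hr : s'.ireg reg = s.ireg reg + 1)
    (ha : ∀ p, s'.ia (arr, p, 0) = if p = s.ireg reg then (u : ℕ) else s.ia (arr, p, 0)) :
    Stack s' arr reg (l ++ [u]) := by
  refine ⟨by rw [hr, h.size]; simp, fun p w hp => ?_⟩
  rw [ha, h.size]
  by_cases hpl : p < l.length
  · rw [List.getElem?_append_left hpl] at hp
    rw [if_neg (by omega), h.entry p w hp]
  · rw [List.getElem?_append_right (by omega)] at hp
    have : p - l.length = 0 := by
      by_contra hne
      rw [List.getElem?_eq_none (by simp; omega)] at hp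
      cases hp
    rw [this] at hp
    have e : u = w := by simpa using hp
    rw [if_pos (by omega), e]

theorem Stack.pop {n : ℕ} {s s' : St} {arr reg : ℕ} {l : List (Fin n)} {u : Fin n}
    (h : Stack s arr reg (l ++ [u])) (hr : s'.ireg reg = s.ireg reg - 1)
    (ha : ∀ p, s'.ia (arr, p, 0) = s.ia (arr, p, 0)) : Stack s' arr reg l := by
  refine ⟨by rw [hr, h.size]; simp, fun p w hp => ?_⟩
  rw [ha, h.entry p w]
  obtain ⟨hlt, -⟩ := List.getElem?_eq_some_iff.mp hp
  rw [List.getElem?_append_left hlt, hp]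

theorem Stack.top {n : ℕ} {s : St} {arr reg : ℕ} {l : List (Fin n)} {u : Fin n}
    (h : Stack s arr reg (l ++ [u])) : s.ireg reg = l.length + 1 ∧ s.ia (arr, l.length, 0) = u :=
  ⟨by rw [h.size]; simp, h.entry _ _ (by simp)⟩

theorem Consts.congr {n : ℕ} {δ : ℝ} {s s' : St} (h : Consts n δ s)
    (hi : ∀ r, 3 ≤ r → r ≤ 5 → s'.ireg r = s.ireg r) (hr : ∀ r ≤ 4, s'.rreg r = s.rreg r) :
    Consts n δ s' := by
  constructor
  · rw [hi 3 (by norm_num) (by norm_num), h.i3]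
  · rw [hi 4 (by norm_num) (by norm_num), h.i4]
  · rw [hi 5 (by norm_num) (by norm_num), h.i5]
  · rw [hr 0 (by norm_num), h.r0]
  · rw [hr 1 (by norm_num), h.r1]
  · rw [hr 2 (by norm_num), h.r2]
  · rw [hr 3 (by norm_num), h.r3]
  · rw [hr 4 (by norm_num), h.r4]

/-- Rep only depends on the memory, and not on the stacks. -/
theorem Rep.congr {n : ℕ} {δ : ℝ} {s s' : St} {f : Fin n → Fin n → Option ℕ} {lev : Fin n → ℕ}
    {W : Fin n → ℝ} (H : Rep n δ s f lev W)
    (hia : ∀ k x y, k ≤ 4 → s'.ia (k, x, y) = s.ia (k, x, y)) (hra : s'.ra = s.ra)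
    (hcov : s'.cov = s.cov) : Rep n δ s' f lev W := by
  refine ⟨H.buckets.congr fun a x y _ h => hia a x y h, ?_, ?_, ?_, ?_, ?_, ?_⟩
  · intro v; rw [hia 1 _ _ (by norm_num), H.level]
  · rw [hra]; exact H.weight
  · rw [hra]; exact H.sum
  · rw [hra]; exact H.scale
  · rw [hcov]; exact H.cov_pos
  · rw [hcov]; exact H.cov_neg

/-- Scan the bucket of the node in register `8` on the level in register `9`, whose size is in
register `12`.  Nodes below the level in register `15` move to the bucket on the level in register
`10` and are pushed onto a stack. -/
def scanCode (arr reg : ℕ) : Com :=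
  .repeatUntil (.ile 12 4)
    (.seq (.ops [.sub 12 12 5, .mul 14 9 3, .add 14 14 8, .ld 11 3 14 12, .ld 13 1 4 11])
      (.ite (.ile 15 13) .skip
        (.seq moveCode (.ops [.st arr reg 4 11, .add reg reg 5]))))

/-- The bucket is scanned from its end: p entries are still unread, and E lists the neighbours moved
so far. An entry swapped into a hole comes from position p or beyond and has been read before, so
every neighbour that still has to move sits below p. The bound b is ℓ(x) + 1 for a raise, where the
whole bucket moves, and ℓ(x) for a drop, where neighbours on the level of x stay. -/
structure Scan {n : ℕ} (δ : ℝ) (f₀ : Fin n → Fin n → Option ℕ) (lev : Fin n → ℕ) (x : Fin n)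
    (i i' b c : ℕ) (arr reg arr' reg' : ℕ) (S S' : List (Fin n)) (s : St)
    (f : Fin n → Fin n → Option ℕ) (E : List (Fin n)) (p : ℕ) : Prop where
  consts : Consts n δ s
  rep : Rep n δ s f lev (wt δ f)
  symm : ∀ v u, f v u = f u v
  irrefl : ∀ v, f v v = none
  r8 : s.ireg 8 = x
  r9 : s.ireg 9 = i
  r10 : s.ireg 10 = i'
  r12 : s.ireg 12 = p
  r15 : s.ireg 15 = b
  ratio : ((1 + δ)⁻¹) ^ i' = ((1 + δ)⁻¹) ^ i * s.rreg 7
  off : ∀ v u, v ≠ x → u ≠ x → f v u = f₀ v u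
  on : ∀ u, f x u = f₀ x u ∨ (f₀ x u = some i ∧ lev u < b ∧ f x u = some i')
  todo : ∀ u, f x u = some i → lev u < b → s.ia (4, x, u) < p
  le : p ≤ s.ia (2, i, x)
  stack : Stack s arr reg (S ++ E)
  stack' : Stack s arr' reg' S'
  mem : ∀ u, f x u ≠ f₀ x u → u ∈ E
  length : E.length + p ≤ c

/-- Each unread entry costs at most 60 steps: 49 for moving the edge and 11 for fetching the
neighbour, the tests and the push. -/
theorem tri_scan {n M : ℕ} {δ : ℝ} {f₀ : Fin n → Fin n → Option ℕ} {lev : Fin n → ℕ} {x : Fin n}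
    {i i' b c arr reg arr' reg' : ℕ} {S S' : List (Fin n)} (hM : n < M)
    (hiM : (i + 1) * n ≤ M) (hiM' : (i' + 1) * n ≤ M) (hii : i ≠ i') (hlev : ∀ v, lev v < M)
    (hc : S.length + c < M) (hb : b < M) (ha : 5 ≤ arr ∧ arr < 8) (ha' : 5 ≤ arr')
    (haa : arr' ≠ arr) (hr : 6 ≤ reg ∧ reg ≤ 7) (hr' : 6 ≤ reg' ∧ reg' ≤ 7) (hrr : reg' ≠ reg) :
    ∀ (p : ℕ) (s : St) (f : Fin n → Fin n → Option ℕ) (E : List (Fin n)),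
      Scan δ f₀ lev x i i' b c arr reg arr' reg' S S' s f E p →
      Tri n M (scanCode arr reg) s fun t s' => t ≤ 60 * p + 1 ∧
        ∃ f' E', Scan δ f₀ lev x i i' b c arr reg arr' reg' S S' s' f' E' 0 := by
  have hn : 0 < n := x.pos
  intro p
  induction p with
  | zero =>
    intro s f E I
    refine Tri.done ⟨by norm_num, by norm_num⟩ ?_ ⟨by omega, f, E, I⟩
    simp [Cond.Holds, I.r12, I.consts.i4]
  | succ p ih =>
    intro s f E I
    have I3 := I.consts.i3
    have I4 := I.consts.i4
    have I5 := I.consts.i5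
    refine Tri.loop ⟨by norm_num, by norm_num⟩ ?_ ?_
    · simp [Cond.Holds, I.r12, I.consts.i4]
    obtain ⟨u, hu, hslot, hpos⟩ := I.rep.buckets.entry x i p (by have := I.le; omega)
    have hcard := I.rep.buckets.card_le x i
    have hple := I.le
    have hun := u.2
    have hxn := x.2
    have hin : i * n + n ≤ M := by linarith
    have hlu := hlev u
    have hxu : x ≠ u := by
      rintro rfl
      rw [I.irrefl] at hu; cases hu
    apply Tri.seq
    apply Tri.ops
    simp only [wp, Op.Safe, Op.eff]
    simp only [Function.update_apply _ _ _ (_ : ℕ), Nat.reduceEqDiff, if_true, if_false, I3, I4,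
      I5, I.r12, I.r9, I.r8, Nat.add_sub_cancel, hslot, I.rep.level]
    refine ⟨⟨by norm_num, by norm_num, by norm_num, by omega⟩,
      ⟨by norm_num, by norm_num, by norm_num, by omega⟩,
      ⟨by norm_num, by norm_num, by norm_num, by omega⟩,
      ⟨by norm_num, by norm_num, by norm_num, by norm_num, trivial, by omega, by omega, by omega⟩,
      ⟨by norm_num, by norm_num, by norm_num, by norm_num, trivial, by omega, by omega, hlu⟩, ?_⟩
    generalize hs₁ : St.mk _ _ _ _ _ = s₁
    have hi₁ : ∀ r, r ≠ 11 → r ≠ 12 → r ≠ 13 → r ≠ 14 → s₁.ireg r = s.ireg r := by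
      intro r h1 h2 h3 h4
      subst hs₁; simp [h1, h2, h3, h4]
    have h11 : s₁.ireg 11 = u := by subst hs₁; simp
    have h12 : s₁.ireg 12 = p := by subst hs₁; simp
    have h13 : s₁.ireg 13 = lev u := by subst hs₁; simp
    have hia₁ : s₁.ia = s.ia := by subst hs₁; rfl
    have hra₁ : s₁.ra = s.ra := by subst hs₁; rfl
    have hrr₁ : s₁.rreg = s.rreg := by subst hs₁; rfl
    have hcov₁ : s₁.cov = s.cov := by subst hs₁; rfl
    have c₁ : Consts n δ s₁ := I.consts.congr
      (fun r _ _ => hi₁ r (by omega) (by omega) (by omega) (by omega)) (fun r _ => by rw [hrr₁])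
    have R₁ : Rep n δ s₁ f lev (wt δ f) := I.rep.congr (fun _ _ _ _ => by rw [hia₁]) hra₁ hcov₁
    have st₁ : Stack s₁ arr reg (S ++ E) := I.stack.congr
      (hi₁ reg (by omega) (by omega) (by omega) (by omega)) (fun p => by rw [hia₁])
    have st₁' : Stack s₁ arr' reg' S' := I.stack'.congr
      (hi₁ reg' (by omega) (by omega) (by omega) (by omega)) (fun p => by rw [hia₁])
    have e8 : s₁.ireg 8 = x := by rw [hi₁ 8 (by omega) (by omega) (by omega) (by omega), I.r8]
    have e9 : s₁.ireg 9 = i := by rw [hi₁ 9 (by omega) (by omega) (by omega) (by omega), I.r9]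
    have e10 : s₁.ireg 10 = i' := by rw [hi₁ 10 (by omega) (by omega) (by omega) (by omega), I.r10]
    have e15 : s₁.ireg 15 = b := by rw [hi₁ 15 (by omega) (by omega) (by omega) (by omega), I.r15]
    have hratio : ((1 + δ)⁻¹) ^ i' = ((1 + δ)⁻¹) ^ i * s₁.rreg 7 := by rw [hrr₁]; exact I.ratio
    -- A slot holds a single neighbour, so after reading position p every other candidate lies
    -- strictly below p.
    have hpu : ∀ w, f x w = some i → w ≠ u → s.ia (4, x, w) ≠ p := by
      intro w hw hwu hp
      have := (I.rep.buckets.pos x w i hw).2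
      rw [hp, hslot] at this
      exact hwu (Fin.ext this.symm)
    apply Tri.ite (show Cond.Safe (.ile 15 13) from ⟨by norm_num, by norm_num⟩)
    · intro hh
      simp only [Cond.Holds, e15, h13] at hh
      refine ⟨0, s₁, .skip s₁, ?_⟩
      refine (ih s₁ f E ⟨c₁, R₁, I.symm, I.irrefl, e8, e9, e10, h12, e15, hratio, I.off, I.on, ?_,
        by rw [hia₁]; omega, st₁, st₁', I.mem, by have := I.length; omega⟩).mono ?_
      · intro w hw hwb
        rw [hia₁]
        have h1 := I.todo w hw hwb
        have h2 := hpu w hw (by rintro rfl; omega)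
        omega
      · rintro t s' ⟨ht, hS⟩
        exact ⟨by simp; omega, hS⟩
    · intro hh
      simp only [Cond.Holds, e15, h13, not_le] at hh
      apply Tri.seq
      refine (tri_move hM c₁ R₁ I.symm hxu e8 h11 e9 e10 hiM hiM' hu hratio).mono ?_
      rintro t s₂ ⟨rfl, R₂, F₂, hpos₂⟩
      have c₂ := F₂.consts c₁
      have st₂ := st₁.frame F₂ (by omega) (by omega)
      have st₂' := st₁'.frame F₂ (by omega) (by omega)
      have hlen := I.length
      have hSE : (S ++ E).length + 1 < M := by rw [List.length_append]; omega
      have g11 : s₂.ireg 11 = u := by rw [F₂.ireg 11 (by norm_num), h11]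
      have n4 : reg ≠ 4 := by omega
      apply Tri.ops
      simp only [wp, Op.Safe, Op.eff, c₂.i3, c₂.i4, c₂.i5, st₂.size, g11]
      refine ⟨⟨by norm_num, by omega, by norm_num, by omega, trivial, by omega, hn⟩,
        ⟨by omega, by omega, by norm_num, hSE⟩, ?_⟩
      set f' := setEdge f x u (some i') with hf'
      have hf'u : f' x u = some i' := by simp [hf', setEdge]
      have hf'w : ∀ w, w ≠ u → f' x w = f x w := by
        intro w hw
        simp [hf', setEdge, hw, hxu]
      -- One entry has left the bucket, so its counter stays at least p after p has decreased by
      -- one.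
      have hcnt : s₂.ia (2, i, x) = s.ia (2, i, x) - 1 := by
        rw [R₂.buckets.card, I.rep.buckets.card]
        have : (univ.filter fun w => f' x w = some i) =
            (univ.filter fun w => f x w = some i).erase u := by
          ext w
          simp only [mem_filter, mem_univ, true_and, mem_erase]
          by_cases hw : w = u
          · subst hw; simp [hf'u, hii.symm]
          · simp [hw, hf'w w hw]
        rw [this, card_erase_of_mem (by simpa using hu)]
      have nreg : ∀ r, 8 ≤ r → r < 20 → Function.update s₂.ireg reg ((S ++ E).length + 1) r =
          s₁.ireg r := by
        intro r h1 h2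
        rw [Function.update_of_ne (by omega), F₂.ireg r h2]
      refine (ih _ f' (E ++ [u]) ⟨?_, ?_, ?_, ?_, ?_, ?_, ?_, ?_, ?_, ?_, ?_, ?_, ?_, ?_, ?_, ?_, ?_,
        ?_⟩).mono ?_
      · exact c₂.congr (fun r h1 h2 => Function.update_of_ne (by omega) _ _) (fun r _ => rfl)
      · refine R₂.congr (fun k y z hk => ?_) rfl rfl
        exact Function.update_of_ne (fun h => by simp at h; omega) _ _
      · intro v w
        simp only [hf', setEdge, I.symm v w]
        congr 1
        simp only [eq_iff_iff]
        tauto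
      · intro v
        have : ¬ ((v = x ∧ v = u) ∨ (v = u ∧ v = x)) := by
          rintro (⟨rfl, h⟩ | ⟨rfl, h⟩)
          · exact hxu h
          · exact hxu h.symm
        simp only [hf', setEdge, this, if_false, I.irrefl]
      · rw [← e8]; exact nreg 8 (by norm_num) (by norm_num)
      · rw [← e9]; exact nreg 9 (by norm_num) (by norm_num)
      · rw [← e10]; exact nreg 10 (by norm_num) (by norm_num)
      · rw [← h12]; exact nreg 12 (by norm_num) (by norm_num)
      · rw [← e15]; exact nreg 15 (by norm_num) (by norm_num)
      · rw [hratio]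
        simp only
        rw [F₂.rreg 7 (by norm_num) (by norm_num) (by norm_num) (by norm_num)]
      · intro v w hv hw
        rw [← I.off v w hv hw]
        simp [hf', setEdge, hv, hw]
      · intro w
        by_cases hw : w = u
        · subst hw
          right
          refine ⟨?_, hh, hf'u⟩
          rcases I.on w with h | h
          · rw [← h, hu]
          · exact h.1
        · rw [hf'w w hw]; exact I.on w
      · intro w hw hwb
        have hwu : w ≠ u := by
          rintro rfl
          rw [hf'u] at hw
          exact hii (by simpa using hw.symm)
        rw [hf'w w hwu] at hw
        have h1 := I.todo w hw hwb
        have h2 := hpu w hw hwu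
        simp only
        rw [Function.update_of_ne (fun h => by simp at h; omega), hpos₂ w hwu (by rw [hia₁]; omega),
          hia₁]
        omega
      · simp only
        rw [Function.update_of_ne (fun h => by simp at h; omega), hcnt]
        omega
      · rw [← List.append_assoc]
        refine st₂.push (u := u) ?_ ?_
        · simp [st₂.size]
        · intro q
          simp only [Function.update_apply, Prod.mk.injEq, true_and, and_true, st₂.size]
      · refine st₂'.congr ?_ ?_
        · exact Function.update_of_ne hrr _ _
        · intro q
          exact Function.update_of_ne (fun h => by simp at h; omega) _ _
      · intro w hw
        by_cases hwu : w = u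
        · simp [hwu]
        · rw [hf'w w hwu] at hw
          simp [I.mem w hw]
      · simp only [List.length_append, List.length_singleton]; omega
      · rintro t s' ⟨ht, hS⟩
        exact ⟨by simp; omega, hS⟩

/-- Set the level of the node in register `8` to register `10`. -/
def setLevelCode : Com :=
  .ops [.st 1 4 8 10, .rld 6 2 4 8, .rsub 6 1 6, .rmul 6 6 7, .rsub 6 1 6, .rst 2 4 8 6]

/-- The power (1+δ)^(-ℓ(x)) is stored and multiplied by the ratio in real register 7, not recomputed
from the level. The cell holds its complement to 1, so that the zero memory at the start is correct
for level 0. -/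
theorem tri_setLevel {n M : ℕ} {δ : ℝ} {s : St} {f : Fin n → Fin n → Option ℕ} {lev : Fin n → ℕ}
    {W : Fin n → ℝ} (hM : n < M) (hc : Consts n δ s) (H : Rep n δ s f lev W) {x : Fin n}
    {i' : ℕ} (hx : s.ireg 8 = x) (hi : s.ireg 10 = i')
    (hr : ((1 + δ)⁻¹) ^ i' = ((1 + δ)⁻¹) ^ lev x * s.rreg 7) :
    Tri n M setLevelCode s fun t s' => t = 6 ∧ Rep n δ s' f (Function.update lev x i') W ∧
      s'.ireg = s.ireg ∧ (∀ r, r ≠ 6 → s'.rreg r = s.rreg r) ∧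
      ∀ k y z, 4 < k → s'.ia (k, y, z) = s.ia (k, y, z) := by
  have hn : 0 < n := x.pos
  apply Tri.ops
  simp only [wp, Op.Safe, Op.eff]
  simp only [Function.update_apply _ _ _ (_ : ℕ), Nat.reduceEqDiff, if_true, if_false, hc.i3, hc.i4,
    hx, hi, hc.r1, H.scale]
  refine ⟨⟨by norm_num, by norm_num, by norm_num, by norm_num, trivial, by omega, x.2⟩,
    ⟨by norm_num, by norm_num, by norm_num, trivial, hn, x.2⟩, trivial, trivial, trivial,
    ⟨by norm_num, by norm_num, by norm_num, trivial, hn, x.2⟩, rfl, ⟨?_, ?_, ?_, ?_, ?_, ?_, ?_⟩,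
    trivial, ?_, ?_⟩
  · exact H.buckets.congr fun k y z h1 _ => Function.update_of_ne (fun h => by simp at h; omega) _ _
  · intro v
    by_cases hv : v = x
    · subst hv; simp
    · have : (v : ℕ) ≠ x := fun h => hv (Fin.ext h)
      simp [hv, this, H.level]
  · intro v u j h
    simpa using H.weight v u j h
  · intro v
    simpa using H.sum v
  · intro v
    by_cases hv : v = x
    · subst hv
      simp only [Function.update_self]
      rw [hr]; ring
    · have : (v : ℕ) ≠ x := fun h => hv (Fin.ext h)
      simp only [Function.update_of_ne hv]
      rw [Function.update_of_ne (fun h => by simp at h; omega), H.scale]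
  · exact H.cov_pos
  · exact H.cov_neg
  · intro r h6
    simp [h6]
  · intro k y z hk
    exact Function.update_of_ne (fun h => by simp at h; omega) _ _

open Classical in
/-- The edge levels that belong to node levels. -/
noncomputable def lvl {n : ℕ} (G : SimpleGraph (Fin n)) (lev : Fin n → ℕ) (v u : Fin n) : Option ℕ :=
  if G.Adj v u then some (max (lev v) (lev u)) else none

/-- The state holds a levelled graph and two stacks. -/
structure Good {n : ℕ} (δ : ℝ) (s : St) (G : SimpleGraph (Fin n)) (lev : Fin n → ℕ)
    (U D : List (Fin n)) : Prop where
  consts : Consts n δ s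
  rep : Rep n δ s (lvl G lev) lev (wt δ (lvl G lev))
  stackU : Stack s 5 6 U
  stackD : Stack s 6 7 D

/-- Move the node in register `8`, on the level in register `9`, to the level in register `10`. -/
def shiftCode (arr reg : ℕ) : Com :=
  .seq (.ops [.ld 12 2 9 8]) (.seq (scanCode arr reg) setLevelCode)

theorem lvl_symm {n : ℕ} (G : SimpleGraph (Fin n)) (lev : Fin n → ℕ) (v u : Fin n) :
    lvl G lev v u = lvl G lev u v := by
  by_cases h : G.Adj v u
  · simp [lvl, h, h.symm, max_comm]
  · have : ¬ G.Adj u v := fun h' => h h'.symm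
    simp [lvl, h, this]

/-- An edge at x lies on level ℓ(x) exactly if the other end is not above x. Hence the scanned
bucket has just the size that the potential pays for. -/
theorem card_lvl {n : ℕ} (G : SimpleGraph (Fin n)) (lev : Fin n → ℕ) (x : Fin n) :
    (univ.filter fun u => lvl G lev x u = some (lev x)).card = DynCover.lowCount G lev x := by
  classical
  unfold DynCover.lowCount
  congr 1
  ext u
  simp only [mem_filter, mem_univ, true_and, lvl]
  by_cases h : G.Adj x u <;> simp [h]

/-- When the scan ends, no neighbour below b is left in the old bucket. Together with the edges that
were moved, this means that all edges at x have the levels prescribed by the new level of x. The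
stack grows by at most the size of the bucket. -/
theorem tri_shift {n M : ℕ} {δ : ℝ} {s : St} {G : SimpleGraph (Fin n)} {lev : Fin n → ℕ}
    {x : Fin n} {i' b arr reg arr' reg' : ℕ} {S S' : List (Fin n)} (hM : n < M)
    (hlevM : ∀ v, (lev v + 2) * n ≤ M)
    (hb : (i' = lev x + 1 ∧ b = lev x + 1) ∨ (lev x = i' + 1 ∧ b = lev x))
    (hS : S.length + n < M) (ha : 5 ≤ arr ∧ arr < 8) (ha' : 5 ≤ arr')
    (haa : arr' ≠ arr) (hr : 6 ≤ reg ∧ reg ≤ 7) (hr' : 6 ≤ reg' ∧ reg' ≤ 7) (hrr : reg' ≠ reg)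
    (hc : Consts n δ s) (H : Rep n δ s (lvl G lev) lev (wt δ (lvl G lev)))
    (stack : Stack s arr reg S) (stack' : Stack s arr' reg' S') (h8 : s.ireg 8 = x)
    (h9 : s.ireg 9 = lev x) (h10 : s.ireg 10 = i') (h15 : s.ireg 15 = b)
    (hratio : ((1 + δ)⁻¹) ^ i' = ((1 + δ)⁻¹) ^ lev x * s.rreg 7) :
    Tri n M (shiftCode arr reg) s fun t s' => t ≤ 60 * DynCover.lowCount G lev x + 8 ∧
      ∃ E, E.length ≤ DynCover.lowCount G lev x ∧ Consts n δ s' ∧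
        Rep n δ s' (lvl G (Function.update lev x i')) (Function.update lev x i')
          (wt δ (lvl G (Function.update lev x i'))) ∧
        Stack s' arr reg (S ++ E) ∧ Stack s' arr' reg' S' ∧
        ∀ u, lvl G (Function.update lev x i') x u ≠ lvl G lev x u → u ∈ E := by
  classical
  have hn : 0 < n := x.pos
  have hle : ∀ v, (lev v + 1) * n ≤ M := fun v => by have := hlevM v; nlinarith
  have hlt : ∀ v, lev v + 1 < M := fun v => by have := hlevM v; nlinarith
  have hcard := H.buckets.card x (lev x)
  rw [card_lvl] at hcard
  have hcard_le := H.buckets.card_le x (lev x)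
  apply Tri.seq
  apply Tri.ops
  simp only [wp, Op.Safe, Op.eff, hc.i3, h8, h9]
  refine ⟨⟨by norm_num, by norm_num, by norm_num, by norm_num, trivial, (Nat.lt_succ_self _).trans
    (hlt x), x.2, by omega⟩, ?_⟩
  rw [hcard]
  have hbx : b < M := by have := hlt x; omega
  have hi'M : (i' + 1) * n ≤ M := by
    have := hlevM x
    rcases hb with hb | hb
    · rw [hb.1]; exact this
    · nlinarith
  apply Tri.seq
  refine (tri_scan (δ := δ) (f₀ := lvl G lev) (lev := lev) (x := x) (i := lev x) (i' := i') (b := b)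
    (c := DynCover.lowCount G lev x) (S := S) (S' := S') hM (hle x) hi'M (by omega)
    (fun v => by have := hlt v; omega) (by omega) hbx ha ha' haa hr hr' hrr
    (DynCover.lowCount G lev x) _ (lvl G lev) [] ?_).mono ?_
  · have nr : ∀ r, r ≠ 12 → Function.update s.ireg 12 (DynCover.lowCount G lev x) r = s.ireg r :=
      fun r h => Function.update_of_ne h _ _
    refine ⟨hc.congr (fun r _ _ => nr r (by omega)) (fun _ _ => rfl), H.congr (fun _ _ _ _ => rfl)
      rfl rfl, lvl_symm G lev, fun v => by simp [lvl], ?_, ?_, ?_, ?_, ?_, hratio,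
      fun _ _ _ _ => rfl, fun _ => Or.inl rfl, ?_, hcard.ge, ?_, ?_, fun u h => absurd rfl h,
      by simp⟩
    · rw [← h8]; exact nr 8 (by norm_num)
    · rw [← h9]; exact nr 9 (by norm_num)
    · rw [← h10]; exact nr 10 (by norm_num)
    · simp
    · rw [← h15]; exact nr 15 (by norm_num)
    · intro u hu _
      rw [← hcard]
      exact (H.buckets.pos x u _ hu).1
    · rw [List.append_nil]
      exact stack.congr (nr reg (by omega)) (fun _ => rfl)
    · exact stack'.congr (nr reg' (by omega)) (fun _ => rfl)
  rintro t s₁ ⟨ht, f, E, I⟩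
  set lev' := Function.update lev x i' with hlev'
  have hfx : ∀ u, f x u = lvl G lev' x u := by
    intro u
    by_cases hadj : G.Adj x u
    · have hux : u ≠ x := hadj.ne'
      have h0 : lvl G lev x u = some (max (lev x) (lev u)) := by simp [lvl, hadj]
      have h1 : lvl G lev' x u = some (max i' (lev u)) := by
        simp [lvl, hadj, hlev', Function.update_of_ne hux]
      rw [h1]
      rcases I.on u with h | ⟨h2, h3, h4⟩
      · rw [h, h0]
        by_cases hq : lev u < b
        · exfalso
          have hm : max (lev x) (lev u) = lev x := by omega
          have := I.todo u (by rw [h, h0, hm]) hq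
          omega
        · congr 1; omega
      · rw [h4]
        rw [h0] at h2
        have : max (lev x) (lev u) = lev x := by simpa using h2
        congr 1; omega
    · have h0 : ∀ l, lvl G l x u = none := fun l => by simp [lvl, hadj]
      rw [h0]
      rcases I.on u with h | ⟨h2, h3, h4⟩
      · rw [h, h0]
      · rw [h0] at h2; cases h2
  have hf : f = lvl G lev' := by
    funext v u
    by_cases hv : v = x
    · rw [hv, hfx]
    · by_cases hu : u = x
      · rw [hu, I.symm, hfx, lvl_symm]
      · rw [I.off v u hv hu]
        simp [lvl, hlev', hv, hu]
  have hrat : ((1 + δ)⁻¹) ^ i' = ((1 + δ)⁻¹) ^ lev x * s₁.rreg 7 := I.ratio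
  refine (tri_setLevel hM I.consts I.rep I.r8 I.r10 hrat).mono ?_
  rintro t' s₂ ⟨rfl, R₂, q1, q2, q3⟩
  refine ⟨by simp; omega, E, by have := I.length; omega,
    I.consts.congr (fun r _ _ => by rw [q1]) (fun r _ => q2 r (by omega)), hf ▸ R₂,
    I.stack.congr (by rw [q1]) (fun p => q3 _ _ _ (by omega)),
    I.stack'.congr (by rw [q1]) (fun p => q3 _ _ _ (by omega)), fun u hu => I.mem u ?_⟩
  rwa [hfx]

/-- Raise the node in register `8` by one level. -/
def raiseCode : Com :=
  .seq (.ops [.ld 9 1 4 8, .add 10 9 5, .add 15 9 5, .rmul 7 3 1]) (shiftCode 6 7)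

/-- Lower the node in register `8` by one level. -/
def dropCode : Com :=
  .seq (.ops [.ld 9 1 4 8, .sub 10 9 5, .add 15 9 4, .rmul 7 2 1]) (shiftCode 5 6)

theorem tri_raise {n M : ℕ} {δ : ℝ} {s : St} {G : SimpleGraph (Fin n)} {lev : Fin n → ℕ}
    {x : Fin n} {U D : List (Fin n)} (hM : n < M) (hlevM : ∀ v, (lev v + 2) * n ≤ M)
    (hD : D.length + n < M) (H : Good δ s G lev U D) (h8 : s.ireg 8 = x) :
    Tri n M raiseCode s fun t s' => t ≤ 60 * DynCover.lowCount G lev x + 12 ∧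
      ∃ E, E.length ≤ DynCover.lowCount G lev x ∧
        Good δ s' G (Function.update lev x (lev x + 1)) U (D ++ E) ∧
        ∀ u, lvl G (Function.update lev x (lev x + 1)) x u ≠ lvl G lev x u → u ∈ E := by
  have hn : 0 < n := x.pos
  have hc := H.consts
  have hlt : lev x + 1 < M := by have := hlevM x; nlinarith
  apply Tri.seq
  apply Tri.ops
  simp only [wp, Op.Safe, Op.eff]
  simp only [Function.update_apply _ _ _ (_ : ℕ), Nat.reduceEqDiff, if_true, if_false, hc.i3, hc.i4,
    hc.i5, h8, H.rep.level, hc.r3, hc.r1, mul_one]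
  refine ⟨⟨by norm_num, by norm_num, by norm_num, by norm_num, trivial, by omega, x.2, by omega⟩,
    ⟨by norm_num, by norm_num, by norm_num, hlt⟩, ⟨by norm_num, by norm_num, by norm_num, hlt⟩,
    trivial, ?_⟩
  generalize hs₁ : St.mk _ _ _ _ _ = s₁
  have hi₁ : ∀ r, r ≠ 9 → r ≠ 10 → r ≠ 15 → s₁.ireg r = s.ireg r := by
    intro r h1 h2 h3
    subst hs₁; simp [h1, h2, h3]
  have hr₁ : ∀ r, r ≠ 7 → s₁.rreg r = s.rreg r := by
    intro r h; subst hs₁; simp [h]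
  have hia : s₁.ia = s.ia := by subst hs₁; rfl
  have hra : s₁.ra = s.ra := by subst hs₁; rfl
  have hcov : s₁.cov = s.cov := by subst hs₁; rfl
  refine (tri_shift (s := s₁) (G := G) (lev := lev) (x := x) (i' := lev x + 1) (b := lev x + 1)
    (arr := 6) (reg := 7) (arr' := 5) (reg' := 6) (S := D) (S' := U) hM hlevM (Or.inl ⟨rfl, rfl⟩)
    hD (by norm_num) (by norm_num) (by norm_num) (by norm_num) (by norm_num) (by norm_num)
    (hc.congr (fun r _ _ => hi₁ r (by omega) (by omega) (by omega)) (fun r _ => hr₁ r (by omega)))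
    (H.rep.congr (fun _ _ _ _ => by rw [hia]) hra hcov)
    (H.stackD.congr (hi₁ _ (by norm_num) (by norm_num) (by norm_num)) (fun _ => by rw [hia]))
    (H.stackU.congr (hi₁ _ (by norm_num) (by norm_num) (by norm_num)) (fun _ => by rw [hia]))
    (by rw [hi₁ 8 (by norm_num) (by norm_num) (by norm_num), h8])
    (by subst hs₁; simp) (by subst hs₁; simp) (by subst hs₁; simp)
    (by subst hs₁; simp [pow_succ])).mono ?_
  rintro t s' ⟨ht, E, hE, c', R', st, st', hu⟩
  exact ⟨by simp; omega, E, hE, ⟨c', R', st', st⟩, hu⟩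

theorem tri_drop {n M : ℕ} {δ : ℝ} (hδ : 0 < δ) {s : St} {G : SimpleGraph (Fin n)}
    {lev : Fin n → ℕ} {x : Fin n} {i : ℕ} {U D : List (Fin n)} (hM : n < M)
    (hlevM : ∀ v, (lev v + 2) * n ≤ M) (hi : lev x = i + 1)
    (hU : U.length + n < M) (H : Good δ s G lev U D) (h8 : s.ireg 8 = x) :
    Tri n M dropCode s fun t s' => t ≤ 60 * DynCover.lowCount G lev x + 12 ∧
      ∃ E, E.length ≤ DynCover.lowCount G lev x ∧
        Good δ s' G (Function.update lev x i) (U ++ E) D ∧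
        ∀ u, lvl G (Function.update lev x i) x u ≠ lvl G lev x u → u ∈ E := by
  have hn : 0 < n := x.pos
  have hc := H.consts
  have hlt : lev x + 1 < M := by have := hlevM x; nlinarith
  apply Tri.seq
  apply Tri.ops
  simp only [wp, Op.Safe, Op.eff]
  simp only [Function.update_apply _ _ _ (_ : ℕ), Nat.reduceEqDiff, if_true, if_false, hc.i3, hc.i4,
    hc.i5, h8, H.rep.level, hc.r2, hc.r1, mul_one]
  refine ⟨⟨by norm_num, by norm_num, by norm_num, by norm_num, trivial, by omega, x.2, by omega⟩,
    ⟨by norm_num, by norm_num, by norm_num, by omega⟩,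
    ⟨by norm_num, by norm_num, by norm_num, by omega⟩, trivial, ?_⟩
  generalize hs₁ : St.mk _ _ _ _ _ = s₁
  have hi₁ : ∀ r, r ≠ 9 → r ≠ 10 → r ≠ 15 → s₁.ireg r = s.ireg r := by
    intro r h1 h2 h3
    subst hs₁; simp [h1, h2, h3]
  have hr₁ : ∀ r, r ≠ 7 → s₁.rreg r = s.rreg r := by
    intro r h; subst hs₁; simp [h]
  have hia : s₁.ia = s.ia := by subst hs₁; rfl
  have hra : s₁.ra = s.ra := by subst hs₁; rfl
  have hcov : s₁.cov = s.cov := by subst hs₁; rfl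
  refine (tri_shift (s := s₁) (G := G) (lev := lev) (x := x) (i' := i) (b := lev x)
    (arr := 5) (reg := 6) (arr' := 6) (reg' := 7) (S := U) (S' := D) hM hlevM (Or.inr ⟨hi, rfl⟩)
    hU (by norm_num) (by norm_num) (by norm_num) (by norm_num) (by norm_num) (by norm_num)
    (hc.congr (fun r _ _ => hi₁ r (by omega) (by omega) (by omega)) (fun r _ => hr₁ r (by omega)))
    (H.rep.congr (fun _ _ _ _ => by rw [hia]) hra hcov)
    (H.stackU.congr (hi₁ _ (by norm_num) (by norm_num) (by norm_num)) (fun _ => by rw [hia]))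
    (H.stackD.congr (hi₁ _ (by norm_num) (by norm_num) (by norm_num)) (fun _ => by rw [hia]))
    (by rw [hi₁ 8 (by norm_num) (by norm_num) (by norm_num), h8])
    (by subst hs₁; simp) (by subst hs₁; simp [hi]) (by subst hs₁; simp)
    (by
      subst hs₁
      have : (1 + δ) ≠ 0 := by positivity
      simp only [hi, pow_succ]
      rw [Function.update_self]
      field_simp)).mono ?_
  rintro t s' ⟨ht, E, hE, c', R', st, st', hu⟩
  exact ⟨by simp; omega, E, hE, ⟨c', R', st, st'⟩, hu⟩

end RAM

/-! ## Restoring the invariants -/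

namespace RAM

open Finset DynCover

/-! ### Node weights under changes of levels -/

section Weights

variable {n : ℕ} {δ : ℝ}

theorem val_lvl (G : SimpleGraph (Fin n)) (lev : Fin n → ℕ) (v u : Fin n)
    [Decidable (G.Adj v u)] :
    val δ (lvl G lev v u) = if G.Adj v u then ((1 + δ)⁻¹) ^ max (lev v) (lev u) else 0 := by
  unfold lvl
  by_cases h : G.Adj v u <;> simp [h, val]

theorem val_nonneg (h0 : 0 < δ) (o : Option ℕ) : 0 ≤ val δ o := by
  cases o <;> simp only [val] <;> positivity

theorem wt_nonneg (h0 : 0 < δ) (f : Fin n → Fin n → Option ℕ) (v : Fin n) : 0 ≤ wt δ f v :=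
  sum_nonneg fun _ _ => val_nonneg h0 _

/-- The exponent ℓ(u) - ℓ(v) in `load` is truncated subtraction, so adding ℓ(v) to it gives the
maximum of the two levels. -/
theorem load_eq (h0 : 0 < δ) (G : SimpleGraph (Fin n)) (lev : Fin n → ℕ) (v : Fin n) :
    load δ G lev v = (1 + δ) ^ lev v * wt δ (lvl G lev) v := by
  classical
  unfold load wt
  rw [mul_sum]
  refine sum_congr rfl fun u _ => ?_
  rw [val_lvl]
  split_ifs
  · have : max (lev v) (lev u) = lev v + (lev u - lev v) := by omega
    rw [this, pow_add, ← mul_assoc, ← mul_pow, mul_inv_cancel₀ (by positivity), one_pow, one_mul]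
  · simp

theorem wt_anti (h0 : 0 < δ) (G : SimpleGraph (Fin n)) {lev lev' : Fin n → ℕ}
    (h : ∀ u, lev u ≤ lev' u) (v : Fin n) : wt δ (lvl G lev') v ≤ wt δ (lvl G lev) v := by
  classical
  unfold wt
  refine sum_le_sum fun u _ => ?_
  rw [val_lvl, val_lvl]
  split_ifs
  · exact pow_le_pow_of_le_one (by positivity) (inv_le_one_of_one_le₀ (by linarith))
      (max_le_max (h v) (h u))
  · exact le_rfl

/-- Every edge level grows by at most one. This is used in both directions: a heavy node does not
become light by a raise, and a drop leaves all weights at most 1 + δ. -/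
theorem wt_le_mul (h0 : 0 < δ) (G : SimpleGraph (Fin n)) {lev lev' : Fin n → ℕ}
    (h : ∀ u, lev' u ≤ lev u + 1) (v : Fin n) :
    wt δ (lvl G lev) v ≤ (1 + δ) * wt δ (lvl G lev') v := by
  classical
  unfold wt
  rw [mul_sum]
  refine sum_le_sum fun u _ => ?_
  rw [val_lvl, val_lvl]
  split_ifs
  · have h1 : max (lev' v) (lev' u) ≤ max (lev v) (lev u) + 1 := by
      have := h v; have := h u; omega
    have h2 : ((1 + δ)⁻¹) ^ (max (lev v) (lev u) + 1) ≤ ((1 + δ)⁻¹) ^ max (lev' v) (lev' u) :=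
      pow_le_pow_of_le_one (by positivity) (inv_le_one_of_one_le₀ (by linarith)) h1
    calc ((1 + δ)⁻¹) ^ max (lev v) (lev u)
        = (1 + δ) * ((1 + δ)⁻¹) ^ (max (lev v) (lev u) + 1) := by
          rw [pow_succ]; field_simp
      _ ≤ _ := mul_le_mul_of_nonneg_left h2 (by positivity)
  · simp

theorem wt_update_eq (G : SimpleGraph (Fin n)) {lev : Fin n → ℕ} {x v : Fin n} {i : ℕ}
    (hv : v ≠ x) (h : lvl G (Function.update lev x i) x v = lvl G lev x v) :
    wt δ (lvl G (Function.update lev x i)) v = wt δ (lvl G lev) v := by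
  unfold wt
  refine sum_congr rfl fun u _ => ?_
  by_cases hu : u = x
  · rw [hu, lvl_symm, h, lvl_symm]
  · simp [lvl, hv, hu]

end Weights

/-- The conditions on the parameters: levels and stack sizes fit into the memory. -/
structure Env (n M : ℕ) (δ K ψ : ℝ) : Prop where
  n_lt : n < M
  const : 64 < M
  pos : 0 < δ
  le : δ ≤ 1 / 64
  K_nonneg : 0 ≤ K
  K_ge : 4 * 1000 ≤ K * δ ^ 2
  level : ∀ l : ℕ, (1 + δ) ^ l ≤ 2 * n → (l + 2) * n ≤ M
  stack : ∀ m : ℕ, 100 * (m : ℝ) ≤ ψ → m + n < M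

/-- The graph `H`, with the offset `o`, accounts for the graph `G`. -/
structure Covers {n : ℕ} (δ : ℝ) (G H : SimpleGraph (Fin n)) (o : Fin n → ℝ) : Prop where
  load : ∀ lev v, load δ G lev v ≤ load δ H lev v + o v
  low : ∀ lev v, lowCount G lev v ≤ lowCount H lev v + 1

/-- The potential including the tasks on the stacks. -/
noncomputable def total {n : ℕ} (K δ : ℝ) (H : SimpleGraph (Fin n)) (lev : Fin n → ℕ)
    (o : Fin n → ℝ) (U D : List (Fin n)) : ℝ :=
  pot K δ H lev o + 100 * (U.length + D.length)

/-- Every node that is too light is on the stack `D`. -/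
def LightOn {n : ℕ} (δ : ℝ) (G : SimpleGraph (Fin n)) (lev : Fin n → ℕ) (D : List (Fin n)) : Prop :=
  ∀ v, wt δ (lvl G lev) v < 1 - 12 * δ → lev v ≠ 0 → v ∈ D

/-- Every node that is too heavy is on the stack `U`. -/
def HeavyOn {n : ℕ} (δ : ℝ) (G : SimpleGraph (Fin n)) (lev : Fin n → ℕ) (U : List (Fin n)) : Prop :=
  ∀ v, 1 < wt δ (lvl G lev) v → v ∈ U

def LevelsLe {n : ℕ} (δ : ℝ) (lev : Fin n → ℕ) : Prop := ∀ v, (1 + δ) ^ lev v ≤ 2 * (n : ℝ)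

/-- Process the nodes on the stack `U`. -/
def drainCode : Com :=
  .repeatUntil (.ile 6 4)
    (.seq (.ops [.sub 13 6 5, .ld 8 5 13 4, .rld 6 1 4 8])
      (.ite (.rle 6 1) (.ops [.sub 6 6 5]) raiseCode))

section

variable {n M : ℕ} {δ K ψ : ℝ} {G H : SimpleGraph (Fin n)} {o : Fin n → ℝ}

/-- The raised node keeps a weight above 1/(1 + δ) > 1 - 12δ. Every other node whose weight has
changed is listed in E. -/
theorem LightOn.raise (h0 : 0 < δ) (h1 : δ ≤ 1 / 64) {lev : Fin n → ℕ} {D E : List (Fin n)}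
    (h : LightOn δ G lev D) {x : Fin n} (hx : 1 < wt δ (lvl G lev) x)
    (hE : ∀ u, lvl G (Function.update lev x (lev x + 1)) x u ≠ lvl G lev x u → u ∈ E) :
    LightOn δ G (Function.update lev x (lev x + 1)) (D ++ E) := by
  intro v hv hv0
  rw [List.mem_append]
  by_cases hvx : v = x
  · subst hvx
    have := wt_le_mul h0 G (lev := lev) (lev' := Function.update lev v (lev v + 1)) (fun u => by
      by_cases hu : u = v
      · subst hu; simp
      · simp [hu]) v
    nlinarith
  · by_cases hvE : v ∈ E
    · exact Or.inr hvE
    · left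
      have he : lvl G (Function.update lev x (lev x + 1)) x v = lvl G lev x v := by
        by_contra hne
        exact hvE (hE v hne)
      rw [wt_update_eq G hvx he] at hv
      rw [Function.update_of_ne hvx] at hv0
      exact h v hv hv0

theorem le_update_succ (lev : Fin n → ℕ) (x u : Fin n) :
    lev u ≤ Function.update lev x (lev x + 1) u := by
  by_cases hu : u = x
  · subst hu; simp
  · simp [hu]

/-- A node stays on U while it is heavy and is popped once its weight is at most 1. Each iteration
lowers the total potential in H by more than its duration and by at least 1, so induction on an
integer bound k gives termination and the time bound together. Raises only decrease weights, so the
hypothesis on the weights in H persists. -/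
theorem tri_drain (env : Env n M δ K ψ) (cov : Covers δ G H o) :
    ∀ (k : ℕ) (s : St) (lev : Fin n → ℕ) (U D : List (Fin n)), Good δ s G lev U D →
      LevelsLe δ lev → HeavyOn δ G lev U → LightOn δ G lev D →
      (∀ v, wt δ (lvl H lev) v ≤ 1 + δ) → total K δ H lev o U D ≤ ψ →
      total K δ H lev o U D ≤ k →
      Tri n M drainCode s fun t s' => ∃ lev' D', Good δ s' G lev' [] D' ∧ LevelsLe δ lev' ∧
        HeavyOn δ G lev' [] ∧ LightOn δ G lev' D' ∧
        t + total K δ H lev' o [] D' ≤ total K δ H lev o U D + 1 := by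
  have h0 := env.pos
  have h1 := env.le
  intro k
  induction k with
  | zero =>
    intro s lev U D good hlev heavy light hH hψ hk
    have hp := pot_nonneg env.K_nonneg h0 h1 H lev o
    unfold total at hk
    have hU : U = [] := by
      rw [← List.length_eq_zero_iff]
      have a1 : (0 : ℝ) ≤ U.length := Nat.cast_nonneg _
      have a2 : (0 : ℝ) ≤ D.length := Nat.cast_nonneg _
      have : (U.length : ℝ) ≤ 0 := by push_cast at hk; linarith
      exact_mod_cast le_antisymm this a1
    subst hU
    refine Tri.done ⟨by norm_num, by norm_num⟩ ?_ ⟨lev, D, good, hlev, heavy, light, ?_⟩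
    · simp [Cond.Holds, good.stackU.size]
    · push_cast; linarith
  | succ k ih =>
    intro s lev U D good hlev heavy light hH hψ hk
    rcases List.eq_nil_or_concat' U with rfl | ⟨L, x, rfl⟩
    · refine Tri.done ⟨by norm_num, by norm_num⟩ ?_ ⟨lev, D, good, hlev, heavy, light, ?_⟩
      · simp [Cond.Holds, good.stackU.size]
      · push_cast; linarith
    have hp := pot_nonneg env.K_nonneg h0 h1 H lev o
    have hn : 0 < n := x.pos
    have hxn := x.2
    have hnM := env.n_lt
    have hc := good.consts
    obtain ⟨top1, top2⟩ := good.stackU.top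
    have hψ' := hψ
    unfold total at hψ'
    simp only [List.length_append, List.length_singleton] at hψ'
    push_cast at hψ'
    -- A node may occur on a stack repeatedly, so the number of nodes does not bound the stacks; the
    -- potential 100 carried by every entry does.
    have hL : L.length + n < M := env.stack _ (by
      have a2 : (0 : ℝ) ≤ D.length := Nat.cast_nonneg _
      linarith)
    have hD : D.length + n < M := env.stack _ (by
      have a2 : (0 : ℝ) ≤ L.length := Nat.cast_nonneg _
      linarith)
    refine Tri.loop ⟨by norm_num, by norm_num⟩ ?_ ?_
    · simp [Cond.Holds, top1, hc.i4]
    apply Tri.seq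
    apply Tri.ops
    simp only [wp, Op.Safe, Op.eff]
    simp only [Function.update_apply _ _ _ (_ : ℕ), Nat.reduceEqDiff, if_true, if_false, hc.i3,
      hc.i4, hc.i5, top1, Nat.add_sub_cancel, top2]
    refine ⟨⟨by norm_num, by norm_num, by norm_num, by omega⟩,
      ⟨by norm_num, by norm_num, by norm_num, by norm_num, trivial, by omega, hn, by omega⟩,
      ⟨by norm_num, by norm_num, by norm_num, trivial, hn, hxn⟩, ?_⟩
    rw [good.rep.sum]
    generalize hs₁ : St.mk _ _ _ _ _ = s₁
    have hi₁ : ∀ r, r ≠ 8 → r ≠ 13 → s₁.ireg r = s.ireg r := by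
      intro r h1 h2
      subst hs₁; simp [h1, h2]
    have hr₁ : ∀ r, r ≠ 6 → s₁.rreg r = s.rreg r := by
      intro r h; subst hs₁; simp [h]
    have h8 : s₁.ireg 8 = x := by subst hs₁; simp
    have h6 : s₁.rreg 6 = wt δ (lvl G lev) x := by subst hs₁; simp
    have hia : s₁.ia = s.ia := by subst hs₁; rfl
    have hra : s₁.ra = s.ra := by subst hs₁; rfl
    have hcov : s₁.cov = s.cov := by subst hs₁; rfl
    have c₁ : Consts n δ s₁ :=
      hc.congr (fun r _ _ => hi₁ r (by omega) (by omega)) (fun r _ => hr₁ r (by omega))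
    have good₁ : Good δ s₁ G lev (L ++ [x]) D := ⟨c₁,
      good.rep.congr (fun _ _ _ _ => by rw [hia]) hra hcov,
      good.stackU.congr (hi₁ _ (by norm_num) (by norm_num)) (fun _ => by rw [hia]),
      good.stackD.congr (hi₁ _ (by norm_num) (by norm_num)) (fun _ => by rw [hia])⟩
    apply Tri.ite (show Cond.Safe (.rle 6 1) from trivial)
    · intro hh
      simp only [Cond.Holds, h6, c₁.r1] at hh
      apply Tri.ops
      simp only [wp, Op.Safe, Op.eff, c₁.i5, good₁.stackU.top.1, Nat.add_sub_cancel]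
      refine ⟨⟨by norm_num, by norm_num, by norm_num, by omega⟩, ?_⟩
      have nr : ∀ r, r ≠ 6 → Function.update s₁.ireg 6 L.length r = s₁.ireg r :=
        fun r h => Function.update_of_ne h _ _
      have etot : total K δ H lev o L D + 100 = total K δ H lev o (L ++ [x]) D := by
        simp only [total, List.length_append, List.length_singleton]
        push_cast; ring
      refine (ih { s₁ with ireg := Function.update s₁.ireg 6 L.length } lev L D
        ⟨c₁.congr (fun r _ _ => nr r (by omega)) (fun _ _ => rfl),
        good₁.rep.congr (fun _ _ _ _ => rfl) rfl rfl,
        good₁.stackU.pop (by simp [good₁.stackU.top.1]) (fun _ => rfl),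
        good₁.stackD.congr (nr 7 (by norm_num)) (fun _ => rfl)⟩ hlev ?_ light hH (by linarith)
        (by push_cast at hk; linarith)).mono ?_
      · intro v hv
        rcases List.mem_append.mp (heavy v hv) with h | h
        · exact h
        · have : v = x := by simpa using h
          subst this
          linarith
      · rintro t s' ⟨lev', D', r1, r2, r3, r4, r5⟩
        refine ⟨lev', D', r1, r2, r3, r4, ?_⟩
        simp only [List.length_cons, List.length_nil]
        push_cast
        linarith
    · intro hh
      simp only [Cond.Holds, h6, c₁.r1, not_le] at hh
      refine (tri_raise hnM (fun v => env.level _ (hlev v)) hD good₁ h8).mono ?_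
      rintro t s₂ ⟨ht, E, hE, good₂, hE'⟩
      set lev₂ := Function.update lev x (lev x + 1) with hlev₂
      have hload : (1 + δ) ^ lev x < load δ G lev x := by
        rw [load_eq h0]
        have : 0 < (1 + δ) ^ lev x := by positivity
        nlinarith
      -- That the node is heavy is known in G and transferred to H by the offset; the upper bound 1
      -- + δ on its weight is known in H only.
      have hraise := pot_raise (c := 1000) (by norm_num) h0 h1 env.K_ge env.K_nonneg H lev o x
        (by have := cov.load lev x; linarith)
        (by
          rw [load_eq h0]
          have := hH x
          have : 0 < (1 + δ) ^ lev x := by positivity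
          nlinarith)
      rw [← hlev₂] at hraise
      have hlow := cov.low lev x
      have hlow' : (lowCount G lev x : ℝ) ≤ lowCount H lev x + 1 := by exact_mod_cast hlow
      have hE'' : (E.length : ℝ) ≤ lowCount G lev x := by exact_mod_cast hE
      have ht' : (t : ℝ) ≤ 60 * lowCount G lev x + 12 := by exact_mod_cast ht
      -- The raise takes at most 60 l + 12 steps and pushes at most l entries worth 100 each, where
      -- l is the low count in G. In H the count may be smaller by one, which the 2 in 1000(l + 2)
      -- makes up for.
      have etot : total K δ H lev₂ o (L ++ [x]) (D ++ E) + t + 100 ≤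
          total K δ H lev o (L ++ [x]) D := by
        simp only [total, List.length_append, List.length_singleton]
        push_cast
        have : (0 : ℝ) ≤ lowCount H lev x := Nat.cast_nonneg _
        linarith
      have ht0 : (0 : ℝ) ≤ t := Nat.cast_nonneg _
      refine (ih s₂ lev₂ (L ++ [x]) (D ++ E) good₂ ?_ ?_ (light.raise h0 h1 hh hE') ?_
        (by linarith) (by push_cast at hk; linarith)).mono ?_
      · intro v
        by_cases hv : v = x
        · subst hv
          rw [hlev₂, Function.update_self, pow_succ]
          -- A node of weight above 1 has load above (1+δ)^ℓ, and the load is at most n. So the next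
          -- power is at most (1+δ)n ≤ 2n, and levels stay bounded without a cap in the algorithm.
          have l1 := (load_le_deg h0 G lev v).trans (deg_le_card G v)
          rw [Fintype.card_fin] at l1
          nlinarith
        · rw [hlev₂, Function.update_of_ne hv]
          exact hlev v
      · intro v hv
        exact heavy v (hv.trans_le (wt_anti h0 G (le_update_succ lev x) v))
      · intro v
        exact (wt_anti h0 H (le_update_succ lev x) v).trans (hH v)
      · rintro t' s' ⟨lev', D', r1, r2, r3, r4, r5⟩
        refine ⟨lev', D', r1, r2, r3, r4, ?_⟩
        simp only [List.length_cons, List.length_nil]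
        push_cast
        linarith

/-- Process the nodes on the stack `D`, and after each step those on the stack `U`. -/
def settleCode : Com :=
  .repeatUntil (.ile 7 4)
    (.seq (.ops [.sub 13 7 5, .ld 8 6 13 4, .rld 6 1 4 8, .ld 9 1 4 8])
      (.seq (.ite (.ile 9 4) (.ops [.sub 7 7 5])
          (.ite (.rle 4 6) (.ops [.sub 7 7 5]) dropCode))
        drainCode))

def restoreCode : Com := .seq drainCode settleCode

theorem covers_self (δ : ℝ) (G : SimpleGraph (Fin n)) : Covers δ G G fun _ => 0 :=
  ⟨fun _ _ => by simp, fun _ _ => Nat.le_succ _⟩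

/-- The invariants that hold between two updates. -/
structure Stable (δ : ℝ) (G : SimpleGraph (Fin n)) (lev : Fin n → ℕ) : Prop where
  levels : LevelsLe δ lev
  heavy : ∀ v, wt δ (lvl G lev) v ≤ 1
  light : ∀ v, lev v ≠ 0 → 1 - 12 * δ ≤ wt δ (lvl G lev) v

/-- No node is heavy when an iteration starts, so after a drop by one level all weights are at most
1 + δ. This is what `tri_drain` requires, with H = G and no offset. The dropped node remains on D
until it is no longer light or reaches level 0. -/
theorem tri_settle (env : Env n M δ K ψ) :
    ∀ (k : ℕ) (s : St) (lev : Fin n → ℕ) (D : List (Fin n)), Good δ s G lev [] D →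
      LevelsLe δ lev → HeavyOn δ G lev [] → LightOn δ G lev D →
      total K δ G lev (fun _ => 0) [] D ≤ ψ → total K δ G lev (fun _ => 0) [] D ≤ k →
      Tri n M settleCode s fun t s' => ∃ lev', Good δ s' G lev' [] [] ∧ Stable δ G lev' ∧
        t + pot K δ G lev' (fun _ => 0) ≤ total K δ G lev (fun _ => 0) [] D + 1 := by
  have h0 := env.pos
  have h1 := env.le
  have fin : ∀ (s : St) (lev : Fin n → ℕ), Good δ s G lev [] [] → LevelsLe δ lev →
      HeavyOn δ G lev [] → LightOn δ G lev [] → ∃ lev', Good δ s G lev' [] [] ∧ Stable δ G lev' ∧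
        ((1 : ℕ) : ℝ) + pot K δ G lev' (fun _ => 0) ≤ total K δ G lev (fun _ => 0) [] [] + 1 := by
    intro s lev good hlev heavy light
    refine ⟨lev, good, ⟨hlev, fun v => ?_, fun v hv => ?_⟩, ?_⟩
    · by_contra hne
      have := heavy v (not_le.mp hne)
      simp at this
    · by_contra hne
      have := light v (not_le.mp hne) hv
      simp at this
    · simp [total]; linarith
  intro k
  induction k with
  | zero =>
    intro s lev D good hlev heavy light hψ hk
    have hp := pot_nonneg env.K_nonneg h0 h1 G lev (fun _ => 0)
    unfold total at hk
    have hD : D = [] := by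
      rw [← List.length_eq_zero_iff]
      have a2 : (0 : ℝ) ≤ D.length := Nat.cast_nonneg _
      have : (D.length : ℝ) ≤ 0 := by
        simp only [List.length_nil] at hk
        push_cast at hk; linarith
      exact_mod_cast le_antisymm this a2
    subst hD
    refine Tri.done ⟨by norm_num, by norm_num⟩ ?_ (fin s lev good hlev heavy light)
    simp [Cond.Holds, good.stackD.size]
  | succ k ih =>
    intro s lev D good hlev heavy light hψ hk
    rcases List.eq_nil_or_concat' D with rfl | ⟨L, x, rfl⟩
    · refine Tri.done ⟨by norm_num, by norm_num⟩ ?_ (fin s lev good hlev heavy light)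
      simp [Cond.Holds, good.stackD.size]
    have hp := pot_nonneg env.K_nonneg h0 h1 G lev (fun _ => 0)
    have hn : 0 < n := x.pos
    have hxn := x.2
    have hnM := env.n_lt
    have hc := good.consts
    obtain ⟨top1, top2⟩ := good.stackD.top
    have hψ' := hψ
    unfold total at hψ'
    simp only [List.length_append, List.length_singleton, List.length_nil] at hψ'
    push_cast at hψ'
    have hL : L.length + n < M := env.stack _ (by linarith)
    have hlx := env.level _ (hlev x)
    have hlxM : lev x < M := by nlinarith
    refine Tri.loop ⟨by norm_num, by norm_num⟩ ?_ ?_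
    · simp [Cond.Holds, top1, hc.i4]
    apply Tri.seq
    apply Tri.ops
    simp only [wp, Op.Safe, Op.eff]
    simp only [Function.update_apply _ _ _ (_ : ℕ), Nat.reduceEqDiff, if_true, if_false, hc.i3,
      hc.i4, hc.i5, top1, Nat.add_sub_cancel, top2]
    refine ⟨⟨by norm_num, by norm_num, by norm_num, by omega⟩,
      ⟨by norm_num, by norm_num, by norm_num, by norm_num, trivial, by omega, hn, by omega⟩,
      ⟨by norm_num, by norm_num, by norm_num, trivial, hn, hxn⟩,
      ⟨by norm_num, by norm_num, by norm_num, by norm_num, trivial, by omega, hxn,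
        by rw [good.rep.level]; exact hlxM⟩, ?_⟩
    rw [good.rep.sum, good.rep.level]
    generalize hs₁ : St.mk _ _ _ _ _ = s₁
    have hi₁ : ∀ r, r ≠ 8 → r ≠ 9 → r ≠ 13 → s₁.ireg r = s.ireg r := by
      intro r h1 h2 h3
      subst hs₁; simp [h1, h2, h3]
    have hr₁ : ∀ r, r ≠ 6 → s₁.rreg r = s.rreg r := by
      intro r h; subst hs₁; simp [h]
    have h8 : s₁.ireg 8 = x := by subst hs₁; simp
    have h9 : s₁.ireg 9 = lev x := by subst hs₁; simp
    have h6 : s₁.rreg 6 = wt δ (lvl G lev) x := by subst hs₁; simp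
    have hia : s₁.ia = s.ia := by subst hs₁; rfl
    have hra : s₁.ra = s.ra := by subst hs₁; rfl
    have hcov : s₁.cov = s.cov := by subst hs₁; rfl
    have c₁ : Consts n δ s₁ := hc.congr
      (fun r _ _ => hi₁ r (by omega) (by omega) (by omega)) (fun r _ => hr₁ r (by omega))
    have good₁ : Good δ s₁ G lev [] (L ++ [x]) := ⟨c₁,
      good.rep.congr (fun _ _ _ _ => by rw [hia]) hra hcov,
      good.stackU.congr (hi₁ _ (by norm_num) (by norm_num) (by norm_num)) (fun _ => by rw [hia]),
      good.stackD.congr (hi₁ _ (by norm_num) (by norm_num) (by norm_num)) (fun _ => by rw [hia])⟩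
    have heavy' : ∀ v, wt δ (lvl G lev) v ≤ 1 := by
      intro v
      by_contra hne
      have := heavy v (not_le.mp hne)
      simp at this
    -- The common end of the three branches: empty U, then continue by induction. The reserve of 20
    -- pays for the tests and jumps of the iteration.
    have drain : ∀ (s₂ : St) (lev₂ : Fin n → ℕ) (U D : List (Fin n)) (t : ℕ),
        Good δ s₂ G lev₂ U D → LevelsLe δ lev₂ → HeavyOn δ G lev₂ U → LightOn δ G lev₂ D →
        (∀ v, wt δ (lvl G lev₂) v ≤ 1 + δ) →
        total K δ G lev₂ (fun _ => 0) U D + t + 20 ≤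
          total K δ G lev (fun _ => 0) [] (L ++ [x]) →
        Tri n M drainCode s₂ fun t' s' => Tri n M settleCode s' fun t'' s'' =>
          ∃ lev', Good δ s'' G lev' [] [] ∧ Stable δ G lev' ∧
          ((([.sub 13 7 5, .ld 8 6 13 4, .rld 6 1 4 8, .ld 9 1 4 8] : List Op).length +
            (t + t') + t'' + 2 : ℕ) : ℝ) + pot K δ G lev' (fun _ => 0) ≤
              total K δ G lev (fun _ => 0) [] (L ++ [x]) + 1 := by
      intro s₂ lev₂ U D t g1 g2 g3 g4 g5 g6
      have ht0 : (0 : ℝ) ≤ t := Nat.cast_nonneg _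
      refine (tri_drain env (covers_self δ G) (k + 1) s₂ lev₂ U D g1 g2 g3 g4 g5 (by linarith)
        (by linarith)).mono ?_
      rintro t' s₃ ⟨lev₃, D₃, r1, r2, r3, r4, r5⟩
      have ht0' : (0 : ℝ) ≤ t' := Nat.cast_nonneg _
      refine (ih s₃ lev₃ D₃ r1 r2 r3 r4 (by linarith) (by push_cast at hk; linarith)).mono ?_
      rintro t'' s₄ ⟨lev₄, q1, q2, q3⟩
      refine ⟨lev₄, q1, q2, ?_⟩
      simp only [List.length_cons, List.length_nil]
      push_cast
      linarith
    have pop : (0 < lev x → 1 - 12 * δ ≤ wt δ (lvl G lev) x) →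
        wp n M [.sub 7 7 5] s₁ fun s₂ => Good δ s₂ G lev [] L ∧ LightOn δ G lev L ∧
          total K δ G lev (fun _ => 0) [] L + 100 ≤
            total K δ G lev (fun _ => 0) [] (L ++ [x]) := by
      intro hx
      simp only [wp, Op.Safe, Op.eff, c₁.i5, good₁.stackD.top.1, Nat.add_sub_cancel]
      have nr : ∀ r, r ≠ 7 → Function.update s₁.ireg 7 L.length r = s₁.ireg r :=
        fun r h => Function.update_of_ne h _ _
      refine ⟨⟨by norm_num, by norm_num, by norm_num, by omega⟩,
        ⟨c₁.congr (fun r _ _ => nr r (by omega)) (fun _ _ => rfl),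
        good₁.rep.congr (fun _ _ _ _ => rfl) rfl rfl,
        good₁.stackU.congr (nr 6 (by norm_num)) (fun _ => rfl),
        good₁.stackD.pop (by simp [good₁.stackD.top.1]) (fun _ => rfl)⟩, ?_, ?_⟩
      · intro v hv hv0
        rcases List.mem_append.mp (light v hv hv0) with h | h
        · exact h
        · have : v = x := by simpa using h
          subst this
          have := hx (Nat.pos_of_ne_zero hv0)
          linarith
      · simp only [total, List.length_append, List.length_singleton]
        push_cast; linarith
    have hle : ∀ v, wt δ (lvl G lev) v ≤ 1 + δ := fun v => by have := heavy' v; linarith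
    apply Tri.seq
    apply Tri.ite (show Cond.Safe (.ile 9 4) from ⟨by norm_num, by norm_num⟩)
    · intro hh
      simp only [Cond.Holds, h9, c₁.i4] at hh
      apply Tri.ops
      obtain ⟨p1, p2, p3, p4⟩ := pop (by omega)
      refine ⟨p1, ?_⟩
      refine drain _ lev [] L _ p2 hlev heavy p3 hle ?_
      simp only [List.length_singleton]
      push_cast; linarith
    · intro hh
      simp only [Cond.Holds, h9, c₁.i4, not_le] at hh
      apply Tri.ite (show Cond.Safe (.rle 4 6) from trivial)
      · intro hh'
        simp only [Cond.Holds, h6, c₁.r4] at hh'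
        apply Tri.ops
        obtain ⟨p1, p2, p3, p4⟩ := pop (fun _ => hh')
        refine ⟨p1, ?_⟩
        refine drain _ lev [] L _ p2 hlev heavy p3 hle ?_
        simp only [List.length_singleton]
        push_cast; linarith
      · intro hh'
        simp only [Cond.Holds, h6, c₁.r4, not_le] at hh'
        obtain ⟨i, hi⟩ : ∃ i, lev x = i + 1 := ⟨lev x - 1, by omega⟩
        refine (tri_drop h0 hnM (fun v => env.level _ (hlev v)) hi (by simpa using hnM) good₁
          h8).mono ?_
        rintro t s₂ ⟨ht, E, hE, good₂, hE'⟩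
        set lev₂ := Function.update lev x i with hlev₂
        have hle₂ : ∀ u, lev₂ u ≤ lev u := by
          intro u
          by_cases hu : u = x
          · subst hu; simp [hlev₂, hi]
          · simp [hlev₂, hu]
        have hle₂' : ∀ u, lev u ≤ lev₂ u + 1 := by
          intro u
          by_cases hu : u = x
          · subst hu; simp [hlev₂, hi]
          · simp [hlev₂, hu]
        have hmul : ∀ v, wt δ (lvl G lev₂) v ≤ (1 + δ) * wt δ (lvl G lev) v :=
          fun v => wt_le_mul h0 G hle₂' v
        have hdrop := pot_drop (c := 1000) (by norm_num) h0 h1 env.K_ge env.K_nonneg G lev x hi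
          (by
            rw [load_eq h0, mul_comm]
            have : 0 < (1 + δ) ^ lev x := by positivity
            exact mul_lt_mul_of_pos_right hh' this)
        rw [← hlev₂] at hdrop
        have hE'' : (E.length : ℝ) ≤ lowCount G lev x := by exact_mod_cast hE
        have ht' : (t : ℝ) ≤ 60 * lowCount G lev x + 12 := by exact_mod_cast ht
        refine drain s₂ lev₂ ([] ++ E) (L ++ [x]) (t + 2 + 2) good₂ ?_ ?_ ?_ ?_ ?_
        · intro v
          exact (pow_le_pow_right₀ (by linarith) (hle₂ v)).trans (hlev v)
        -- The dropped node has weight at most (1 + δ)(1 - 12δ) < 1, so a node that is heavy now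
        -- must be a neighbour whose edge has changed, and these are in E.
        · intro v hv
          rw [List.nil_append]
          by_cases hvx : v = x
          · subst hvx
            have := hmul v
            nlinarith
          · by_contra hvE
            have he : lvl G lev₂ x v = lvl G lev x v := by
              by_contra hne
              exact hvE (hE' v hne)
            rw [wt_update_eq G hvx he] at hv
            exact absurd (heavy' v) (not_le.mpr hv)
        · intro v hv hv0
          by_cases hvx : v = x
          · simp [hvx]
          · refine light v ((wt_anti h0 G hle₂ v).trans_lt hv) ?_
            rwa [hlev₂, Function.update_of_ne hvx] at hv0
        · intro v
          have := hmul v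
          have := heavy' v
          nlinarith
        · simp only [total, List.length_append, List.length_singleton, List.length_nil]
          push_cast
          have : (0 : ℝ) ≤ lowCount G lev x := Nat.cast_nonneg _
          linarith

/-- The potential is kept in H with offset o until U is empty, and only then converted to G at the
price e. From then on G accounts for itself. -/
theorem tri_restore (env : Env n M δ K ψ) (cov : Covers δ G H o) {e : ℝ} (he : 0 ≤ e)
    (hconv : ∀ lev, pot K δ G lev (fun _ => 0) ≤ pot K δ H lev o + e) {s : St} {lev : Fin n → ℕ}
    {U D : List (Fin n)} (good : Good δ s G lev U D) (hlev : LevelsLe δ lev)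
    (heavy : HeavyOn δ G lev U) (light : LightOn δ G lev D)
    (hH : ∀ v, wt δ (lvl H lev) v ≤ 1 + δ) (hψ : total K δ H lev o U D + e + 1 ≤ ψ) :
    Tri n M restoreCode s fun t s' => ∃ lev', Good δ s' G lev' [] [] ∧ Stable δ G lev' ∧
      t + pot K δ G lev' (fun _ => 0) ≤ total K δ H lev o U D + e + 2 := by
  obtain ⟨k, hk⟩ := exists_nat_ge ψ
  apply Tri.seq
  refine (tri_drain env cov k s lev U D good hlev heavy light hH (by linarith)
    (by linarith)).mono ?_
  rintro t s₁ ⟨lev₁, D₁, r1, r2, r3, r4, r5⟩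
  have ht : (0 : ℝ) ≤ t := Nat.cast_nonneg _
  have h := hconv lev₁
  have e1 : total K δ G lev₁ (fun _ => 0) [] D₁ ≤ total K δ H lev₁ o [] D₁ + e := by
    unfold total; linarith
  refine (tri_settle env k s₁ lev₁ D₁ r1 r2 r3 r4 (by linarith) (by linarith)).mono ?_
  rintro t' s₂ ⟨lev₂, q1, q2, q3⟩
  refine ⟨lev₂, q1, q2, ?_⟩
  push_cast
  linarith

end

end RAM

/-! ## The updates -/

namespace DynCover

variable {V : Type*}

theorem edgeAdded_insert {G : SimpleGraph V} {u v : V} (huv : u ≠ v) (h : ¬ G.Adj u v) :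
    EdgeAdded G (G ⊔ SimpleGraph.edge u v) u v := by
  refine ⟨huv, h, by simp [SimpleGraph.edge_adj, huv], fun w x hw => ?_⟩
  simp only [SimpleGraph.sup_adj, SimpleGraph.edge_adj]
  rw [ne_eq, Sym2.eq_iff] at hw
  tauto

theorem edgeAdded_delete {G : SimpleGraph V} {u v : V} (h : G.Adj u v) :
    EdgeAdded (G.deleteEdges {s(u, v)}) G u v := by
  refine ⟨h.ne, by simp, h, fun w x hw => ?_⟩
  simp [SimpleGraph.deleteEdges_adj, hw]

variable [Fintype V]

/-- Together with `EdgeAdded.lowCount_le`, this shows that the old graph with the offset at the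
endpoints covers the new graph. -/
theorem EdgeAdded.load_le {G G' : SimpleGraph V} {u v : V} (h : EdgeAdded G G' u v) {δ : ℝ}
    (h0 : 0 < δ) (ℓ : V → ℕ) (w : V) :
    load δ G' ℓ w ≤ load δ G ℓ w + endOffset u v w := by
  by_cases hu : w = u
  · subst hu
    rw [h.load_left, endOffset, if_pos (Or.inl rfl)]
    linarith [inv_pow_le_one h0 (ℓ v - ℓ w)]
  · by_cases hv : w = v
    · subst hv
      rw [h.symm.load_left, endOffset, if_pos (Or.inr rfl)]
      linarith [inv_pow_le_one h0 (ℓ u - ℓ w)]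
    · rw [(h.other δ ℓ hu hv).1, endOffset, if_neg (by tauto), add_zero]

theorem EdgeAdded.lowCount_le {G G' : SimpleGraph V} {u v : V} (h : EdgeAdded G G' u v)
    (ℓ : V → ℕ) (w : V) : lowCount G' ℓ w ≤ lowCount G ℓ w + 1 := by
  classical
  have key : ∀ {u v : V}, EdgeAdded G G' u v → lowCount G' ℓ u ≤ lowCount G ℓ u + 1 := by
    intro u v h
    unfold lowCount
    rw [← Finset.card_insert_of_notMem (a := v) (by simp [h.not_adj])]
    refine Finset.card_le_card fun x hx => ?_
    rw [Finset.mem_insert]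
    by_cases hxv : x = v
    · exact Or.inl hxv
    · right
      rw [Finset.mem_filter] at hx ⊢
      rwa [← h.iff u x (by simp [hxv, h.ne])]
  by_cases hu : w = u
  · exact hu ▸ key h
  · by_cases hv : w = v
    · exact hv ▸ key h.symm
    · have : ∀ x, G'.Adj w x ↔ G.Adj w x := fun x => h.iff w x (by simp [hu, hv])
      simp [lowCount, this]

end DynCover

namespace RAM

open Finset DynCover

section

variable {n M : ℕ} {δ K ψ : ℝ} {G G' : SimpleGraph (Fin n)} {u v : Fin n}

theorem lvl_insert (h : EdgeAdded G G' u v) (lev : Fin n → ℕ) :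
    setEdge (lvl G lev) u v (some (max (lev u) (lev v))) = lvl G' lev := by
  classical
  funext w x
  by_cases hw : s(w, x) = s(u, v)
  · rw [setEdge, if_pos (by rwa [Sym2.eq_iff] at hw)]
    rcases Sym2.eq_iff.mp hw with ⟨rfl, rfl⟩ | ⟨rfl, rfl⟩
    · simp [lvl, h.adj]
    · simp [lvl, h.adj.symm, max_comm]
  · rw [setEdge, if_neg (by rwa [Sym2.eq_iff] at hw)]
    exact if_congr (h.iff w x hw).symm rfl rfl

theorem lvl_delete (h : EdgeAdded G G' u v) (lev : Fin n → ℕ) :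
    setEdge (lvl G' lev) u v none = lvl G lev := by
  classical
  funext w x
  by_cases hw : s(w, x) = s(u, v)
  · rw [setEdge, if_pos (by rwa [Sym2.eq_iff] at hw)]
    rcases Sym2.eq_iff.mp hw with ⟨rfl, rfl⟩ | ⟨rfl, rfl⟩
    · simp [lvl, h.not_adj]
    · have : ¬ G.Adj w x := fun a => h.not_adj a.symm
      simp [lvl, this]
  · rw [setEdge, if_neg (by rwa [Sym2.eq_iff] at hw)]
    exact if_congr (h.iff w x hw) rfl rfl

theorem wt_insert (h : EdgeAdded G G' u v) (lev : Fin n → ℕ) :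
    wt δ (lvl G' lev) = Function.update (Function.update (wt δ (lvl G lev)) u
      (wt δ (lvl G lev) u + ((1 + δ)⁻¹) ^ max (lev u) (lev v))) v
      (wt δ (lvl G lev) v + ((1 + δ)⁻¹) ^ max (lev u) (lev v)) := by
  rw [← lvl_insert h, wt_setEdge (lvl_symm G lev) h.ne]
  simp [val, lvl, h.not_adj]

theorem wt_delete (h : EdgeAdded G G' u v) (lev : Fin n → ℕ) :
    wt δ (lvl G lev) = Function.update (Function.update (wt δ (lvl G' lev)) u
      (wt δ (lvl G' lev) u + -((1 + δ)⁻¹) ^ max (lev u) (lev v))) v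
      (wt δ (lvl G' lev) v + -((1 + δ)⁻¹) ^ max (lev u) (lev v)) := by
  rw [← lvl_delete h, wt_setEdge (lvl_symm G' lev) h.ne]
  simp [val, lvl, h.adj]

theorem wt_insert_of_ne (h : EdgeAdded G G' u v) (lev : Fin n → ℕ) {w : Fin n} (hu : w ≠ u)
    (hv : w ≠ v) : wt δ (lvl G' lev) w = wt δ (lvl G lev) w := by
  rw [wt_insert h, Function.update_of_ne hv, Function.update_of_ne hu]

theorem wt_le_insert (h0 : 0 < δ) (h : EdgeAdded G G' u v) (lev : Fin n → ℕ) (w : Fin n) :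
    wt δ (lvl G lev) w ≤ wt δ (lvl G' lev) w := by
  have hp : 0 < (1 + δ) ^ max (lev u) (lev v) := by positivity
  rw [wt_insert h]
  by_cases hv : w = v
  · subst hv; simp [hp.le]
  · by_cases hu : w = u
    · subst hu; simp [hp.le, hv]
    · simp [hu, hv]

/-- Put the constants and the endpoints of the edge into registers. -/
def setupCode : Com :=
  .ops [.const 4 0, .const 5 1, .cast 1 5, .const 9 64, .cast 2 9, .rdiv 2 0 2, .const 9 12,
    .cast 4 9, .rmul 4 4 2, .rsub 4 1 4, .radd 2 1 2, .rdiv 3 1 2, .add 8 1 4, .add 11 2 4]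

def pushUCode : Com := .ops [.st 5 6 4 8, .add 6 6 5, .st 5 6 4 11, .add 6 6 5]

def pushDCode : Com := .ops [.st 6 7 4 8, .add 7 7 5, .st 6 7 4 11, .add 7 7 5]

/-- Insert the edge between the registers `8` and `11`. -/
def insertCode : Com :=
  .seq (.ops [.ld 9 1 4 8, .ld 10 1 4 11, .rld 9 2 4 8, .rld 6 2 4 11])
    (.seq (.ite (.ile 9 10) (.ops [.rsub 9 1 6]) (.ops [.add 10 9 4, .rsub 9 1 9]))
      (.seq (.ops (.rmul 5 9 1 :: storeWeight))
        (.seq linkCode (.seq addWeightsCode (.seq pushUCode restoreCode)))))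

/-- Delete the edge between the registers `8` and `11`. -/
def deleteCode : Com :=
  .seq (.ops [.ld 9 1 4 8, .ld 10 1 4 11, .rld 8 0 8 11, .rsub 5 1 1, .rsub 5 5 8])
    (.seq (.ite (.ile 9 10) (.ops [.add 9 10 4]) (.ops []))
      (.seq unlinkCode (.seq addWeightsCode (.seq pushDCode restoreCode))))

/-- Register 5 holds 1, so the test succeeds exactly for the kind 1, an insertion. -/
def updateCode : Com := .seq setupCode (.ite (.ile 5 0) insertCode deleteCode)

theorem tri_pushU (env : Env n M δ K ψ) {s : St} {lev : Fin n → ℕ} (H : Good δ s G lev [] [])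
    (h8 : s.ireg 8 = u) (h11 : s.ireg 11 = v) :
    Tri n M pushUCode s fun t s' => t = 4 ∧ Good δ s' G lev [u, v] [] := by
  have hc := H.consts
  have hM := env.const
  have hn : 0 < n := u.pos
  have h6 : s.ireg 6 = 0 := H.stackU.size
  apply Tri.ops
  simp only [wp, Op.Safe, Op.eff]
  simp only [Function.update_apply _ _ _ (_ : ℕ), Nat.reduceEqDiff, if_true, if_false, hc.i3, hc.i4,
    hc.i5, h8, h11, h6]
  refine ⟨⟨by norm_num, by norm_num, by norm_num, by norm_num, trivial, by omega, hn⟩,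
    ⟨by norm_num, by norm_num, by norm_num, by omega⟩,
    ⟨by norm_num, by norm_num, by norm_num, by norm_num, trivial, by omega, hn⟩,
    ⟨by norm_num, by norm_num, by norm_num, by omega⟩, rfl, ?_, ?_, ?_, ?_⟩
  · exact hc.congr (fun r _ _ => by
      dsimp only
      rw [Function.update_of_ne (by omega), Function.update_of_ne (by omega)]) (fun _ _ => rfl)
  · refine H.rep.congr (fun k x y hk => ?_) rfl rfl
    dsimp only
    rw [Function.update_of_ne (fun h => by simp at h; omega),
      Function.update_of_ne (fun h => by simp at h; omega)]
  · refine ⟨by simp, fun p w hp => ?_⟩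
    match p with
    | 0 => simp at hp; simp [hp]
    | 1 => simp at hp; simp [hp]
    | p + 2 => simp at hp
  · refine H.stackD.congr (by simp) (fun p => ?_)
    dsimp only
    rw [Function.update_of_ne (fun h => by simp at h),
      Function.update_of_ne (fun h => by simp at h)]

theorem tri_pushD (env : Env n M δ K ψ) {s : St} {lev : Fin n → ℕ} (H : Good δ s G lev [] [])
    (h8 : s.ireg 8 = u) (h11 : s.ireg 11 = v) :
    Tri n M pushDCode s fun t s' => t = 4 ∧ Good δ s' G lev [] [u, v] := by
  have hc := H.consts
  have hM := env.const
  have hn : 0 < n := u.pos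
  have h7 : s.ireg 7 = 0 := H.stackD.size
  apply Tri.ops
  simp only [wp, Op.Safe, Op.eff]
  simp only [Function.update_apply _ _ _ (_ : ℕ), Nat.reduceEqDiff, if_true, if_false, hc.i3, hc.i4,
    hc.i5, h8, h11, h7]
  refine ⟨⟨by norm_num, by norm_num, by norm_num, by norm_num, trivial, by omega, hn⟩,
    ⟨by norm_num, by norm_num, by norm_num, by omega⟩,
    ⟨by norm_num, by norm_num, by norm_num, by norm_num, trivial, by omega, hn⟩,
    ⟨by norm_num, by norm_num, by norm_num, by omega⟩, rfl, ?_, ?_, ?_, ?_⟩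
  · exact hc.congr (fun r _ _ => by
      dsimp only
      rw [Function.update_of_ne (by omega), Function.update_of_ne (by omega)]) (fun _ _ => rfl)
  · refine H.rep.congr (fun k x y hk => ?_) rfl rfl
    dsimp only
    rw [Function.update_of_ne (fun h => by simp at h; omega),
      Function.update_of_ne (fun h => by simp at h; omega)]
  · refine H.stackU.congr (by simp) (fun p => ?_)
    dsimp only
    rw [Function.update_of_ne (fun h => by simp at h),
      Function.update_of_ne (fun h => by simp at h)]
  · refine ⟨by simp, fun p w hp => ?_⟩
    match p with
    | 0 => simp at hp; simp [hp]
    | 1 => simp at hp; simp [hp]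
    | p + 2 => simp at hp

theorem Good.frame {s s' : St} {lev : Fin n → ℕ} {U D : List (Fin n)} (H : Good δ s G lev U D)
    (F : Frame s s') (R : Rep n δ s' (lvl G' lev) lev (wt δ (lvl G' lev))) :
    Good δ s' G' lev U D :=
  ⟨F.consts H.consts, R, H.stackU.frame F (by norm_num) (by norm_num),
    H.stackD.frame F (by norm_num) (by norm_num)⟩

/-- The drain is charged to the old graph with offset 1 at u and v: introducing the offset costs 2K,
exchanging it for the edge costs 4K, and the two entries on U cost 200. The weight of the new edge
is recovered from the stored scale of its higher endpoint. -/
theorem tri_insert (env : Env n M δ K ψ) {s : St} {lev : Fin n → ℕ} (H : Good δ s G lev [] [])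
    (S : Stable δ G lev) (h : EdgeAdded G G' u v) (h8 : s.ireg 8 = u) (h11 : s.ireg 11 = v)
    (hψ : pot K δ G lev (fun _ => 0) + 6 * K + 201 ≤ ψ) :
    Tri n M insertCode s fun t s' => ∃ lev', Good δ s' G' lev' [] [] ∧ Stable δ G' lev' ∧
      t + pot K δ G' lev' (fun _ => 0) ≤ pot K δ G lev (fun _ => 0) + 6 * K + 300 := by
  have h0 := env.pos
  have hc := H.consts
  have hM := env.const
  have hn : 0 < n := u.pos
  have huv := h.ne
  have huv' : (u : ℕ) ≠ v := fun e => huv (Fin.ext e)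
  have hlevM : ∀ w, (lev w + 2) * n ≤ M := fun w => env.level _ (S.levels w)
  have hlt : ∀ w, lev w < M := fun w => by have := hlevM w; nlinarith
  set m := max (lev u) (lev v) with hm
  have hmM : (m + 1) * n ≤ M := by
    have h1 := hlevM u
    have h2 := hlevM v
    rcases max_choice (lev u) (lev v) with e | e <;> rw [hm, e] <;> nlinarith
  apply Tri.seq
  apply Tri.ops
  simp only [wp, Op.Safe, Op.eff]
  simp only [Function.update_apply _ _ _ (_ : ℕ), Nat.reduceEqDiff, if_false, hc.i3, hc.i4,
    h8, h11, H.rep.level, H.rep.scale]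
  refine ⟨⟨by norm_num, by norm_num, by norm_num, by norm_num, trivial, by omega, u.2, hlt u⟩,
    ⟨by norm_num, by norm_num, by norm_num, by norm_num, trivial, by omega, v.2, hlt v⟩,
    ⟨by norm_num, by norm_num, by norm_num, trivial, hn, u.2⟩,
    ⟨by norm_num, by norm_num, by norm_num, trivial, hn, v.2⟩, ?_⟩
  generalize hs₁ : St.mk _ _ _ _ _ = s₁
  have hi₁ : ∀ r, r ≠ 9 → r ≠ 10 → s₁.ireg r = s.ireg r := by
    intro r h1 h2; subst hs₁; simp [h1, h2]
  have hr₁ : ∀ r, r ≠ 6 → r ≠ 9 → s₁.rreg r = s.rreg r := by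
    intro r h1 h2; subst hs₁; simp [h1, h2]
  have i9 : s₁.ireg 9 = lev u := by subst hs₁; simp
  have i10 : s₁.ireg 10 = lev v := by subst hs₁; simp
  have r9 : s₁.rreg 9 = 1 - ((1 + δ)⁻¹) ^ lev u := by subst hs₁; simp
  have r6 : s₁.rreg 6 = 1 - ((1 + δ)⁻¹) ^ lev v := by subst hs₁; simp
  have hia₁ : s₁.ia = s.ia := by subst hs₁; rfl
  have hra₁ : s₁.ra = s.ra := by subst hs₁; rfl
  have hcov₁ : s₁.cov = s.cov := by subst hs₁; rfl
  have c₁ : Consts n δ s₁ := hc.congr (fun r _ _ => hi₁ r (by omega) (by omega))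
    (fun r _ => hr₁ r (by omega) (by omega))
  apply Tri.seq
  have rest : ∀ s₂ : St, (∀ r, r ≠ 9 → r ≠ 10 → s₂.ireg r = s.ireg r) →
      (∀ r, r ≠ 6 → r ≠ 9 → s₂.rreg r = s.rreg r) → s₂.ireg 10 = m →
      s₂.rreg 9 = ((1 + δ)⁻¹) ^ m → s₂.ia = s.ia → s₂.ra = s.ra → s₂.cov = s.cov →
      Tri n M (.seq (.ops (.rmul 5 9 1 :: storeWeight))
        (.seq linkCode (.seq addWeightsCode (.seq pushUCode restoreCode)))) s₂ fun t s' =>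
        ∃ lev', Good δ s' G' lev' [] [] ∧ Stable δ G' lev' ∧
          t + pot K δ G' lev' (fun _ => 0) ≤ pot K δ G lev (fun _ => 0) + 6 * K + 280 := by
    intro s₂ hi₂ hr₂ i10 r9 hia₂ hra₂ hcov₂
    have good₂ : Good δ s₂ G lev [] [] := ⟨hc.congr (fun r _ _ => hi₂ r (by omega) (by omega))
      (fun r _ => hr₂ r (by omega) (by omega)),
      H.rep.congr (fun _ _ _ _ => by rw [hia₂]) hra₂ hcov₂,
      H.stackU.congr (hi₂ _ (by norm_num) (by norm_num)) (fun _ => by rw [hia₂]),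
      H.stackD.congr (hi₂ _ (by norm_num) (by norm_num)) (fun _ => by rw [hia₂])⟩
    have c₂ := good₂.consts
    have h8₂ : s₂.ireg 8 = u := by rw [hi₂ 8 (by norm_num) (by norm_num), h8]
    have h11₂ : s₂.ireg 11 = v := by rw [hi₂ 11 (by norm_num) (by norm_num), h11]
    apply Tri.seq
    apply Tri.ops
    simp only [storeWeight, wp, Op.Safe, Op.eff]
    simp only [Function.update_apply _ _ _ (_ : ℕ), Nat.reduceEqDiff, if_false, h8₂, h11₂,
      c₂.i3, r9, c₂.r1, mul_one]
    refine ⟨trivial, ⟨by norm_num, by norm_num, by norm_num, trivial, u.2, v.2⟩,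
      ⟨by norm_num, by norm_num, by norm_num, trivial, v.2, u.2⟩, ?_⟩
    generalize hs₃ : St.mk _ _ _ _ _ = s₃
    have F₃ : Frame s₂ s₃ := by
      subst hs₃
      exact ⟨fun _ _ => rfl, fun r h1 _ _ _ => by simp [h1], fun _ _ _ _ => rfl⟩
    have e5 : s₃.rreg 5 = ((1 + δ)⁻¹) ^ m := by subst hs₃; simp
    have ew : s₃.ra (0, u, v) = ((1 + δ)⁻¹) ^ m ∧ s₃.ra (0, v, u) = ((1 + δ)⁻¹) ^ m := by
      subst hs₃; simp [huv']
    have hn1 : lvl G lev u v = none := by simp [lvl, h.not_adj]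
    have hn2 : lvl G lev v u = none := by rw [lvl_symm, hn1]
    have R₃ : Rep n δ s₃ (lvl G lev) lev (wt δ (lvl G lev)) := by
      subst hs₃
      refine good₂.rep.of_weights rfl rfl (fun k x y hk => by simp [hk]) (fun x y j hxy => ?_)
      have n1 : ¬ (x = u ∧ y = v) := by
        rintro ⟨rfl, rfl⟩
        rw [hn1] at hxy; cases hxy
      have n2 : ¬ (x = v ∧ y = u) := by
        rintro ⟨rfl, rfl⟩
        rw [hn2] at hxy; cases hxy
      simp only [Function.update_apply, Prod.mk.injEq, true_and, Fin.val_inj, n1, n2, if_false]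
    have good₃ := good₂.frame F₃ R₃
    apply Tri.seq
    refine (tri_link env.n_lt good₃.consts R₃ huv (by rw [F₃.ireg 8 (by norm_num), h8₂])
      (by rw [F₃.ireg 11 (by norm_num), h11₂]) (by rw [F₃.ireg 10 (by norm_num), i10]) hmM
      hn1 hn2 ew.1 ew.2).mono ?_
    rintro t s₄ ⟨rfl, R₄, F₄, b1, -⟩
    have F₂₄ := F₃.trans F₄
    apply Tri.seq
    refine (tri_addWeights (F₄.consts good₃.consts) R₄ huv
      (by rw [F₂₄.ireg 8 (by norm_num), h8₂]) (by rw [F₂₄.ireg 11 (by norm_num), h11₂])).mono ?_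
    rintro t s₅ ⟨rfl, R₅, F₅, -⟩
    have F₂₅ := F₂₄.trans F₅
    rw [b1, e5, ← wt_insert h, lvl_insert h] at R₅
    apply Tri.seq
    refine (tri_pushU env (good₂.frame F₂₅ R₅) (by rw [F₂₅.ireg 8 (by norm_num), h8₂])
      (by rw [F₂₅.ireg 11 (by norm_num), h11₂])).mono ?_
    rintro t s₆ ⟨rfl, good₆⟩
    have hoff := pot_offset_le env.K_nonneg h0 env.le G lev huv
    have htot : total K δ G lev (endOffset u v) [u, v] [] =
        pot K δ G lev (endOffset u v) + 200 := by
      simp [total]; norm_num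
    have hK := env.K_nonneg
    refine (tri_restore env ⟨fun lev w => h.load_le h0 lev w, h.lowCount_le⟩
      (e := 4 * K) (by linarith) (fun lev => pot_insert_le hK h0 env.le h lev) good₆ S.levels ?_ ?_
      ?_ ?_).mono ?_
    · intro w hw
      by_contra hne
      simp only [List.mem_cons, List.not_mem_nil, or_false, not_or] at hne
      rw [wt_insert_of_ne h lev hne.1 hne.2] at hw
      exact absurd (S.heavy w) (not_le.mpr hw)
    · intro w hw hw0
      have h1 := S.light w hw0
      have h2 := wt_le_insert h0 h lev w
      linarith
    · intro w
      have := S.heavy w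
      linarith
    · rw [htot]; linarith
    · rintro t s' ⟨lev', g, st, ht⟩
      refine ⟨lev', g, st, ?_⟩
      rw [htot] at ht
      simp only [List.length_cons, List.length_nil]
      push_cast
      linarith
  apply Tri.ite (show Cond.Safe (.ile 9 10) from ⟨by norm_num, by norm_num⟩)
  · intro hh
    simp only [Cond.Holds, i9, i10] at hh
    have hmv : m = lev v := max_eq_right hh
    apply Tri.ops
    simp only [wp, Op.Safe, Op.eff, c₁.r1, r6]
    refine ⟨trivial, (rest { s₁ with
      rreg := Function.update s₁.rreg 9 (1 - (1 - ((1 + δ)⁻¹) ^ lev v)) } hi₁ ?_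
      (by rw [i10, hmv]) (by simp [hmv]) hia₁ hra₁ hcov₁).mono ?_⟩
    · intro r h6 h9
      dsimp only
      rw [Function.update_of_ne h9, hr₁ r h6 h9]
    · rintro t s' ⟨lev', g, st, ht⟩
      refine ⟨lev', g, st, ?_⟩
      simp only [List.length_cons, List.length_nil]
      push_cast
      linarith
  · intro hh
    simp only [Cond.Holds, i9, i10, not_le] at hh
    have hmu : m = lev u := max_eq_left hh.le
    apply Tri.ops
    simp only [wp, Op.Safe, Op.eff, c₁.r1, c₁.i4, r9, i9, add_zero]
    refine ⟨⟨by norm_num, by norm_num, by norm_num, hlt u⟩, trivial,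
      (rest { s₁ with
        ireg := Function.update s₁.ireg 10 (lev u)
        rreg := Function.update s₁.rreg 9 (1 - (1 - ((1 + δ)⁻¹) ^ lev u)) } ?_ ?_
        (by simp [hmu]) (by simp [hmu]) hia₁ hra₁ hcov₁).mono ?_⟩
    · intro r h9 h10
      dsimp only
      rw [Function.update_of_ne h10, hi₁ r h9 h10]
    · intro r h6 h9
      dsimp only
      rw [Function.update_of_ne h9, hr₁ r h6 h9]
    · rintro t s' ⟨lev', g, st, ht⟩
      refine ⟨lev', g, st, ?_⟩
      simp only [List.length_cons, List.length_nil]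
      push_cast
      linarith

/-- Weights only decrease, so no node becomes heavy and only the two endpoints can become light. No
offset is needed, and the price 2K of `pot_delete_le` is well below the 6K allowed. -/
theorem tri_delete (env : Env n M δ K ψ) {s : St} {lev : Fin n → ℕ} (H : Good δ s G' lev [] [])
    (S : Stable δ G' lev) (h : EdgeAdded G G' u v) (h8 : s.ireg 8 = u) (h11 : s.ireg 11 = v)
    (hψ : pot K δ G' lev (fun _ => 0) + 6 * K + 201 ≤ ψ) :
    Tri n M deleteCode s fun t s' => ∃ lev', Good δ s' G lev' [] [] ∧ Stable δ G lev' ∧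
      t + pot K δ G lev' (fun _ => 0) ≤ pot K δ G' lev (fun _ => 0) + 6 * K + 300 := by
  have h0 := env.pos
  have hK := env.K_nonneg
  have hc := H.consts
  have hM := env.const
  have hn : 0 < n := u.pos
  have huv := h.ne
  have hlevM : ∀ w, (lev w + 2) * n ≤ M := fun w => env.level _ (S.levels w)
  have hlt : ∀ w, lev w < M := fun w => by have := hlevM w; nlinarith
  set m := max (lev u) (lev v) with hm
  have hmM : (m + 1) * n ≤ M := by
    have h1 := hlevM u
    have h2 := hlevM v
    rcases max_choice (lev u) (lev v) with e | e <;> rw [hm, e] <;> nlinarith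
  have hm1 : lvl G' lev u v = some m := by simp [lvl, h.adj, hm]
  have hm2 : lvl G' lev v u = some m := by rw [lvl_symm, hm1]
  apply Tri.seq
  apply Tri.ops
  simp only [wp, Op.Safe, Op.eff]
  simp only [Function.update_apply _ _ _ (_ : ℕ), Nat.reduceEqDiff, if_true, if_false, hc.i3, hc.i4,
    h8, h11, H.rep.level, H.rep.weight u v m hm1, hc.r1, sub_self, zero_sub]
  refine ⟨⟨by norm_num, by norm_num, by norm_num, by norm_num, trivial, by omega, u.2, hlt u⟩,
    ⟨by norm_num, by norm_num, by norm_num, by norm_num, trivial, by omega, v.2, hlt v⟩,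
    ⟨by norm_num, by norm_num, by norm_num, trivial, u.2, v.2⟩, trivial, trivial, ?_⟩
  generalize hs₁ : St.mk _ _ _ _ _ = s₁
  have hi₁ : ∀ r, r ≠ 9 → r ≠ 10 → s₁.ireg r = s.ireg r := by
    intro r h1 h2; subst hs₁; simp [h1, h2]
  have hr₁ : ∀ r, r ≠ 5 → r ≠ 8 → s₁.rreg r = s.rreg r := by
    intro r h1 h2; subst hs₁; simp [h1, h2]
  have i9 : s₁.ireg 9 = lev u := by subst hs₁; simp
  have i10 : s₁.ireg 10 = lev v := by subst hs₁; simp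
  have r5 : s₁.rreg 5 = -((1 + δ)⁻¹) ^ m := by subst hs₁; simp
  have hia₁ : s₁.ia = s.ia := by subst hs₁; rfl
  have hra₁ : s₁.ra = s.ra := by subst hs₁; rfl
  have hcov₁ : s₁.cov = s.cov := by subst hs₁; rfl
  have c₁ : Consts n δ s₁ := hc.congr (fun r _ _ => hi₁ r (by omega) (by omega))
    (fun r _ => hr₁ r (by omega) (by omega))
  apply Tri.seq
  have rest : ∀ s₂ : St, (∀ r, r ≠ 9 → r ≠ 10 → s₂.ireg r = s.ireg r) → s₂.rreg = s₁.rreg →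
      s₂.ireg 9 = m → s₂.ia = s.ia → s₂.ra = s.ra → s₂.cov = s.cov →
      Tri n M (.seq unlinkCode (.seq addWeightsCode (.seq pushDCode restoreCode))) s₂ fun t s' =>
        ∃ lev', Good δ s' G lev' [] [] ∧ Stable δ G lev' ∧
          t + pot K δ G lev' (fun _ => 0) ≤ pot K δ G' lev (fun _ => 0) + 6 * K + 280 := by
    intro s₂ hi₂ hr₂ i9 hia₂ hra₂ hcov₂
    have good₂ : Good δ s₂ G' lev [] [] := ⟨hc.congr (fun r _ _ => hi₂ r (by omega) (by omega))
      (fun r _ => by rw [hr₂, hr₁ r (by omega) (by omega)]),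
      H.rep.congr (fun _ _ _ _ => by rw [hia₂]) hra₂ hcov₂,
      H.stackU.congr (hi₂ _ (by norm_num) (by norm_num)) (fun _ => by rw [hia₂]),
      H.stackD.congr (hi₂ _ (by norm_num) (by norm_num)) (fun _ => by rw [hia₂])⟩
    have h8₂ : s₂.ireg 8 = u := by rw [hi₂ 8 (by norm_num) (by norm_num), h8]
    have h11₂ : s₂.ireg 11 = v := by rw [hi₂ 11 (by norm_num) (by norm_num), h11]
    apply Tri.seq
    refine (tri_unlink env.n_lt good₂.consts good₂.rep huv h8₂ h11₂ i9 hmM hm1 hm2).mono ?_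
    rintro t s₃ ⟨rfl, R₃, F₃, b1, -, -⟩
    apply Tri.seq
    refine (tri_addWeights (F₃.consts good₂.consts) R₃ huv
      (by rw [F₃.ireg 8 (by norm_num), h8₂]) (by rw [F₃.ireg 11 (by norm_num), h11₂])).mono ?_
    rintro t s₄ ⟨rfl, R₄, F₄, -⟩
    have F₂₄ := F₃.trans F₄
    rw [b1, hr₂, r5, ← wt_delete h, lvl_delete h] at R₄
    apply Tri.seq
    refine (tri_pushD env (good₂.frame F₂₄ R₄) (by rw [F₂₄.ireg 8 (by norm_num), h8₂])
      (by rw [F₂₄.ireg 11 (by norm_num), h11₂])).mono ?_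
    rintro t s₅ ⟨rfl, good₅⟩
    have hdel := pot_delete_le hK h0 env.le h lev
    have htot : total K δ G lev (fun _ => 0) [] [u, v] =
        pot K δ G lev (fun _ => 0) + 200 := by
      simp [total]; norm_num
    refine (tri_restore env (covers_self δ G) (e := 0) le_rfl (fun lev => by linarith) good₅
      S.levels ?_ ?_ ?_ ?_).mono ?_
    · intro w hw
      have h1 := S.heavy w
      have h2 := wt_le_insert h0 h lev w
      linarith
    · intro w hw hw0
      by_contra hne
      simp only [List.mem_cons, List.not_mem_nil, or_false, not_or] at hne
      rw [← wt_insert_of_ne h lev hne.1 hne.2] at hw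
      exact absurd (S.light w hw0) (not_le.mpr hw)
    · intro w
      have h1 := S.heavy w
      have h2 := wt_le_insert h0 h lev w
      linarith
    · rw [htot]; linarith
    · rintro t s' ⟨lev', g, st, ht⟩
      refine ⟨lev', g, st, ?_⟩
      rw [htot] at ht
      push_cast
      linarith
  apply Tri.ite (show Cond.Safe (.ile 9 10) from ⟨by norm_num, by norm_num⟩)
  · intro hh
    simp only [Cond.Holds, i9, i10] at hh
    have hmv : m = lev v := max_eq_right hh
    apply Tri.ops
    simp only [wp, Op.Safe, Op.eff, c₁.i4, i10, add_zero]
    refine ⟨⟨by norm_num, by norm_num, by norm_num, hlt v⟩,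
      (rest { s₁ with ireg := Function.update s₁.ireg 9 (lev v) } ?_ rfl (by simp [hmv])
        hia₁ hra₁ hcov₁).mono ?_⟩
    · intro r h9 h10
      dsimp only
      rw [Function.update_of_ne h9, hi₁ r h9 h10]
    · rintro t s' ⟨lev', g, st, ht⟩
      refine ⟨lev', g, st, ?_⟩
      simp only [List.length_cons, List.length_nil]
      push_cast
      linarith
  · intro hh
    simp only [Cond.Holds, i9, i10, not_le] at hh
    have hmu : m = lev u := max_eq_left hh.le
    apply Tri.ops
    refine (rest _ hi₁ rfl (by rw [i9, hmu]) hia₁ hra₁ hcov₁).mono ?_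
    rintro t s' ⟨lev', g, st, ht⟩
    refine ⟨lev', g, st, ?_⟩
    simp only [List.length_cons, List.length_nil]
    push_cast
    linarith

/-- The state between two updates. -/
structure Idle {n : ℕ} (δ : ℝ) (s : St) (G : SimpleGraph (Fin n)) (lev : Fin n → ℕ) : Prop where
  i3 : s.ireg 3 = n
  i6 : s.ireg 6 = 0
  i7 : s.ireg 7 = 0
  r0 : s.rreg 0 = 64 * δ
  rep : Rep n δ s (lvl G lev) lev (wt δ (lvl G lev))

theorem Good.idle {s : St} {lev : Fin n → ℕ} (H : Good δ s G lev [] []) : Idle δ s G lev :=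
  ⟨H.consts.i3, H.stackU.size, H.stackD.size, H.consts.r0, H.rep⟩

/-- There is no separate initialization, so the constants are derived anew from ε = 64δ in every
update, in constant time. -/
theorem tri_setup (env : Env n M δ K ψ) {s : St} {lev : Fin n → ℕ} (H : Idle δ s G lev)
    (h1 : s.ireg 1 = u) (h2 : s.ireg 2 = v) :
    Tri n M setupCode s fun t s' => t = 14 ∧ Good δ s' G lev [] [] ∧ s'.ireg 8 = u ∧
      s'.ireg 11 = v ∧ s'.ireg 0 = s.ireg 0 := by
  have h0 := env.pos
  have hM := env.const
  have hnM := env.n_lt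
  have hu := u.2
  have hv := v.2
  apply Tri.ops
  simp only [wp, Op.Safe, Op.eff]
  simp only [Function.update_apply _ _ _ (_ : ℕ), Nat.reduceEqDiff, if_true, if_false, h1, h2,
    H.r0, add_zero]
  push_cast
  have e : 64 * δ / 64 = δ := by ring
  rw [e]
  refine ⟨⟨by norm_num, by omega⟩, ⟨by norm_num, by omega⟩, by norm_num, ⟨by norm_num, hM⟩,
    by norm_num, by norm_num, ⟨by norm_num, by omega⟩, by norm_num, trivial, trivial, trivial,
    by positivity, ⟨by norm_num, by norm_num, by norm_num, by omega⟩,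
    ⟨by norm_num, by norm_num, by norm_num, by omega⟩, rfl, ⟨?_, ?_, ?_, ?_⟩, ?_, ?_, ?_⟩
  · constructor <;> simp [H.i3, H.r0]
  · exact H.rep.congr (fun _ _ _ _ => rfl) rfl rfl
  · exact ⟨by simp [H.i6], by simp⟩
  · exact ⟨by simp [H.i7], by simp⟩
  all_goals simp

theorem tri_update_insert (env : Env n M δ K ψ) {s : St} {lev : Fin n → ℕ} (H : Idle δ s G lev)
    (S : Stable δ G lev) (h : EdgeAdded G G' u v) (hk : s.ireg 0 = 1) (h1 : s.ireg 1 = u)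
    (h2 : s.ireg 2 = v) (hψ : pot K δ G lev (fun _ => 0) + 6 * K + 201 ≤ ψ) :
    Tri n M updateCode s fun t s' => ∃ lev', Idle δ s' G' lev' ∧ Stable δ G' lev' ∧
      t + pot K δ G' lev' (fun _ => 0) ≤ pot K δ G lev (fun _ => 0) + 6 * K + 320 := by
  apply Tri.seq
  refine (tri_setup env H h1 h2).mono ?_
  rintro t s₁ ⟨rfl, good, h8, h11, e0⟩
  apply Tri.ite (show Cond.Safe (.ile 5 0) from ⟨by norm_num, by norm_num⟩)
  · intro _
    refine (tri_insert env good S h h8 h11 hψ).mono ?_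
    rintro t s' ⟨lev', g, st, ht⟩
    refine ⟨lev', g.idle, st, ?_⟩
    push_cast
    linarith
  · intro hh
    simp [Cond.Holds, good.consts.i5, e0, hk] at hh

theorem tri_update_delete (env : Env n M δ K ψ) {s : St} {lev : Fin n → ℕ} (H : Idle δ s G' lev)
    (S : Stable δ G' lev) (h : EdgeAdded G G' u v) (hk : s.ireg 0 = 0) (h1 : s.ireg 1 = u)
    (h2 : s.ireg 2 = v) (hψ : pot K δ G' lev (fun _ => 0) + 6 * K + 201 ≤ ψ) :
    Tri n M updateCode s fun t s' => ∃ lev', Idle δ s' G lev' ∧ Stable δ G lev' ∧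
      t + pot K δ G lev' (fun _ => 0) ≤ pot K δ G' lev (fun _ => 0) + 6 * K + 320 := by
  apply Tri.seq
  refine (tri_setup env H h1 h2).mono ?_
  rintro t s₁ ⟨rfl, good, h8, h11, e0⟩
  apply Tri.ite (show Cond.Safe (.ile 5 0) from ⟨by norm_num, by norm_num⟩)
  · intro hh
    simp [Cond.Holds, good.consts.i5, e0, hk] at hh
  · intro _
    refine (tri_delete env good S h h8 h11 hψ).mono ?_
    rintro t s' ⟨lev', g, st, ht⟩
    refine ⟨lev', g.idle, st, ?_⟩
    push_cast
    linarith

end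

end RAM

/-! ## The approximation ratio -/

open Classical in
/-- Counting the weight of each edge at both of its endpoints. -/
theorem sum_adj_eq_two_mul_fracSize {V : Type*} [Fintype V] (G : SimpleGraph V) (x : Sym2 V → ℝ) :
    ∑ v, ∑ u, (if G.Adj v u then x s(v, u) else 0) = 2 * fracSize G x := by
  rw [← Fintype.sum_prod_type' (f := fun v u => if G.Adj v u then x s(v, u) else 0), fracSize,
    Finset.sum_filter, Finset.mul_sum,
    ← Finset.sum_fiberwise Finset.univ fun p : V × V => s(p.1, p.2)]
  refine Finset.sum_congr rfl fun e _ => ?_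
  induction e with
  | h a b =>
    by_cases hab : G.Adj a b
    · have : (Finset.univ.filter fun p : V × V => s(p.1, p.2) = s(a, b)) = {(a, b), (b, a)} := by
        ext p
        simp only [Finset.mem_filter, Finset.mem_univ, true_and, Finset.mem_insert,
          Finset.mem_singleton, Sym2.eq_iff, Prod.ext_iff]
      rw [this, Finset.sum_pair (by simp [Prod.ext_iff, hab.ne]),
        if_pos hab, if_pos hab.symm, if_pos (show s(a, b) ∈ G.edgeSet from hab),
        Sym2.eq_swap (a := b)]
      ring
    · rw [if_neg (by simpa using hab), mul_zero]
      refine Finset.sum_eq_zero fun p hp => ?_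
      rw [Finset.mem_filter] at hp
      rw [if_neg]
      intro h
      have : s(p.1, p.2) ∈ G.edgeSet := h
      rw [hp.2] at this
      exact hab this

-- Weak duality: every edge has an endpoint in T, and each node of T receives at most 1. The factor
-- 2 arises because each edge is counted from both of its ends.
open Classical in
theorem IsFractionalMatching.sum_adj_le {V : Type*} [Fintype V] {G : SimpleGraph V}
    {x : Sym2 V → ℝ} (hx : IsFractionalMatching G x) {T : Finset V}
    (hT : G.IsVertexCover (T : Set V)) :
    ∑ v, ∑ u, (if G.Adj v u then x s(v, u) else 0) ≤ 2 * T.card := by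
  have key : ∑ v, (if v ∈ T then ∑ u, (if G.Adj v u then x s(v, u) else 0) else 0) ≤
      (T.card : ℝ) := by
    rw [← Finset.sum_filter, Finset.filter_mem_eq_inter, Finset.univ_inter,
      Finset.card_eq_sum_ones, Nat.cast_sum]
    refine Finset.sum_le_sum fun v _ => ?_
    rw [← Finset.sum_filter, Nat.cast_one]
    exact hx.2 v
  have key' : ∑ v, ∑ u, (if u ∈ T then (if G.Adj v u then x s(v, u) else 0) else 0) ≤
      (T.card : ℝ) := by
    rw [Finset.sum_comm]
    refine le_trans (le_of_eq (Finset.sum_congr rfl fun u _ => ?_)) key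
    split_ifs
    · refine Finset.sum_congr rfl fun v _ => ?_
      rw [Sym2.eq_swap]
      exact if_congr (G.adj_comm v u) rfl rfl
    · simp
  have split : ∀ v u, (if G.Adj v u then x s(v, u) else 0) ≤
      (if v ∈ T then (if G.Adj v u then x s(v, u) else 0) else 0) +
        (if u ∈ T then (if G.Adj v u then x s(v, u) else 0) else 0) := by
    intro v u
    by_cases h : G.Adj v u
    · have h0 := (hx.1 s(v, u) h).1
      have := hT h
      simp only [Finset.mem_coe] at this
      rcases this with h1 | h1 <;> simp only [h, h1, if_true] <;> split_ifs <;> linarith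
    · simp [h]
  calc ∑ v, ∑ u, (if G.Adj v u then x s(v, u) else 0)
      ≤ ∑ v, ∑ u, ((if v ∈ T then (if G.Adj v u then x s(v, u) else 0) else 0) +
        (if u ∈ T then (if G.Adj v u then x s(v, u) else 0) else 0)) :=
        Finset.sum_le_sum fun v _ => Finset.sum_le_sum fun u _ => split v u
    _ = ∑ v, (if v ∈ T then ∑ u, (if G.Adj v u then x s(v, u) else 0) else 0) +
        ∑ v, ∑ u, (if u ∈ T then (if G.Adj v u then x s(v, u) else 0) else 0) := by
        simp only [Finset.sum_add_distrib]
        congr 1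
        refine Finset.sum_congr rfl fun v _ => ?_
        split_ifs <;> simp
    _ ≤ _ := by linarith

namespace RAM

open Finset DynCover

/-- The weights of the edges on the levels that belong to node levels. -/
noncomputable def edgeWeight {n : ℕ} (δ : ℝ) (lev : Fin n → ℕ) : Sym2 (Fin n) → ℝ :=
  Sym2.lift ⟨fun u v => ((1 + δ)⁻¹) ^ max (lev u) (lev v), fun u v => by simp only [max_comm]⟩

/-- The nodes that are nearly saturated. -/
noncomputable def saturated {n : ℕ} (δ : ℝ) (G : SimpleGraph (Fin n)) (lev : Fin n → ℕ) :
    Finset (Fin n) :=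
  univ.filter fun v => 1 - 12 * δ ≤ wt δ (lvl G lev) v

section

variable {n : ℕ} {δ α : ℝ} {G : SimpleGraph (Fin n)} {lev : Fin n → ℕ}

open Classical in
theorem wt_lvl_eq (δ : ℝ) (G : SimpleGraph (Fin n)) (lev : Fin n → ℕ) (v : Fin n) :
    wt δ (lvl G lev) v = ∑ u, if G.Adj v u then edgeWeight δ lev s(v, u) else 0 := by
  unfold wt
  exact sum_congr rfl fun u _ => val_lvl G lev v u

theorem Stable.isFractionalMatching (h0 : 0 < δ) (S : Stable δ G lev) :
    IsFractionalMatching G (edgeWeight δ lev) := by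
  classical
  refine ⟨fun e _ => ?_, fun v => ?_⟩
  · induction e with
    | h a b => exact ⟨by simp only [edgeWeight, Sym2.lift_mk]; positivity, inv_pow_le_one h0 _⟩
  · rw [sum_filter]
    refine le_trans (le_of_eq ?_) (S.heavy v)
    rw [wt_lvl_eq]

/-- If neither endpoint is saturated, both are on level 0, so the edge has weight 1. This exceeds 1
- 12δ and contradicts the small weight of its endpoints. -/
theorem Stable.isVertexCover (h0 : 0 < δ) (S : Stable δ G lev) :
    G.IsVertexCover (saturated δ G lev : Set (Fin n)) := by
  classical
  intro u v h
  by_contra hne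
  simp only [saturated, coe_filter, mem_univ, true_and, Set.mem_ofPred_eq, not_or, not_le] at hne
  have hu : lev u = 0 := by
    by_contra hu
    linarith [S.light u hu]
  have hv : lev v = 0 := by
    by_contra hv
    linarith [S.light v hv]
  have h1 : val δ (lvl G lev u v) ≤ wt δ (lvl G lev) u :=
    single_le_sum (f := fun w => val δ (lvl G lev u w)) (fun w _ => val_nonneg h0 _) (mem_univ v)
  rw [val_lvl, if_pos h, hu, hv] at h1
  simp at h1
  linarith

theorem saturated_card_le (h0 : 0 < δ) (G : SimpleGraph (Fin n)) (lev : Fin n → ℕ) :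
    (1 - 12 * δ) * (saturated δ G lev).card ≤ ∑ v, wt δ (lvl G lev) v := by
  calc (1 - 12 * δ) * (saturated δ G lev).card = ∑ _v ∈ saturated δ G lev, (1 - 12 * δ) := by
        rw [sum_const, nsmul_eq_mul, mul_comm]
    _ ≤ ∑ v ∈ saturated δ G lev, wt δ (lvl G lev) v :=
        sum_le_sum fun v hv => (mem_filter.mp hv).2
    _ ≤ _ := sum_le_sum_of_subset_of_nonneg (subset_univ _) fun v _ _ => wt_nonneg h0 _ v

/-- The saturated nodes carry at least 1 - 12δ each, and by weak duality all nodes together carry at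
most twice the size of any cover T. -/
theorem Stable.approx_cover (h0 : 0 < δ) (S : Stable δ G lev) (hδ : 0 < 1 - 12 * δ)
    (hα : 2 ≤ α * (1 - 12 * δ)) : IsApproxMinVertexCover α G (saturated δ G lev) := by
  classical
  refine ⟨S.isVertexCover h0, fun T hT => ?_⟩
  have h1 := saturated_card_le h0 G lev
  have h2 := (S.isFractionalMatching h0).sum_adj_le hT
  simp only [wt_lvl_eq] at h1
  have h3 : (0 : ℝ) ≤ T.card := Nat.cast_nonneg _
  refine le_of_mul_le_mul_left ?_ hδ
  calc _ ≤ 2 * (T.card : ℝ) := h1.trans h2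
    _ ≤ α * (1 - 12 * δ) * T.card := mul_le_mul_of_nonneg_right hα h3
    _ = _ := by ring

/-- The saturated nodes serve as a dual certificate: they bound the size of y from above, and their
number is bounded by the total weight, which is twice the size of x. -/
theorem Stable.approx_matching (h0 : 0 < δ) (S : Stable δ G lev) (hδ : 0 < 1 - 12 * δ)
    (hα : 2 ≤ α * (1 - 12 * δ)) :
    IsApproxMaxFractionalMatching α G (edgeWeight δ lev) := by
  classical
  refine ⟨S.isFractionalMatching h0, fun y hy => ?_⟩
  have h1 := saturated_card_le h0 G lev
  have h2 := hy.sum_adj_le (S.isVertexCover h0)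
  simp only [wt_lvl_eq] at h1
  rw [sum_adj_eq_two_mul_fracSize] at h1 h2
  have h3 : (0 : ℝ) ≤ (saturated δ G lev).card := Nat.cast_nonneg _
  have h4 : 0 ≤ fracSize G (edgeWeight δ lev) := by
    have := mul_nonneg hδ.le h3
    linarith
  nlinarith

end

end RAM

/-! ## Runs of the machine -/

namespace RAM

open Finset DynCover

/-- The program that handles an update. -/
def program : Program := updateCode.compile 0

theorem Tri.runs {n M B : ℕ} (hB : Fits n M B) {s : St} {Q : ℕ → St → Prop}
    (h : Tri n M updateCode s Q) {c : Config} (hc : Sim n M s c) (hpc : c.pc = 0) :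
    ∃ t' d t s', Runs B program c t' d ∧ t' ≤ 8 * t ∧ Sim n M s' d ∧ Q t s' := by
  obtain ⟨t, s', hbig, hQ⟩ := h
  have hP : CodeAt program c.pc (updateCode.compile c.pc) := by
    rw [hpc]
    intro j i hj
    rwa [zero_add]
  obtain ⟨t', d, h1, h2, h3, h4⟩ := hbig.steps hB hP hc
  refine ⟨t', d, t, s', h1.runs ?_, h2, h3, hQ⟩
  rw [h4, hpc, List.getElem?_eq_none_iff, program, Com.length_compile, zero_add]

/-- Hand an update to the machine. -/
def St.feed {n : ℕ} (s : St) : EdgeUpdate (Fin n) → St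
  | .insert u v => { s with
      ireg := Function.update (Function.update (Function.update s.ireg 0 1) 1 u) 2 v }
  | .delete u v => { s with
      ireg := Function.update (Function.update (Function.update s.ireg 0 0) 1 u) 2 v }

theorem Sim.feed {n M : ℕ} {s : St} {c : Config} (h : Sim n M s c) (a : EdgeUpdate (Fin n)) :
    Sim n M (s.feed a) (feed c a) := by
  cases a <;>
  · refine ⟨fun r hr => ?_, h.rreg, h.imem, h.rmem, h.cov⟩
    simp only [St.feed, RAM.feed, Function.update_apply, h.ireg r hr]

theorem feed_pc {n : ℕ} (c : Config) (a : EdgeUpdate (Fin n)) : (feed c a).pc = 0 := by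
  cases a <;> rfl

/-! ### Amortization over a sequence of updates, and the word length -/

section

variable {n M B : ℕ} {δ K ψ : ℝ}

theorem Idle.feed {s : St} {G : SimpleGraph (Fin n)} {lev : Fin n → ℕ} (H : Idle δ s G lev)
    (a : EdgeUpdate (Fin n)) : Idle δ (s.feed a) G lev := by
  cases a <;> exact ⟨by simp [St.feed, H.i3], by simp [St.feed, H.i6], by simp [St.feed, H.i7],
    H.r0, H.rep.congr (fun _ _ _ _ => rfl) rfl rfl⟩

theorem tri_update (env : Env n M δ K ψ) {s : St} {G : SimpleGraph (Fin n)} {lev : Fin n → ℕ}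
    (H : Idle δ s G lev) (S : Stable δ G lev) {a : EdgeUpdate (Fin n)} (ha : a.Legal G)
    (hψ : pot K δ G lev (fun _ => 0) + 6 * K + 201 ≤ ψ) :
    Tri n M updateCode (s.feed a) fun t s' => ∃ lev', Idle δ s' (a.apply G) lev' ∧
      Stable δ (a.apply G) lev' ∧ t + pot K δ (a.apply G) lev' (fun _ => 0) ≤
        pot K δ G lev (fun _ => 0) + 6 * K + 320 := by
  cases a with
  | insert u v =>
    exact tri_update_insert env (H.feed _) S (edgeAdded_insert ha.1 ha.2) (by simp [St.feed])
      (by simp [St.feed]) (by simp [St.feed]) hψ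
  | delete u v =>
    exact tri_update_delete env (H.feed _) S (edgeAdded_delete ha) (by simp [St.feed])
      (by simp [St.feed]) (by simp [St.feed]) hψ

/-- The potential telescopes, and the factor 8 accounts for compilation. The bound on the memory is
renewed at each update, since every stable state has small potential however many updates came
before. -/
theorem handles (env : Env n M δ K ψ) (hB : Fits n M B)
    (hψ : ∀ (G : SimpleGraph (Fin n)) lev, Stable δ G lev →
      pot K δ G lev (fun _ => 0) + 6 * K + 201 ≤ ψ)
    (us : List (EdgeUpdate (Fin n))) {s : St} {c : Config} {G : SimpleGraph (Fin n)}
    {lev : Fin n → ℕ} (H : Idle δ s G lev) (S : Stable δ G lev) (hc : Sim n M s c)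
    (hus : EdgeUpdate.LegalSeq G us) :
    ∃ t d s' lev', Handles B program c us t d ∧ Idle δ s' (EdgeUpdate.applySeq G us) lev' ∧
      Stable δ (EdgeUpdate.applySeq G us) lev' ∧ Sim n M s' d ∧
      (t : ℝ) + 8 * pot K δ (EdgeUpdate.applySeq G us) lev' (fun _ => 0) ≤
        8 * pot K δ G lev (fun _ => 0) + us.length * (8 * (6 * K + 320)) := by
  induction us generalizing s c G lev with
  | nil => exact ⟨0, c, s, lev, ⟨rfl, rfl⟩, H, S, hc, by simp [EdgeUpdate.applySeq]⟩
  | cons a as ih =>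
    obtain ⟨t', d, t, s', h1, h2, h3, lev', h4, h5, h6⟩ :=
      (tri_update env H S hus.1 (hψ G lev S)).runs hB (hc.feed a) (feed_pc c a)
    obtain ⟨t₂, d₂, s₂, lev₂, k1, k2, k3, k4, k5⟩ := ih h4 h5 h3 hus.2
    refine ⟨t' + t₂, d₂, s₂, lev₂, ⟨t', t₂, d, h1, k1, rfl⟩, k2, k3, k4, ?_⟩
    have h2' : (t' : ℝ) ≤ 8 * t := by exact_mod_cast h2
    rw [EdgeUpdate.applySeq, List.length_cons]
    push_cast
    linarith

theorem Idle.nodes_eq {s : St} {c : Config} {G : SimpleGraph (Fin n)} {lev : Fin n → ℕ}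
    (H : Idle δ s G lev) (hc : Sim n M s c) : c.nodes n = saturated δ G lev := by
  unfold Config.nodes saturated
  refine filter_congr fun v _ => ?_
  rw [hc.cov v v.2]
  by_cases h : 1 - 12 * δ ≤ wt δ (lvl G lev) v
  · simp [h, H.rep.cov_pos v h]
  · simp [h, H.rep.cov_neg v h]

theorem Idle.holdsWeights {s : St} {c : Config} {G : SimpleGraph (Fin n)} {lev : Fin n → ℕ}
    (H : Idle δ s G lev) (hc : Sim n M s c) : c.HoldsWeights G (edgeWeight δ lev) := by
  intro u v h
  have := hc.rmem 0 (by norm_num) u u.2 v v.2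
  rw [zero_mul, zero_add] at this
  rw [this, H.rep.weight u v (max (lev u) (lev v)) (by simp [lvl, h])]
  rfl

/-- The initial state. -/
noncomputable def St.init (n : ℕ) (ε : ℝ) : St where
  ireg := Function.update (fun _ => 0) 3 n
  rreg := Function.update (fun _ => 0) 0 ε
  ia := fun _ => 0
  ra := fun _ => 0
  cov := fun _ => 0

theorem sim_init (n M : ℕ) (ε : ℝ) : Sim n M (St.init n ε) (init n ε) :=
  ⟨fun _ _ => rfl, rfl, fun _ _ _ _ _ _ => rfl, fun _ _ _ _ _ _ => rfl, fun _ _ => rfl⟩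

theorem lvl_bot (lev : Fin n → ℕ) (v u : Fin n) : lvl ⊥ lev v u = none := by simp [lvl]

theorem wt_bot (δ : ℝ) (lev : Fin n → ℕ) (v : Fin n) : wt δ (lvl ⊥ lev) v = 0 := by
  simp [wt, lvl_bot, val]

/-- Zero memory already represents the empty graph with all nodes on level 0: counters and weights
are 0, the stored scale is 1 - 1, and no node is saturated because 0 < 1 - 12δ. -/
theorem idle_init (hδ : 0 < 1 - 12 * δ) : 
    Idle δ (St.init n (64 * δ)) (⊥ : SimpleGraph (Fin n)) fun _ => 0 := by
  refine ⟨by simp [St.init], by simp [St.init], by simp [St.init], by simp [St.init],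
    ⟨⟨fun v u j h => ?_, fun v j p h => ?_⟩, fun _ => rfl, fun v u j h => ?_, fun v => ?_,
    fun v => ?_, fun v h => ?_, fun _ _ => rfl⟩⟩
  · rw [lvl_bot] at h; cases h
  · simp [St.init] at h
  · rw [lvl_bot] at h; cases h
  · rw [wt_bot]; rfl
  · simp [St.init]
  · rw [wt_bot] at h; linarith

theorem stable_bot : Stable δ (⊥ : SimpleGraph (Fin n)) fun _ => 0 := by
  refine ⟨fun v => ?_, fun v => ?_, fun v hv => absurd rfl hv⟩
  · have : (1 : ℝ) ≤ n := by exact_mod_cast v.pos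
    rw [pow_zero]; linarith
  · rw [wt_bot]; norm_num

/-- Words of `40 log ((n + 2) / ε)` bits are long enough. -/
theorem exists_env {ε : ℝ} (h0 : 0 < ε) (h1 : ε < 1) (hδ : δ = ε / 64) (hK : K = 4000 / δ ^ 2)
    (hB : (((n : ℝ) + 2) / ε) ^ 40 ≤ (B : ℝ)) :
    ∃ M, Env n M δ K (6 * K * ((n : ℝ) + 2) ^ 2 + 6 * K + 201) ∧ Fits n M B := by
  set X : ℝ := ((n : ℝ) + 2) / ε with hX
  have hn0 : (0 : ℝ) ≤ n := Nat.cast_nonneg n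
  have hXe : X * ε = n + 2 := by rw [hX]; field_simp
  have hXn : (n : ℝ) + 2 ≤ X := by rw [hX, le_div_iff₀ h0]; nlinarith
  have hX2 : 2 ≤ X := by linarith
  have hεX : 1 ≤ X * ε := by linarith
  have hδ0 : 0 < δ := by rw [hδ]; positivity
  have hKε : K * ε ^ 2 = 16384000 := by
    rw [hK, hδ]; field_simp; norm_num
  have hK0 : 0 ≤ K := by rw [hK]; positivity
  have hKX : K ≤ 16384000 * X ^ 2 := by
    have : 1 ≤ X ^ 2 * ε ^ 2 := by rw [← mul_pow]; exact one_le_pow₀ hεX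
    calc K = K * 1 := by ring
      _ ≤ K * (X ^ 2 * ε ^ 2) := mul_le_mul_of_nonneg_left this hK0
      _ = K * ε ^ 2 * X ^ 2 := by ring
      _ = _ := by rw [hKε]
  have p2 : 4 ≤ X ^ 2 := by nlinarith
  have p4 : X ^ 2 * 4 ≤ X ^ 4 := by nlinarith
  have p1 : X * 8 ≤ X ^ 4 := by nlinarith
  have hψ : 6 * K * ((n : ℝ) + 2) ^ 2 + 6 * K + 201 ≤ 2 ^ 28 * X ^ 4 := by
    have e1 : ((n : ℝ) + 2) ^ 2 ≤ X ^ 2 := pow_le_pow_left₀ (by linarith) hXn 2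
    have e2 : K * ((n : ℝ) + 2) ^ 2 ≤ 16384000 * X ^ 2 * X ^ 2 :=
      mul_le_mul hKX e1 (by positivity) (by positivity)
    nlinarith
  -- Stacks have at most ψ/100 ≤ 2²⁸X⁴/100 < 2²²X⁴ entries, and 2²³X⁴ leaves room for n more as well
  -- as for the rows of the buckets.
  set M : ℕ := ⌈2 ^ 23 * X ^ 4⌉₊ with hM
  have hM1 : 2 ^ 23 * X ^ 4 ≤ M := Nat.le_ceil _
  have hM2 : (M : ℝ) ≤ 2 ^ 24 * X ^ 4 := by
    have := (Nat.ceil_lt_add_one (show 0 ≤ 2 ^ 23 * X ^ 4 by positivity)).le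
    rw [← hM] at this
    linarith
  -- Addresses are of the order 8Mn ≤ 2²⁷X⁵. Since X ≥ 2, the constant 2²⁸ is at most X²⁸, so the
  -- exponent 33 would suffice; 40 is a round choice.
  have hBX : 2 ^ 28 * X ^ 5 ≤ (B : ℝ) := by
    refine le_trans ?_ hB
    have : (2 : ℝ) ^ 28 ≤ X ^ 28 := pow_le_pow_left₀ (by norm_num) hX2 28
    calc 2 ^ 28 * X ^ 5 ≤ X ^ 28 * X ^ 5 := mul_le_mul_of_nonneg_right this (by positivity)
      _ = X ^ 33 := by ring
      _ ≤ X ^ 40 := pow_le_pow_right₀ (by linarith) (by norm_num)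
  have p5 : X ^ 4 * 2 ≤ X ^ 5 := by
    calc X ^ 4 * 2 ≤ X ^ 4 * X := mul_le_mul_of_nonneg_left hX2 (by positivity)
      _ = X ^ 5 := by ring
  refine ⟨M, ⟨?_, ?_, hδ0, by rw [hδ]; linarith, hK0, ?_, fun l hl => ?_, fun m hm => ?_⟩,
    ⟨?_, ?_, ?_, ?_⟩⟩
  · have : (n : ℝ) < M := by linarith
    exact_mod_cast this
  · have : (64 : ℝ) < M := by linarith
    exact_mod_cast this
  · rw [hK]
    have : δ ≠ 0 := hδ0.ne'
    field_simp
    norm_num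
  -- Bernoulli's inequality turns (1+δ)^l ≤ 2n into lδ ≤ 2n, that is, l ≤ 128n/ε. This is coarser
  -- than a logarithmic bound but polynomial, which is all that the memory needs.
  · have e1 := one_add_mul_le_pow (show (-2 : ℝ) ≤ δ by linarith) l
    have e2 : (l : ℝ) * ε ≤ 128 * n := by rw [hδ] at e1 hl; linarith
    have e3 : (l : ℝ) ≤ 128 * X := by
      refine le_of_mul_le_mul_right ?_ h0
      rw [mul_assoc, hXe]; linarith
    have : ((l : ℝ) + 2) * n ≤ M := by
      calc ((l : ℝ) + 2) * n ≤ (128 * X + 2) * X :=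
            mul_le_mul (by linarith) (by linarith) hn0 (by positivity)
        _ ≤ M := by nlinarith
    exact_mod_cast this
  · have : (m : ℝ) + n < M := by linarith
    exact_mod_cast this
  · have e1 : (M : ℝ) * n ≤ 2 ^ 24 * X ^ 4 * X := mul_le_mul hM2 (by linarith) hn0 (by positivity)
    have : 8 * ((M : ℝ) * n) + n ≤ B := by
      rw [show 2 ^ 24 * X ^ 4 * X = 2 ^ 24 * X ^ 5 by ring] at e1
      linarith
    exact_mod_cast this
  · have e1 : (n : ℝ) * n ≤ X * X := mul_le_mul (by linarith) (by linarith) hn0 (by linarith)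
    have : 3 * ((n : ℝ) * n) ≤ B := by nlinarith
    exact_mod_cast this
  · have : (M : ℝ) ≤ B := by linarith
    exact_mod_cast this
  · have : (9 : ℝ) < B := by linarith
    exact_mod_cast this

theorem pot_le_of_stable (hK : 0 ≤ K) (h0 : 0 < δ) (h1 : δ ≤ 1 / 64) {G : SimpleGraph (Fin n)}
    {lev : Fin n → ℕ} (S : Stable δ G lev) :
    pot K δ G lev (fun _ => 0) ≤ 6 * K * ((n : ℝ) + 2) ^ 2 := by
  have hn0 : (0 : ℝ) ≤ n := Nat.cast_nonneg n
  refine pot_le hK h0 h1 G lev _ (by rw [Fintype.card_fin]; linarith) (by linarith)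
    (fun _ => ⟨le_rfl, zero_le_one⟩) fun v => (S.levels v).trans ?_
  linarith

end

end RAM

theorem theorem1 :
    ∃ (P : RAM.Program) (c : ℕ) (C : ℝ),
      ∀ ε : ℝ, 0 < ε → ε < 1 →
        ∀ n w : ℕ, (((n : ℝ) + 2) / ε) ^ c ≤ (2 : ℝ) ^ w →
          ∀ us : List (EdgeUpdate (Fin n)),
            EdgeUpdate.LegalSeq (⊥ : SimpleGraph (Fin n)) us →
              ∃ (t : ℕ) (m : RAM.Config),
                RAM.Handles (2 ^ w) P (RAM.init n ε) us t m ∧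
                (t : ℝ) ≤ C * (us.length : ℝ) / ε ^ 2 ∧
                IsApproxMinVertexCover (2 + ε) (EdgeUpdate.applySeq ⊥ us) (m.nodes n) ∧
                ∃ x : Sym2 (Fin n) → ℝ,
                  m.HoldsWeights (EdgeUpdate.applySeq ⊥ us) x ∧
                  IsApproxMaxFractionalMatching (2 + ε) (EdgeUpdate.applySeq ⊥ us) x := by
  -- Here 16384000 = 4000·64² is the value of Kε². The amortized time of an update is 6K + 320
  -- structured steps, each of at most 8 machine instructions.
  refine ⟨RAM.program, 40, 8 * (6 * 16384000 + 320), fun ε h0 h1 n w hw us hus => ?_⟩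
  obtain ⟨δ, hδ⟩ : ∃ δ, δ = ε / 64 := ⟨_, rfl⟩
  obtain ⟨K, hK⟩ : ∃ K, K = 4000 / δ ^ 2 := ⟨_, rfl⟩
  obtain ⟨M, env, hB⟩ := RAM.exists_env (B := 2 ^ w) h0 h1 hδ hK (by exact_mod_cast hw)
  have hδ1 : 0 < 1 - 12 * δ := by linarith
  -- With 12δ = 3ε/16 the product exceeds 2 by 5ε/8 - 3ε²/16, which is positive for ε < 1.
  have hα : 2 ≤ (2 + ε) * (1 - 12 * δ) := by rw [hδ]; nlinarith
  have hε : 64 * δ = ε := by linarith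
  obtain ⟨t, d, s, lev, k1, k2, k3, k4, k5⟩ := RAM.handles env hB
    (fun G lev S => by linarith [RAM.pot_le_of_stable env.K_nonneg env.pos env.le S]) us
    (RAM.idle_init hδ1) RAM.stable_bot (RAM.sim_init n M (64 * δ)) hus
  rw [hε] at k1
  refine ⟨t, d, k1, ?_, ?_, RAM.edgeWeight δ lev, k2.holdsWeights k4,
    k3.approx_matching env.pos hδ1 hα⟩
  · rw [DynCover.pot_bot env.le] at k5
    have hp := DynCover.pot_nonneg env.K_nonneg env.pos env.le (EdgeUpdate.applySeq ⊥ us) lev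
      fun _ => 0
    have hKε : K * ε ^ 2 = 16384000 := by
      rw [hK, hδ]; field_simp; norm_num
    have hl : (0 : ℝ) ≤ us.length := Nat.cast_nonneg _
    rw [le_div_iff₀ (by positivity)]
    have hε2 : ε ^ 2 ≤ 1 := pow_le_one₀ h0.le h1.le
    calc (t : ℝ) * ε ^ 2 ≤ us.length * (8 * (6 * K + 320)) * ε ^ 2 :=
          mul_le_mul_of_nonneg_right (by linarith) (by positivity)
      _ = us.length * (8 * (6 * (K * ε ^ 2) + 320 * ε ^ 2)) := by ring
      _ ≤ us.length * (8 * (6 * 16384000 + 320)) := by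
          apply mul_le_mul_of_nonneg_left _ hl
          rw [hKε]; linarith
      _ = _ := by ring
  · rw [k2.nodes_eq k4]
    exact k3.approx_cover env.pos hδ1 hα
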